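/- Let $s>1$ be real, let $A_n=\frac{\Gamma(sn+1)}{\Gamma((s-1)n+2)\,\Gamma(n+1)}$ be the Fuss–Catalan numbers, $f_n=\sqrt{A_n}$, and consider the Z-Hamiltonian system $$ i\,\dot\alpha_n=\sum_{\substack{m,k,j\ge 0\\ k+j=n+m}} C_{nmkj}\,\bar\alpha_m\alpha_k\alpha_j,\qquad C_{nmkj}=\Big(\tfrac{s-1}{2}(n+m)+1\Big)\frac{f_nf_mf_kf_j}{f_{n+m}^2},\qquad n\ge 0. $$ A solution on an interval means a family of differentiable functions $\alpha_n$ satisfying these equations, for which, for some $\xi>3/2$, the Sobolev norm $H^{\xi}=\big(\sum_n (n+1)^{2\xi}|\alpha_n|^2\big)^{1/2}$ is bounded on compact subintervals. Put $N=\sum_n|\alpha_n|^2$, $E=\sum_n n|\alpha_n|^2$, $x_c=(s-1)^{s-1}/s^s$, $F(x)=\sum_{n\ge1}f_n^2x^n$ and $F_c=F(x_c)$. Consider data on the manifold $\alpha_0=b$, $\alpha_n=f_n\,c\,p^{\,n-1}$ $(n\ge1)$ with $b,c,p\in\mathbb C$, $x=|p|^2<x_c$ and $c\ne0$ (equivalently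 $E>0$; then also $N>0$), and set, with $F=F(|p|^2)$, $$ S=\frac{2s}{F+1}\Big(N+\frac{F-1}{F+1}\big(1-(s-1)F\big)E+(F+1)^s\,(bp\bar c+\bar b\bar pc)\Big). $$ Then $F_c=\frac1{s-1}$, a solution passing through such data is unique on every interval, and the following hold. 1. (Criterion.) Data on the manifold condense in finite time (there are $0<T'<\infty$ and a solution on $[0,T')$ starting from the data with $|\alpha_n(t)|^2\to N\delta_{n0}$ for every $n$ as $t\to T'$) if and only if $S=2(s-1)N$. If $S\neq 2(s-1)N$, the solution is global in time, remains on the manifold, and $F(|p(t)|^2)\le F_c-\delta$ for all $t\in\mathbb R$, for some $\delta>0$. 2. (Every energy per particle.) For all $N>0$ and $E>0$ put $D=(N-sE)^2+(s-1)(N+sE)^2$ and $F_0=\frac{(N-sE)^2}{(N+sE)^2}F_c$. The data $$ p=\frac{sE-N}{\sqrt{s-1}\,(N+sE)}\Big(\frac{(s-1)(N+sE)^2}{D}\Big)^{s/2},\quad b=(N+(s-2)E)\Big(\frac{sN}{D}\Big)^{1/2},\quad c=2E(sN)^{1/2}(N+sE)^s\Big(\frac{s-1}{D}\Big)^{(s+1)/2}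 $$ satisfy $|p|^2<x_c$ and $c\ne0$, have particle number $N$ and energy $E$, satisfy $S=2(s-1)N$, and have $F(|p|^2)=F_0$. 3. (Explicit solution and blow-up.) Let $N,E>0$, $\Omega=\sqrt{D/(4s)}$, $T=\frac{\pi}{2\Omega}$ and $$ F(t)=\frac{sF_0+\left(1-\frac{F_0}{F_c}\right)\sin^2(\Omega t)}{s-\left(1-\frac{F_0}{F_c}\right)\sin^2(\Omega t)}. $$ For any data $(b,c,p)$ on the manifold with particle number $N$, energy $E$ and $S=2(s-1)N$ there are $t_0\in(-T,T)$ and a solution on $(-T,T)$ of the form $\alpha_0=b(t)$, $\alpha_n=f_nc(t)p(t)^{n-1}$ which passes through the data at $t=t_0$ and satisfies, for all $t\in(-T,T)$, $x(t):=|p(t)|^2<x_c$ and $$ F(x(t))=F(t),\quad x(t)=\frac{F(t)}{(1+F(t))^s},\quad |b(t)|^2=N-\frac{E}{F(t)+1}\Big(1-\frac{F(t)}{F_c}\Big),\quad |c(t)|^2=\frac{E}{(F(t)+1)^{s+1}}\Big(1-\frac{F(t)}{F_c}\Big); $$ all its norms $H^\xi$, $\xi\in\mathbb R$, are finite for $t\in(-T,T)$.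 As $t\to T^-$: * $F(t)\to F_c$, $x(t)\to x_c$, and $|\alpha_n(t)|^2\to N\delta_{n0}$ for every $n$; * a $-3/2$ power-law spectrum develops: with a constant $\kappa>0$ depending only on $s$, $|\alpha_n(t)|^2=\kappa\,(1+o(1))\,|c(t)|^2\,n^{-3/2}\,(x(t)/x_c)^{n-1}$ as $n\to\infty$, uniformly in $t\in(-T,T)$, where $|c(t)|^2\sim C_1(T-t)^2$ and $1-x(t)/x_c\sim C_2(T-t)^4$ as $t\to T^-$, with constants $C_1,C_2>0$ depending only on $s,N,E$; * for every $\xi>1/2$, $H^\xi(\alpha(t))\sim \tilde C\,(T-t)^{2(1-2\xi)}$ with a constant $\tilde C>0$ depending only on $s,N,E,\xi$. -/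

import Mathlib

open Filter Topology

noncomputable section

namespace ZHam

/-- The Fuss-Catalan number `A_n^{(s)} = Γ(sn+1) / (Γ((s-1)n+2) Γ(n+1))` with real parameter `s`. -/
def fussCatalan (s : ℝ) (n : ℕ) : ℝ :=
  Real.Gamma (s * n + 1) / (Real.Gamma ((s - 1) * n + 2) * Real.Gamma ((n : ℝ) + 1))

/-- `f_n = √A_n^{(s)}`. -/
def f (s : ℝ) (n : ℕ) : ℝ := Real.sqrt (fussCatalan s n)

/-- The couplings `C_{nmkj}` of the Z-Hamiltonian system
(they only enter at indices with `n + m = k + j`). -/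
def coupling (s : ℝ) (n m k j : ℕ) : ℝ :=
  ((s - 1) / 2 * ((n : ℝ) + m) + 1) * (f s n * f s m * f s k * f s j / f s (n + m) ^ 2)

/-- The inner sum, over all `(k, j)` with `k + j = n + m`, of the right-hand side of the
resonant equation. -/
def interaction (s : ℝ) (a : ℕ → ℂ) (n m : ℕ) : ℂ :=
  ∑ kj ∈ Finset.HasAntidiagonal.antidiagonal (n + m),
    (coupling s n m kj.1 kj.2 : ℂ) * (starRingEnd ℂ) (a m) * a kj.1 * a kj.2

/-- The terms of the series defining the square of the Sobolev norm `H^ξ`. -/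
def sobolevTerm (ξ : ℝ) (a : ℕ → ℂ) (n : ℕ) : ℝ :=
  ((n : ℝ) + 1) ^ (2 * ξ) * ‖a n‖ ^ 2

/-- The Sobolev norm `H^ξ = (∑ (n+1)^{2ξ} |α_n|²)^{1/2}`. -/
def sobolevNorm (ξ : ℝ) (a : ℕ → ℂ) : ℝ := Real.sqrt (∑' n, sobolevTerm ξ a n)

/-- `α` is a solution of the Z-Hamiltonian system `i α_n' = ∑ C_{nmkj} ᾱ_m α_k α_j` on the
interval `I`, in the class in which the system is well posed: for some `ξ > 3/2` the `H^ξ` norm is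
bounded on compact subsets of `I`. The equation is written as `α_n' = -i ∑ C_{nmkj} ᾱ_m α_k α_j`;
at an end point of `I` belonging to `I` the derivative is one-sided. -/
def IsSolutionOn (s : ℝ) (α : ℝ → ℕ → ℂ) (I : Set ℝ) : Prop :=
  (∃ ξ : ℝ, 3 / 2 < ξ ∧ ∀ K : Set ℝ, K ⊆ I → IsCompact K → ∃ M : ℝ, ∀ t ∈ K,
      Summable (sobolevTerm ξ (α t)) ∧ ∑' n, sobolevTerm ξ (α t) n ≤ M) ∧
  ∀ t ∈ I, ∀ n : ℕ,
    Summable (fun m => interaction s (α t) n m) ∧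
    HasDerivWithinAt (fun τ => α τ n) (-Complex.I * ∑' m, interaction s (α t) n m) I t

/-- The particle number `N = ∑ |α_n|²`. -/
def particleNumber (a : ℕ → ℂ) : ℝ := ∑' n, ‖a n‖ ^ 2

/-- The energy `E = ∑ n |α_n|²`. -/
def energy (a : ℕ → ℂ) : ℝ := ∑' n : ℕ, (n : ℝ) * ‖a n‖ ^ 2

/-- A point of the manifold: `α_0 = b` and `α_n = f_n c p^{n-1}` for `n ≥ 1`. -/
def ansatz (s : ℝ) (b c p : ℂ) : ℕ → ℂ
  | 0 => b
  | n + 1 => (f s (n + 1) : ℂ) * c * p ^ n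

/-- `x_c = (s-1)^{s-1} / s^s`. -/
def xc (s : ℝ) : ℝ := (s - 1) ^ (s - 1) / s ^ s

/-- The generating function `F(x) = ∑_{n ≥ 1} f_n² x^n`. -/
def genF (s x : ℝ) : ℝ := ∑' n : ℕ, f s (n + 1) ^ 2 * x ^ (n + 1)

/-- `F_c = F(x_c)`. -/
def Fc (s : ℝ) : ℝ := genF s (xc s)

/-- The conserved quantity `S` at the point of the manifold with parameters `b, c, p`, namely
`S = 2s/(F+1) (N + (F-1)/(F+1) (1-(s-1)F) E + (F+1)^s (b p c̄ + b̄ p̄ c))` with `F = F(|p|²)`. -/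
def Sval (s : ℝ) (b c p : ℂ) : ℝ :=
  2 * s / (genF s (‖p‖ ^ 2) + 1) *
    (particleNumber (ansatz s b c p)
      + (genF s (‖p‖ ^ 2) - 1) / (genF s (‖p‖ ^ 2) + 1)
          * (1 - (s - 1) * genF s (‖p‖ ^ 2)) * energy (ansatz s b c p)
      + (genF s (‖p‖ ^ 2) + 1) ^ s *
          (b * p * (starRingEnd ℂ) c + (starRingEnd ℂ) b * (starRingEnd ℂ) p * c).re)

/-- `|α_n(t)|² → N δ_{n0}` for every `n`, as `t → T` from below. -/
def CondensesAt (α : ℝ → ℕ → ℂ) (N T : ℝ) : Prop :=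
  ∀ n : ℕ, Tendsto (fun t => ‖α t n‖ ^ 2) (𝓝[<] T) (𝓝 (if n = 0 then N else 0))

/-- The evolution of the initial datum `a` condenses in finite time. -/
def CondensesInFiniteTime (s : ℝ) (a : ℕ → ℂ) : Prop :=
  ∃ T : ℝ, 0 < T ∧ ∃ α : ℝ → ℕ → ℂ,
    IsSolutionOn s α (Set.Ico 0 T) ∧ α 0 = a ∧ CondensesAt α (particleNumber a) T

/-- `F_0 = (N - sE)² / (N + sE)² F_c`. -/
def F0 (s N E : ℝ) : ℝ := (N - s * E) ^ 2 / (N + s * E) ^ 2 * Fc s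

/-- `Ω = √(((N - sE)² + (s-1)(N + sE)²) / (4s))`. -/
def Omega (s N E : ℝ) : ℝ :=
  Real.sqrt (((N - s * E) ^ 2 + (s - 1) * (N + s * E) ^ 2) / (4 * s))

/-- The condensation time `T = π / (2Ω)` of the explicit solution. -/
def Tc (s N E : ℝ) : ℝ := Real.pi / (2 * Omega s N E)

/-- The explicit solution `F(t)`. -/
def Fsol (s N E t : ℝ) : ℝ :=
  (s * F0 s N E + (1 - F0 s N E / Fc s) * Real.sin (Omega s N E * t) ^ 2) /
    (s - (1 - F0 s N E / Fc s) * Real.sin (Omega s N E * t) ^ 2)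

/-- The explicit initial value `p(0)`. -/
def pInit (s N E : ℝ) : ℝ :=
  (s * E - N) / (Real.sqrt (s - 1) * (N + s * E)) *
    ((s - 1) * (N + s * E) ^ 2 / ((N - s * E) ^ 2 + (s - 1) * (N + s * E) ^ 2)) ^ (s / 2)

/-- The explicit initial value `b(0)`. -/
def bInit (s N E : ℝ) : ℝ :=
  (N + (s - 2) * E) *
    (s * N / ((N - s * E) ^ 2 + (s - 1) * (N + s * E) ^ 2)) ^ (1 / 2 : ℝ)

/-- The explicit initial value `c(0)`. -/
def cInit (s N E : ℝ) : ℝ :=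
  2 * E * (s * N) ^ (1 / 2 : ℝ) * (N + s * E) ^ s *
    ((s - 1) / ((N - s * E) ^ 2 + (s - 1) * (N + s * E) ^ 2)) ^ ((s + 1) / 2)

end ZHam

end

/-!
The data `α_0 = b`, `α_n = f_n c p^{n-1}` form an invariant manifold because of the Rothe–Hagen
convolution identity for the Fuss–Catalan numbers `A_n` (`raney_convolution`,
`fussCatalan_convolution`), which are values of the Raney polynomials.
With them the interaction sums are evaluated in closed form on the manifold
(`hasSum_interaction_zero`, `hasSum_interaction_succ`), and the generating function satisfies
`F = x (1 + F)^s` (`genF_eq`); hence `F` is the inverse of `F / (1 + F)^s` on `[0, 1/(s-1)]`, and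
`F_c = 1/(s-1)`.

In the variables `u = p (1 + F)^{s/2}`, `v = c (1 + F)^{s/2}`, for which `|u|² = F`, the motion on
the manifold is a system of three ordinary differential equations for `b, u, v` whose right-hand
sides are polynomials in the variables and their conjugates. Its conservation laws bound all three
variables, so the flow is global (`exists_gaugeFlow`), and it gives solutions of the original system
as long as `F < F_c` (`IsGaugeSolution.isSolutionOn`).
The variable `y = 1/(1 + F)` performs a harmonic motion (`IsGaugeSolution.gaugeY_deriv_sq`,
`IsGaugeSolution.hasDerivAt_gaugeY_deriv`). It reaches its critical value `(s-1)/s` exactly when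
`v` vanishes. Since `S - 2(s-1)N` is bounded by a multiple of `|v|`, this needs `S = 2(s-1)N`
(`IsGaugeSolution.exists_le_normSq_v`), and in that case the motion is the explicit one up to a
translation in time (`IsGaugeSolution.exists_gaugeY_eq`).

Uniqueness in the class of solutions with bounded `H^ξ` norm, `ξ > 3/2`, is a Grönwall estimate
for the `ℓ²` norm of the difference of two solutions; the terms that would lose a derivative drop
out because the couplings are symmetric (`abs_im_quartic_sub_le`, `isSolutionOn_unique`).

Stirling's formula gives `A_n ~ const · n^{-3/2} x_c^{-n}` (`tendsto_fussCatalan`) and therefore the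
spectrum. At `T` the variable `y` reaches the critical value to second order, so that `|c|²`, which
is linear in `y - y_c`, vanishes to second order and `1 - x/x_c`, which is quadratic, to fourth
order. An Abelian theorem obtained by comparison with the binomial series
(`tendsto_one_sub_rpow_mul_tsum`) turns this into the growth of the Sobolev norms
(`tendsto_sobolevNorm`).
-/

noncomputable section

namespace ZHam

/-! ### Raney numbers and the Rothe–Hagen convolution identity -/

/-- The Raney number `A_n(s, r) = r / (s n + r) * binom (s n + r) n` as a polynomial in `r`. For
`r = 1` it is the Fuss–Catalan number; `∑ A_n(s, r) x ^ n` is the `r`-th power of the generating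
function of the Fuss–Catalan numbers. -/
def raneyPoly (s : ℝ) : ℕ → Polynomial ℝ
  | 0 => 1
  | n + 1 => Polynomial.C (1 / ((n + 1).factorial : ℝ)) * Polynomial.X *
      ∏ i ∈ Finset.range n, (Polynomial.X + Polynomial.C (s * (n + 1) - (i + 1)))

/-- The value of `raneyPoly s n` at `r`. -/
def raney (s : ℝ) (n : ℕ) (r : ℝ) : ℝ := (raneyPoly s n).eval r

lemma raney_zero (s r : ℝ) : raney s 0 r = 1 := by simp [raney, raneyPoly]

lemma raney_succ (s : ℝ) (n : ℕ) (r : ℝ) : raney s (n + 1) r =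
    1 / ((n + 1).factorial : ℝ) * r * ∏ i ∈ Finset.range n, (r + (s * (n + 1) - (i + 1))) := by
  simp [raney, raneyPoly, Polynomial.eval_prod]

lemma raney_succ_at_zero (s : ℝ) (n : ℕ) : raney s (n + 1) 0 = 0 := by
  simp [raney_succ]

/-- The coefficient form of `G ^ (r + 1) - G ^ r = x G ^ (r + s)`. -/
lemma raney_succ_sub (s : ℝ) (n : ℕ) (r : ℝ) :
    raney s (n + 1) (r + 1) - raney s (n + 1) r = raney s n (r + s) := by
  cases n with
  | zero => simp [raney_succ, raney_zero]
  | succ n =>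
    rw [raney_succ, raney_succ, raney_succ, Finset.prod_range_succ', Finset.prod_range_succ]
    have e1 : ∀ i ∈ Finset.range n,
        (r + 1 + (s * (((n + 1 : ℕ) : ℝ) + 1) - (((i + 1 : ℕ) : ℝ) + 1)))
          = r + s + (s * ((n : ℝ) + 1) - ((i : ℝ) + 1)) := by
      intro i _; push_cast; ring
    have e2 : ∀ i ∈ Finset.range n,
        (r + (s * (((n + 1 : ℕ) : ℝ) + 1) - ((i : ℝ) + 1)))
          = r + s + (s * ((n : ℝ) + 1) - ((i : ℝ) + 1)) := by
      intro i _; push_cast; ring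
    rw [Finset.prod_congr rfl e1, Finset.prod_congr rfl e2, Nat.factorial_succ (n + 1)]
    have h : ((n + 1).factorial : ℝ) ≠ 0 := by positivity
    have h2 : (n : ℝ) + 1 + 1 ≠ 0 := by positivity
    push_cast
    field_simp
    ring

/-- A polynomial vanishing at all natural numbers vanishes. -/
lemma polynomial_eq_zero_of_eval_nat (P : Polynomial ℝ) (h : ∀ k : ℕ, P.eval (k : ℝ) = 0) :
    P = 0 := by
  apply Polynomial.eq_zero_of_infinite_isRoot
  exact (Set.infinite_range_of_injective (Nat.cast_injective (R := ℝ))).mono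
    (by rintro _ ⟨k, rfl⟩; exact h k)

/-- The **Rothe–Hagen identity**. Both sides are polynomials in `r` with the same difference
`r ↦ r + 1` (by induction on `n`) and the same value at `0`, so they agree at all natural
numbers. -/
theorem raney_convolution (s : ℝ) (n : ℕ) (r t : ℝ) :
    ∑ q ∈ Finset.HasAntidiagonal.antidiagonal n, raney s q.1 r * raney s q.2 t
      = raney s n (r + t) := by
  induction n generalizing r with
  | zero => simp [raney_zero]
  | succ n ih =>
    set P : Polynomial ℝ :=
      (∑ q ∈ Finset.HasAntidiagonal.antidiagonal (n + 1),
          raneyPoly s q.1 * Polynomial.C (raney s q.2 t))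
        - (raneyPoly s (n + 1)).comp (Polynomial.X + Polynomial.C t) with hP
    have ev : ∀ r, P.eval r =
        (∑ q ∈ Finset.HasAntidiagonal.antidiagonal (n + 1), raney s q.1 r * raney s q.2 t)
        - raney s (n + 1) (r + t) := by
      intro r
      simp [hP, Polynomial.eval_finsetSum, raney]
    have step : ∀ r, P.eval (r + 1) - P.eval r = 0 := by
      intro r
      rw [ev, ev, Finset.Nat.antidiagonal_succ, Finset.sum_cons, Finset.sum_cons, Finset.sum_map,
        Finset.sum_map]
      simp only [Function.Embedding.prodMap, Function.Embedding.coeFn_mk, Prod.map,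
        Function.Embedding.refl_apply, raney_zero]
      have h1 := ih (r + s)
      have h2 := raney_succ_sub s n (r + t)
      have h3 : ∑ q ∈ Finset.HasAntidiagonal.antidiagonal n,
            raney s (Nat.succ q.1) (r + 1) * raney s q.2 t
          - ∑ q ∈ Finset.HasAntidiagonal.antidiagonal n, raney s (Nat.succ q.1) r * raney s q.2 t
          = raney s n (r + s + t) := by
        rw [← h1, ← Finset.sum_sub_distrib]
        refine Finset.sum_congr rfl fun q _ => ?_
        rw [← raney_succ_sub s q.1 r, sub_mul]
      rw [show r + 1 + t = r + t + 1 by ring]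
      rw [show r + t + s = r + s + t by ring] at h2
      linarith
    have h0 : P.eval 0 = 0 := by
      rw [ev, Finset.Nat.antidiagonal_succ, Finset.sum_cons, Finset.sum_map]
      simp [raney_zero, raney_succ_at_zero]
    have hz : P = 0 := by
      apply polynomial_eq_zero_of_eval_nat
      intro k
      induction k with
      | zero => simpa using h0
      | succ k ihk => have := step k; push_cast; linarith
    have := ev r
    rw [hz] at this
    simp at this
    linarith

lemma raney_nonneg {s : ℝ} (hs : 1 < s) (n : ℕ) {r : ℝ} (hr : 0 ≤ r) : 0 ≤ raney s n r := by
  cases n with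
  | zero => simp [raney_zero]
  | succ n =>
    rw [raney_succ]
    refine mul_nonneg (by positivity) (Finset.prod_nonneg fun i hi => ?_)
    have h1 : (i : ℝ) + 1 ≤ n := by exact_mod_cast Finset.mem_range.mp hi
    nlinarith [(Nat.cast_nonneg n : (0 : ℝ) ≤ n)]

lemma raney_mono {s : ℝ} (hs : 1 < s) (n : ℕ) {r t : ℝ} (hr : 0 ≤ r) (hrt : r ≤ t) :
    raney s n r ≤ raney s n t := by
  cases n with
  | zero => simp [raney_zero]
  | succ n =>
    rw [raney_succ, raney_succ]
    have hpos : ∀ i ∈ Finset.range n, 0 ≤ r + (s * ((n : ℝ) + 1) - ((i : ℝ) + 1)) := by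
      intro i hi
      have h1 : (i : ℝ) + 1 ≤ n := by exact_mod_cast Finset.mem_range.mp hi
      nlinarith [(Nat.cast_nonneg n : (0 : ℝ) ≤ n)]
    refine mul_le_mul (by gcongr) (Finset.prod_le_prod hpos fun i _ => by linarith)
      (Finset.prod_nonneg hpos) (mul_nonneg (by positivity) (by linarith))

/-! ### Fuss–Catalan numbers -/

lemma gamma_eq_prod_mul_gamma (n : ℕ) (z : ℝ) (h : (n : ℝ) ≤ z) :
    Real.Gamma (z + 1) = (∏ i ∈ Finset.range n, (z - i)) * Real.Gamma (z + 1 - n) := by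
  induction n with
  | zero => simp
  | succ n ih =>
    push_cast at h
    rw [ih (by linarith), Finset.prod_range_succ]
    have h1 : z - n ≠ 0 := by intro h0; linarith
    rw [show z + 1 - (n : ℝ) = (z - n) + 1 by ring, Real.Gamma_add_one h1]
    push_cast
    rw [show z + 1 - ((n : ℝ) + 1) = z - n by ring]
    ring

lemma fussCatalan_eq_raney {s : ℝ} (hs : 1 < s) (n : ℕ) : fussCatalan s n = raney s n 1 := by
  cases n with
  | zero => simp [fussCatalan, raney_zero]
  | succ n =>
    have hn : (0 : ℝ) ≤ n := Nat.cast_nonneg n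
    have h := gamma_eq_prod_mul_gamma n (s * ((n : ℝ) + 1)) (by nlinarith)
    have hg : 0 < Real.Gamma (s * ((n : ℝ) + 1) + 1 - n) := Real.Gamma_pos_of_pos (by nlinarith)
    rw [fussCatalan, raney_succ, Real.Gamma_nat_eq_factorial]
    push_cast
    rw [h, show (s - 1) * ((n : ℝ) + 1) + 2 = s * ((n : ℝ) + 1) + 1 - n by ring]
    have e : ∀ i ∈ Finset.range n, (1 + (s * ((n : ℝ) + 1) - ((i : ℝ) + 1)))
        = s * ((n : ℝ) + 1) - i := fun i _ => by ring
    rw [Finset.prod_congr rfl e]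
    field_simp

lemma fussCatalan_pos {s : ℝ} (hs : 1 < s) (n : ℕ) : 0 < fussCatalan s n := by
  have hn : (0 : ℝ) ≤ n := Nat.cast_nonneg n
  have h1 := mul_nonneg (sub_nonneg.2 hs.le) hn
  refine div_pos (Real.Gamma_pos_of_pos (by nlinarith)) (mul_pos ?_ ?_) <;>
    exact Real.Gamma_pos_of_pos (by linarith)

lemma f_pos {s : ℝ} (hs : 1 < s) (n : ℕ) : 0 < f s n := Real.sqrt_pos.2 (fussCatalan_pos hs n)

lemma f_sq {s : ℝ} (hs : 1 < s) (n : ℕ) : f s n ^ 2 = fussCatalan s n :=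
  Real.sq_sqrt (fussCatalan_pos hs n).le

lemma fussCatalan_zero {s : ℝ} (hs : 1 < s) : fussCatalan s 0 = 1 := by
  rw [fussCatalan_eq_raney hs, raney_zero]

lemma fussCatalan_one {s : ℝ} (hs : 1 < s) : fussCatalan s 1 = 1 := by
  rw [fussCatalan_eq_raney hs, raney_succ]; simp

lemma f_zero {s : ℝ} (hs : 1 < s) : f s 0 = 1 := by
  rw [f, fussCatalan_zero hs, Real.sqrt_one]

lemma raney_two {s : ℝ} (hs : 1 < s) (n : ℕ) :
    ((s - 1) * n + 2) * raney s n 2 = 2 * (s * n + 1) * fussCatalan s n := by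
  rw [fussCatalan_eq_raney hs]
  cases n with
  | zero => simp [raney_zero]
  | succ n =>
    rw [raney_succ, raney_succ]
    set w := s * ((n : ℝ) + 1) with hw
    have e1 : ∏ i ∈ Finset.range n, (2 + (w - ((i : ℝ) + 1))) = ∏ i ∈ Finset.range n, (w + 1 - i) :=
      Finset.prod_congr rfl fun i _ => by ring
    have e2 : ∏ i ∈ Finset.range n, (1 + (w - ((i : ℝ) + 1))) = ∏ i ∈ Finset.range n, (w - i) :=
      Finset.prod_congr rfl fun i _ => by ring
    have e3 : (∏ i ∈ Finset.range n, (w + 1 - i)) * (w + 1 - n)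
        = (w + 1) * ∏ i ∈ Finset.range n, (w - i) := by
      rw [← Finset.prod_range_succ, Finset.prod_range_succ', mul_comm]
      push_cast
      simp
    rw [e1, e2]
    push_cast
    rw [show (s - 1) * ((n : ℝ) + 1) + 2 = w + 1 - n by rw [hw]; ring, ← hw]
    linear_combination (1 / ((n + 1).factorial : ℝ) * 2) * e3

/-- The convolution square of the Fuss–Catalan sequence; this is why the manifold is invariant. -/
theorem fussCatalan_convolution {s : ℝ} (hs : 1 < s) (n : ℕ) :
    ((s - 1) * n + 2) *
        ∑ q ∈ Finset.HasAntidiagonal.antidiagonal n, fussCatalan s q.1 * fussCatalan s q.2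
      = 2 * (s * n + 1) * fussCatalan s n := by
  rw [← raney_two hs]
  simp only [fussCatalan_eq_raney hs]
  rw [raney_convolution]
  norm_num

lemma fussCatalan_mul_le {s : ℝ} (hs : 1 < s) (n m : ℕ) :
    fussCatalan s n * fussCatalan s m ≤ (2 * s / (s - 1)) * fussCatalan s (n + m) := by
  have h := fussCatalan_convolution hs (n + m)
  have hle : fussCatalan s n * fussCatalan s m ≤
      ∑ q ∈ Finset.HasAntidiagonal.antidiagonal (n + m), fussCatalan s q.1 * fussCatalan s q.2 :=
    Finset.single_le_sum (f := fun q : ℕ × ℕ => fussCatalan s q.1 * fussCatalan s q.2)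
      (fun q _ => (mul_pos (fussCatalan_pos hs _) (fussCatalan_pos hs _)).le)
      (a := (n, m)) (by simp)
  set w := ∑ q ∈ Finset.HasAntidiagonal.antidiagonal (n + m), fussCatalan s q.1 * fussCatalan s q.2
  have hM : (0 : ℝ) ≤ ((n + m : ℕ) : ℝ) := Nat.cast_nonneg _
  set M : ℝ := ((n + m : ℕ) : ℝ)
  have hA := fussCatalan_pos hs (n + m)
  have h1 : 0 < s - 1 := by linarith
  have hden : 0 < (s - 1) * M + 2 := by positivity
  refine hle.trans ?_
  rw [div_mul_eq_mul_div, le_div_iff₀ h1]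
  refine le_of_mul_le_mul_left ?_ hden
  have : ((s - 1) * M + 2) * (w * (s - 1))
      = (s - 1) * (2 * (s * M + 1) * fussCatalan s (n + m)) := by
    rw [← h]; ring
  rw [this]
  have : 0 ≤ fussCatalan s (n + m) * (2 * s + 2) := by positivity
  nlinarith

/-! ### Stirling's formula and the growth of the Fuss–Catalan numbers -/

lemma log_gamma_le (n : ℕ) {θ : ℝ} (h0 : 0 ≤ θ) (h1 : θ ≤ 1) :
    Real.log (Real.Gamma (n + θ + 1)) ≤ Real.log (n.factorial) + θ * Real.log (n + 1) := by
  have hc := Real.convexOn_log_Gamma.2 (x := (n : ℝ) + 1) (y := (n : ℝ) + 2)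
    (by simp only [Set.mem_Ioi]; positivity) (by simp only [Set.mem_Ioi]; positivity)
    (sub_nonneg.2 h1) h0 (by ring)
  simp only [smul_eq_mul, Function.comp] at hc
  rw [show (1 - θ) * ((n : ℝ) + 1) + θ * ((n : ℝ) + 2) = n + θ + 1 by ring,
    Real.Gamma_nat_eq_factorial,
    show (n : ℝ) + 2 = ((n + 1 : ℕ) : ℝ) + 1 by push_cast; ring,
    Real.Gamma_nat_eq_factorial, Nat.factorial_succ] at hc
  push_cast at hc
  rw [Real.log_mul (by positivity) (by positivity)] at hc
  linarith

lemma le_log_gamma {n : ℕ} (hn : 1 ≤ n) {θ : ℝ} (h0 : 0 ≤ θ) :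
    Real.log (n.factorial) + θ * Real.log n ≤ Real.log (Real.Gamma (n + θ + 1)) := by
  have hn0 : (0 : ℝ) < n := by exact_mod_cast hn
  have ht : 0 < 1 + θ := by linarith
  have hc := Real.convexOn_log_Gamma.2 (x := (n : ℝ)) (y := (n : ℝ) + θ + 1)
    (by simp only [Set.mem_Ioi]; positivity) (by simp only [Set.mem_Ioi]; positivity)
    (show 0 ≤ θ / (1 + θ) by positivity) (show 0 ≤ 1 / (1 + θ) by positivity) (by field_simp; ring)
  simp only [smul_eq_mul, Function.comp] at hc
  rw [show θ / (1 + θ) * (n : ℝ) + 1 / (1 + θ) * (n + θ + 1) = n + 1 by field_simp; ring,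
    Real.Gamma_nat_eq_factorial] at hc
  obtain ⟨m, rfl⟩ : ∃ m, n = m + 1 := ⟨n - 1, by omega⟩
  have hG : Real.Gamma ((m + 1 : ℕ) : ℝ) = m.factorial := by
    push_cast; exact Real.Gamma_nat_eq_factorial m
  have hf : Real.log ((m + 1).factorial : ℝ)
      = Real.log ((m + 1 : ℕ) : ℝ) + Real.log (m.factorial : ℝ) := by
    rw [Nat.factorial_succ]; push_cast
    rw [Real.log_mul (by positivity) (by positivity)]
  rw [hG] at hc
  have hc' := mul_le_mul_of_nonneg_left hc ht.le
  rw [mul_add, ← mul_assoc, ← mul_assoc, mul_div_cancel₀ _ ht.ne', mul_div_cancel₀ _ ht.ne',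
    one_mul] at hc'
  nlinarith

/-- The logarithm of the ratio in **Stirling's formula** for the Gamma function. -/
def stirlingError (z : ℝ) : ℝ := Real.log (Real.Gamma (z + 1)) - ((z + 1 / 2) * Real.log z - z)

/-- Log-convexity of the Gamma function carries Stirling's formula from integers to real
arguments. -/
lemma abs_stirlingError_sub_le {n : ℕ} (hn : 1 ≤ n) {θ : ℝ} (h0 : 0 ≤ θ) (h1 : θ ≤ 1) :
    |stirlingError (n + θ) - stirlingError n| ≤ 3 / n := by
  have hn0 : (0 : ℝ) < n := by exact_mod_cast hn
  have hu := log_gamma_le n h0 h1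
  have hl := le_log_gamma hn h0
  have hlog1 : Real.log ((n : ℝ) + 1) ≤ Real.log n + 1 / n := by
    have := Real.log_le_sub_one_of_pos (x := ((n : ℝ) + 1) / n) (by positivity)
    rw [Real.log_div (by positivity) hn0.ne'] at this
    have e : ((n : ℝ) + 1) / n - 1 = 1 / n := by field_simp; ring
    linarith
  have hlog2 : Real.log ((n : ℝ) + θ) ≤ Real.log n + θ / n := by
    have := Real.log_le_sub_one_of_pos (x := ((n : ℝ) + θ) / n) (by positivity)
    rw [Real.log_div (by positivity) hn0.ne'] at this
    have e : ((n : ℝ) + θ) / n - 1 = θ / n := by field_simp; ring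
    linarith
  have hlog3 : Real.log n + θ / (n + θ) ≤ Real.log ((n : ℝ) + θ) := by
    have := Real.one_sub_inv_le_log_of_pos (x := ((n : ℝ) + θ) / n) (by positivity)
    rw [Real.log_div (by positivity) hn0.ne'] at this
    have e : 1 - (((n : ℝ) + θ) / n)⁻¹ = θ / (n + θ) := by field_simp; ring
    linarith
  have hz : (0 : ℝ) < n + θ + 1 / 2 := by positivity
  have m2 := mul_le_mul_of_nonneg_left hlog2 hz.le
  have m3 := mul_le_mul_of_nonneg_left hlog3 hz.le
  have e2 : ((n : ℝ) + θ + 1 / 2) * (Real.log n + θ / n)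
      = (n + θ + 1 / 2) * Real.log n + θ + (θ + 1 / 2) * θ / n := by field_simp; ring
  have e3 : ((n : ℝ) + θ + 1 / 2) * (Real.log n + θ / (n + θ))
      = (n + θ + 1 / 2) * Real.log n + θ + (1 / 2) * θ / (n + θ) := by
    have : (n : ℝ) + θ ≠ 0 := by positivity
    field_simp; ring
  have b2 : (θ + 1 / 2) * θ / n ≤ 3 / 2 / n := by gcongr; nlinarith
  have b3 : 0 ≤ (1 / 2) * θ / (n + θ) := by positivity
  have b1 : θ * Real.log ((n : ℝ) + 1) ≤ θ * Real.log n + 1 / n := by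
    have h := mul_le_mul_of_nonneg_left hlog1 h0
    have : θ * (1 / n) ≤ 1 / (n : ℝ) := mul_le_of_le_one_left (by positivity) h1
    linarith
  have hG : Real.Gamma ((n : ℝ) + 1) = n.factorial := Real.Gamma_nat_eq_factorial n
  have c : (3 : ℝ) / n = 3 / 2 / n + 3 / 2 * (1 / n) := by field_simp; norm_num
  have c0 : 0 < 1 / (n : ℝ) := by positivity
  have c1 : 0 < 3 / 2 / (n : ℝ) := by positivity
  unfold stirlingError
  rw [hG, abs_le]
  constructor <;> nlinarith

theorem tendsto_stirlingError :
    Tendsto stirlingError atTop (𝓝 (Real.log (√Real.pi) + 1 / 2 * Real.log 2)) := by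
  have hnat : Tendsto (fun n : ℕ => stirlingError n) atTop
      (𝓝 (Real.log (√Real.pi) + 1 / 2 * Real.log 2)) := by
    have h1 := (Stirling.tendsto_stirlingSeq_sqrt_pi.log (by positivity)).add_const
      (1 / 2 * Real.log 2)
    refine h1.congr' ?_
    filter_upwards [eventually_ge_atTop 1] with n hn
    have hn0 : (0 : ℝ) < n := by exact_mod_cast hn
    rw [Stirling.log_stirlingSeq_formula, stirlingError, Real.Gamma_nat_eq_factorial,
      Real.log_mul two_ne_zero hn0.ne', Real.log_div hn0.ne' (Real.exp_pos 1).ne', Real.log_exp]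
    ring
  have h2 : Tendsto (fun z : ℝ => stirlingError (⌊z⌋₊ : ℝ)) atTop
      (𝓝 (Real.log (√Real.pi) + 1 / 2 * Real.log 2)) := hnat.comp tendsto_nat_floor_atTop
  have h3 : Tendsto (fun z : ℝ => stirlingError z - stirlingError (⌊z⌋₊ : ℝ)) atTop (𝓝 0) := by
    have h4 : Tendsto (fun z : ℝ => 3 / (⌊z⌋₊ : ℝ)) atTop (𝓝 0) :=
      (tendsto_const_div_atTop_nhds_zero_nat 3).comp tendsto_nat_floor_atTop
    refine squeeze_zero_norm' ?_ h4
    filter_upwards [eventually_ge_atTop 1] with z hz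
    have hfl : 1 ≤ ⌊z⌋₊ := (Nat.one_le_floor_iff z).2 hz
    have := abs_stirlingError_sub_le hfl (θ := z - ⌊z⌋₊)
      (sub_nonneg.2 (Nat.floor_le (by linarith))) (by linarith [Nat.lt_floor_add_one z])
    rw [add_sub_cancel] at this
    exact this
  simpa using h3.add h2

lemma xc_pos {s : ℝ} (hs : 1 < s) : 0 < xc s :=
  div_pos (Real.rpow_pos_of_pos (by linarith) _) (Real.rpow_pos_of_pos (by linarith) _)

/-- The limit of `A_n n ^ (3 / 2) x_c ^ n`. -/
def fussCatalanConst (s : ℝ) : ℝ :=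
  Real.exp (-(Real.log (√Real.pi) + 1 / 2 * Real.log 2) + 1 / 2 * Real.log s
    - 3 / 2 * Real.log (s - 1))

theorem tendsto_fussCatalan {s : ℝ} (hs : 1 < s) :
    Tendsto (fun n : ℕ => fussCatalan s n * (n : ℝ) ^ (3 / 2 : ℝ) * xc s ^ n) atTop
      (𝓝 (fussCatalanConst s)) := by
  have hs1 : 0 < s - 1 := by linarith
  have hs0 : 0 < s := by linarith
  have hcast : Tendsto (fun n : ℕ => (n : ℝ)) atTop atTop := tendsto_natCast_atTop_atTop
  have t1 : Tendsto (fun n : ℕ => stirlingError (s * n)) atTop _ :=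
    tendsto_stirlingError.comp (hcast.const_mul_atTop hs0)
  have t2 : Tendsto (fun n : ℕ => stirlingError ((s - 1) * n)) atTop _ :=
    tendsto_stirlingError.comp (hcast.const_mul_atTop hs1)
  have t3 : Tendsto (fun n : ℕ => stirlingError (n : ℝ)) atTop _ :=
    tendsto_stirlingError.comp hcast
  have t4 : Tendsto (fun n : ℕ => Real.log (s - 1 + 1 / (n : ℝ))) atTop (𝓝 (Real.log (s - 1))) := by
    have : Tendsto (fun n : ℕ => s - 1 + 1 / (n : ℝ)) atTop (𝓝 (s - 1 + 0)) :=
      tendsto_one_div_atTop_nhds_zero_nat.const_add _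
    rw [add_zero] at this
    exact this.log hs1.ne'
  have t5 := ((((t1.sub t2).sub t3).add_const (1 / 2 * Real.log s - 1 / 2 * Real.log (s - 1))).sub
    t4).rexp
  have e : Real.exp (Real.log (√Real.pi) + 1 / 2 * Real.log 2 -
      (Real.log (√Real.pi) + 1 / 2 * Real.log 2) - (Real.log (√Real.pi) + 1 / 2 * Real.log 2)
      + (1 / 2 * Real.log s - 1 / 2 * Real.log (s - 1)) - Real.log (s - 1))
      = fussCatalanConst s := by
    unfold fussCatalanConst; congr 1; ring
  rw [e] at t5
  refine t5.congr' ?_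
  filter_upwards [eventually_ge_atTop 1] with n hn
  have hn0 : (0 : ℝ) < n := by exact_mod_cast hn
  have hA := fussCatalan_pos hs n
  have hx := xc_pos hs
  have hpos : 0 < fussCatalan s n * (n : ℝ) ^ (3 / 2 : ℝ) * xc s ^ n := by positivity
  rw [← Real.exp_log hpos]
  congr 1
  have g1 : 0 < Real.Gamma (s * n + 1) := Real.Gamma_pos_of_pos (by positivity)
  have g2 : 0 < Real.Gamma ((s - 1) * n + 1) := Real.Gamma_pos_of_pos (by positivity)
  have g3 : 0 < Real.Gamma ((n : ℝ) + 1) := Real.Gamma_pos_of_pos (by positivity)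
  have g4 : Real.Gamma ((s - 1) * n + 2) = ((s - 1) * n + 1) * Real.Gamma ((s - 1) * n + 1) := by
    rw [← Real.Gamma_add_one (by positivity)]; congr 1; ring
  have l0 : Real.log (s - 1 + 1 / (n : ℝ)) = Real.log ((s - 1) * n + 1) - Real.log n := by
    rw [← Real.log_div (by positivity) hn0.ne']; congr 1; field_simp
  rw [Real.log_mul (by positivity) (by positivity), Real.log_mul hA.ne' (by positivity),
    Real.log_rpow hn0, Real.log_pow, xc, Real.log_div (by positivity) (by positivity),
    Real.log_rpow hs1, Real.log_rpow hs0, fussCatalan, g4,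
    Real.log_div g1.ne' (by positivity), Real.log_mul (by positivity) g3.ne',
    Real.log_mul (by positivity) g2.ne', l0]
  unfold stirlingError
  rw [Real.log_mul hs0.ne' hn0.ne', Real.log_mul hs1.ne' hn0.ne']
  ring

lemma fussCatalanConst_pos (s : ℝ) : 0 < fussCatalanConst s := Real.exp_pos _

lemma summable_fussCatalan_xc {s : ℝ} (hs : 1 < s) :
    Summable (fun n : ℕ => fussCatalan s n * xc s ^ n) := by
  have hx := xc_pos hs
  have hO : (fun n : ℕ => fussCatalan s n * xc s ^ n) =O[atTop]
      (fun n : ℕ => (n : ℝ) ^ (-(3 / 2) : ℝ)) := by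
    obtain ⟨c, hc⟩ := (tendsto_fussCatalan hs).isBigO_one ℝ |>.bound
    refine Asymptotics.IsBigO.of_bound c ?_
    filter_upwards [hc, eventually_ge_atTop 1] with n h hn
    have hn0 : (0 : ℝ) < n := by exact_mod_cast hn
    have hA := fussCatalan_pos hs n
    rw [Real.norm_of_nonneg (by positivity)] at h ⊢
    rw [Real.norm_of_nonneg (by positivity), Real.rpow_neg hn0.le, ← div_eq_mul_inv,
      le_div_iff₀ (by positivity)]
    simp only [norm_one, mul_one] at h
    linarith
  exact summable_of_isBigO_nat (Real.summable_nat_rpow.2 (by norm_num)) hO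

lemma summable_fussCatalan {s : ℝ} (hs : 1 < s) {x : ℝ} (h0 : 0 ≤ x) (hx : x ≤ xc s) :
    Summable (fun n : ℕ => fussCatalan s n * x ^ n) :=
  (summable_fussCatalan_xc hs).of_nonneg_of_le
    (fun n => mul_nonneg (fussCatalan_pos hs n).le (pow_nonneg h0 n))
    (fun n => mul_le_mul_of_nonneg_left (pow_le_pow_left₀ h0 hx n) (fussCatalan_pos hs n).le)

lemma exists_fussCatalan_le {s : ℝ} (hs : 1 < s) :
    ∃ M : ℝ, 0 < M ∧ ∀ n, fussCatalan s n * xc s ^ n ≤ M := by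
  have h := summable_fussCatalan_xc hs
  have hp : ∀ n, 0 ≤ fussCatalan s n * xc s ^ n := fun n =>
    mul_nonneg (fussCatalan_pos hs n).le (pow_nonneg (xc_pos hs).le n)
  have h0 : 0 ≤ ∑' n : ℕ, fussCatalan s n * xc s ^ n := tsum_nonneg hp
  exact ⟨(∑' n : ℕ, fussCatalan s n * xc s ^ n) + 1, by linarith,
    fun n => by linarith [h.le_tsum n (fun j _ => hp j)]⟩

/-- Below the radius of convergence, polynomial weights do not harm. -/
lemma summable_rpow_mul_fussCatalan {s : ℝ} (hs : 1 < s) {x : ℝ} (h0 : 0 ≤ x) (hx : x < xc s)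
    (a : ℝ) : Summable (fun n : ℕ => ((n : ℝ) + 1) ^ a * (fussCatalan s n * x ^ n)) := by
  obtain ⟨M, hM, hb⟩ := exists_fussCatalan_le hs
  have hc := xc_pos hs
  obtain ⟨k, hk⟩ := exists_nat_ge a
  have hq0 : 0 ≤ x / xc s := by positivity
  have hq1 : ‖x / xc s‖ < 1 := by
    rw [Real.norm_of_nonneg hq0]; exact (div_lt_one hc).2 hx
  have h1 : Summable (fun n : ℕ => ((n : ℝ) + 1) ^ k * (x / xc s) ^ n) := by
    have e : (fun n : ℕ => ((n : ℝ) + 1) ^ k * (x / xc s) ^ n) =O[atTop]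
        (fun n : ℕ => (n : ℝ) ^ k * (x / xc s) ^ n) := by
      refine Asymptotics.IsBigO.of_bound (2 ^ k) ?_
      filter_upwards [eventually_ge_atTop 1] with n hn
      have hn0 : (1 : ℝ) ≤ n := by exact_mod_cast hn
      rw [Real.norm_of_nonneg (by positivity), Real.norm_of_nonneg (by positivity), ← mul_assoc,
        ← mul_pow]
      gcongr
      linarith
    exact summable_of_isBigO_nat (summable_pow_mul_geometric_of_norm_lt_one k hq1) e
  refine (h1.mul_left M).of_nonneg_of_le
    (fun n => mul_nonneg (by positivity) (mul_nonneg (fussCatalan_pos hs n).le (by positivity)))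
    fun n => ?_
  have hA := fussCatalan_pos hs n
  have e1 : fussCatalan s n * x ^ n = (fussCatalan s n * xc s ^ n) * (x / xc s) ^ n := by
    rw [div_pow]; field_simp
  rw [e1]
  have e2 : ((n : ℝ) + 1) ^ a ≤ ((n : ℝ) + 1) ^ k := by
    rw [← Real.rpow_natCast]
    exact Real.rpow_le_rpow_of_exponent_le (by linarith [(Nat.cast_nonneg n : (0 : ℝ) ≤ n)]) hk
  calc ((n : ℝ) + 1) ^ a * ((fussCatalan s n * xc s ^ n) * (x / xc s) ^ n)
      ≤ ((n : ℝ) + 1) ^ k * (M * (x / xc s) ^ n) := by gcongr; exact hb n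
    _ = _ := by ring

/-! ### The generating function -/

lemma summable_raney_natCast {s : ℝ} (hs : 1 < s) {x : ℝ} (h0 : 0 ≤ x) (hx : x ≤ xc s) (k : ℕ) :
    Summable (fun n : ℕ => raney s n k * x ^ n) := by
  induction k with
  | zero =>
    refine summable_of_ne_finset_zero (s := {0}) fun n hn => ?_
    obtain ⟨m, rfl⟩ : ∃ m, n = m + 1 := ⟨n - 1, by simp at hn; omega⟩
    simp [raney_succ_at_zero]
  | succ k ih =>
    have h1 : Summable (fun n : ℕ => raney s n 1 * x ^ n) := by
      simpa [fussCatalan_eq_raney hs] using summable_fussCatalan hs h0 hx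
    have h := (summable_norm_sum_mul_antidiagonal_of_summable_norm ih.norm h1.norm).of_norm
    refine h.congr fun n => ?_
    push_cast
    rw [← raney_convolution, Finset.sum_mul]
    refine Finset.sum_congr rfl fun q hq => ?_
    rw [← Finset.HasAntidiagonal.mem_antidiagonal.mp hq, pow_add]; ring

lemma summable_raney {s : ℝ} (hs : 1 < s) {x : ℝ} (h0 : 0 ≤ x) (hx : x ≤ xc s) {r : ℝ}
    (hr : 0 ≤ r) : Summable (fun n : ℕ => raney s n r * x ^ n) := by
  obtain ⟨k, hk⟩ := exists_nat_ge r
  exact (summable_raney_natCast hs h0 hx k).of_nonneg_of_le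
    (fun n => mul_nonneg (raney_nonneg hs n hr) (pow_nonneg h0 n))
    (fun n => mul_le_mul_of_nonneg_right (raney_mono hs n hr hk) (pow_nonneg h0 n))

/-- The generating function of the Raney numbers `A_n(s, r)`. -/
def raneyGen (s x r : ℝ) : ℝ := ∑' n : ℕ, raney s n r * x ^ n

lemma genF_nonneg (s : ℝ) {x : ℝ} (h0 : 0 ≤ x) : 0 ≤ genF s x :=
  tsum_nonneg fun _ => mul_nonneg (sq_nonneg _) (pow_nonneg h0 _)

section
variable {s : ℝ} (hs : 1 < s) {x : ℝ} (h0 : 0 ≤ x) (hx : x ≤ xc s)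
include hs h0 hx

lemma raneyGen_add {r t : ℝ} (hr : 0 ≤ r) (ht : 0 ≤ t) :
    raneyGen s x (r + t) = raneyGen s x r * raneyGen s x t := by
  unfold raneyGen
  rw [tsum_mul_tsum_eq_tsum_sum_antidiagonal_of_summable_norm (summable_raney hs h0 hx hr).norm
    (summable_raney hs h0 hx ht).norm]
  refine tsum_congr fun n => ?_
  rw [← raney_convolution, Finset.sum_mul]
  refine Finset.sum_congr rfl fun q hq => ?_
  rw [← Finset.HasAntidiagonal.mem_antidiagonal.mp hq, pow_add]; ring

lemma one_le_raneyGen {r : ℝ} (hr : 0 ≤ r) : 1 ≤ raneyGen s x r := by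
  have := (summable_raney hs h0 hx hr).le_tsum 0
    (fun n _ => mul_nonneg (raney_nonneg hs n hr) (pow_nonneg h0 n))
  simpa [raney_zero, raneyGen] using this

lemma raneyGen_mono {r t : ℝ} (hr : 0 ≤ r) (hrt : r ≤ t) : raneyGen s x r ≤ raneyGen s x t :=
  (summable_raney hs h0 hx hr).tsum_le_tsum
    (fun n => mul_le_mul_of_nonneg_right (raney_mono hs n hr hrt) (pow_nonneg h0 n))
    (summable_raney hs h0 hx (hr.trans hrt))

lemma raneyGen_natCast_mul (k : ℕ) {r : ℝ} (hr : 0 ≤ r) :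
    raneyGen s x (k * r) = raneyGen s x r ^ k := by
  induction k with
  | zero =>
    have h1 := raneyGen_add hs h0 hx le_rfl (zero_le_one (α := ℝ))
    have h2 := one_le_raneyGen hs h0 hx (zero_le_one (α := ℝ))
    rw [zero_add] at h1
    have : raneyGen s x 0 = 1 := by
      have h3 : raneyGen s x 1 ≠ 0 := by linarith
      exact (mul_right_cancel₀ h3 (by rw [one_mul]; exact h1)).symm
    simp [this]
  | succ k ih =>
    push_cast
    rw [add_mul, one_mul, raneyGen_add hs h0 hx (by positivity) hr, ih, pow_succ]

/-- `r ↦ raneyGen s x r` is multiplicative and monotone, hence a power. -/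
theorem raneyGen_eq_rpow {r : ℝ} (hr : 0 ≤ r) : raneyGen s x r = raneyGen s x 1 ^ r := by
  have hG := fun {r : ℝ} (hr : 0 ≤ r) => one_le_raneyGen hs h0 hx hr
  set g : ℝ → ℝ := fun r => Real.log (raneyGen s x r) with hg
  have hnat : ∀ (k : ℕ) {r : ℝ}, 0 ≤ r → g (k * r) = k * g r := by
    intro k r hr
    simp only [hg]
    rw [raneyGen_natCast_mul hs h0 hx k hr, Real.log_pow]
  have hmono : ∀ {r t : ℝ}, 0 ≤ r → r ≤ t → g r ≤ g t := fun hr hrt =>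
    Real.log_le_log (by linarith [hG hr]) (raneyGen_mono hs h0 hx hr hrt)
  have hg1 : 0 ≤ g 1 := Real.log_nonneg (hG zero_le_one)
  -- compare `k r` with the neighbouring integers
  have hbound : ∀ k : ℕ, k * |g r - r * g 1| ≤ g 1 := by
    intro k
    have hkr : 0 ≤ k * r := by positivity
    have l1 := hmono (Nat.cast_nonneg _) (Nat.floor_le hkr)
    have l2 := hmono hkr (Nat.lt_floor_add_one (k * r)).le
    rw [hnat k hr] at l1 l2
    have e1 := hnat ⌊(k : ℝ) * r⌋₊ (zero_le_one (α := ℝ))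
    have e2 := hnat (⌊(k : ℝ) * r⌋₊ + 1) (zero_le_one (α := ℝ))
    rw [mul_one] at e1 e2
    push_cast at e2
    rw [e1] at l1
    rw [e2] at l2
    have f1 := mul_le_mul_of_nonneg_right (Nat.floor_le hkr) hg1
    have f2 := mul_le_mul_of_nonneg_right (Nat.lt_floor_add_one ((k : ℝ) * r)).le hg1
    rw [← Nat.abs_cast k, ← abs_mul, abs_le]
    constructor <;> nlinarith
  have hzero : g r = r * g 1 := by
    by_contra hne
    have hpos : 0 < |g r - r * g 1| := abs_pos.2 (sub_ne_zero.2 hne)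
    obtain ⟨k, hk⟩ := exists_nat_gt (g 1 / |g r - r * g 1|)
    rw [div_lt_iff₀ hpos] at hk
    exact absurd (hbound k) (not_le.2 hk)
  have p1 : 0 < raneyGen s x 1 := by linarith [hG zero_le_one]
  have p2 : 0 < raneyGen s x r := by linarith [hG hr]
  simp only [hg] at hzero
  rw [Real.rpow_def_of_pos p1, mul_comm, ← hzero, Real.exp_log p2]

lemma raneyGen_one : raneyGen s x 1 = 1 + genF s x := by
  unfold raneyGen genF
  rw [(summable_raney hs h0 hx zero_le_one).tsum_eq_zero_add]
  simp [raney_zero, f_sq hs, fussCatalan_eq_raney hs]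

lemma summable_fussCatalan_succ : Summable (fun n : ℕ => fussCatalan s (n + 1) * x ^ n) := by
  refine (summable_raney hs h0 hx (r := s) (by linarith)).congr fun n => ?_
  have := raney_succ_sub s n 0
  rw [raney_succ_at_zero, zero_add, zero_add, sub_zero] at this
  rw [fussCatalan_eq_raney hs, this]

lemma tsum_fussCatalan_succ : ∑' n : ℕ, fussCatalan s (n + 1) * x ^ n = (1 + genF s x) ^ s := by
  rw [← raneyGen_one hs h0 hx, ← raneyGen_eq_rpow hs h0 hx (by linarith)]
  refine tsum_congr fun n => ?_
  have := raney_succ_sub s n 0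
  rw [raney_succ_at_zero, zero_add, zero_add, sub_zero] at this
  rw [fussCatalan_eq_raney hs, this]

/-- The functional equation of the generating function. -/
theorem genF_eq : genF s x = x * (1 + genF s x) ^ s := by
  rw [← tsum_fussCatalan_succ hs h0 hx, ← tsum_mul_left]
  refine tsum_congr fun n => ?_
  rw [f_sq hs]; ring

end

/-- The inverse function of `genF s` on `[0, 1 / (s - 1)]`. -/
def genFInv (s F : ℝ) : ℝ := F / (1 + F) ^ s

lemma hasDerivAt_genFInv {s F : ℝ} (hF : 0 ≤ F) :
    HasDerivAt (genFInv s) ((1 - (s - 1) * F) / (1 + F) ^ (s + 1)) F := by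
  have h1 : 0 < 1 + F := by linarith
  have h := (hasDerivAt_id F).div
    (((hasDerivAt_id F).const_add 1).rpow_const (p := s) (Or.inl h1.ne')) (by positivity)
  refine h.congr_deriv ?_
  simp only [id]
  have e : (1 + F) ^ (s - 1) * (1 + F) = (1 + F) ^ s := by
    rw [← Real.rpow_add_one h1.ne', sub_add_cancel]
  have p : 0 < (1 + F) ^ s := by positivity
  rw [Real.rpow_add_one h1.ne']
  field_simp
  rw [← e]
  ring

lemma continuousOn_genFInv (s : ℝ) : ContinuousOn (genFInv s) (Set.Ici 0) := fun _ hF =>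
  (hasDerivAt_genFInv hF).continuousAt.continuousWithinAt

lemma genFInv_strictMonoOn {s : ℝ} (hs : 1 < s) :
    StrictMonoOn (genFInv s) (Set.Icc 0 (1 / (s - 1))) := by
  refine strictMonoOn_of_deriv_pos (convex_Icc _ _)
    ((continuousOn_genFInv s).mono fun F hF => hF.1) fun F hF => ?_
  rw [interior_Icc] at hF
  rw [(hasDerivAt_genFInv hF.1.le).deriv]
  have h1 : 0 < s - 1 := by linarith
  have := (lt_div_iff₀ h1).1 hF.2
  have h2 : 0 < 1 + F := by linarith [hF.1]
  exact div_pos (by linarith) (by positivity)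

lemma genFInv_strictAntiOn {s : ℝ} (hs : 1 < s) :
    StrictAntiOn (genFInv s) (Set.Ici (1 / (s - 1))) := by
  have h1 : 0 < s - 1 := by linarith
  have hp : 0 < 1 / (s - 1) := by positivity
  refine strictAntiOn_of_deriv_neg (convex_Ici _)
    ((continuousOn_genFInv s).mono fun F hF => hp.le.trans hF) fun F hF => ?_
  rw [interior_Ici] at hF
  have hF' : 1 / (s - 1) < F := hF
  rw [(hasDerivAt_genFInv (hp.trans hF').le).deriv]
  have := (div_lt_iff₀ h1).1 hF'
  have h2 : 0 < 1 + F := by linarith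
  exact div_neg_of_neg_of_pos (by linarith) (by positivity)

lemma genFInv_crit {s : ℝ} (hs : 1 < s) : genFInv s (1 / (s - 1)) = xc s := by
  have h1 : 0 < s - 1 := by linarith
  have h2 : 0 < s := by linarith
  unfold genFInv xc
  rw [show 1 + 1 / (s - 1) = s / (s - 1) by field_simp; ring, Real.div_rpow h2.le h1.le,
    Real.rpow_sub_one h1.ne']
  field_simp

lemma genFInv_genF {s : ℝ} (hs : 1 < s) {x : ℝ} (h0 : 0 ≤ x) (hx : x ≤ xc s) :
    genFInv s (genF s x) = x := by
  have h := genF_eq hs h0 hx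
  have h1 : 0 < 1 + genF s x := by linarith [genF_nonneg s h0]
  unfold genFInv
  rw [div_eq_iff (by positivity)]
  exact h

/-- `F(x_c)` is the point where `genFInv` has its maximum. -/
theorem Fc_eq {s : ℝ} (hs : 1 < s) : Fc s = 1 / (s - 1) := by
  have h1 : 0 < s - 1 := by linarith
  have hp : 0 < 1 / (s - 1) := by positivity
  have h := genFInv_genF hs (xc_pos hs).le le_rfl
  have hn := genF_nonneg s (xc_pos hs).le
  rw [← genFInv_crit hs] at h
  rw [genFInv_crit hs] at h
  change genFInv s (Fc s) = _ at h
  change 0 ≤ Fc s at hn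
  rcases lt_trichotomy (Fc s) (1 / (s - 1)) with hlt | heq | hgt
  · have := genFInv_strictMonoOn hs ⟨hn, hlt.le⟩ ⟨hp.le, le_rfl⟩ hlt
    rw [genFInv_crit hs, h] at this
    exact absurd this (lt_irrefl _)
  · exact heq
  · have := genFInv_strictAntiOn hs (Set.mem_Ici.2 le_rfl) (Set.mem_Ici.2 hgt.le) hgt
    rw [genFInv_crit hs, h] at this
    exact absurd this (lt_irrefl _)

lemma genF_le {s : ℝ} (hs : 1 < s) {x : ℝ} (h0 : 0 ≤ x) (hx : x ≤ xc s) :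
    genF s x ≤ 1 / (s - 1) := by
  rw [← Fc_eq hs]
  have hsum : ∀ {y}, 0 ≤ y → y ≤ xc s →
      Summable fun n : ℕ => f s (n + 1) ^ 2 * y ^ (n + 1) := by
    intro y hy0 hy
    simpa [f_sq hs] using (summable_nat_add_iff 1).2 (summable_fussCatalan hs hy0 hy)
  exact (hsum h0 hx).tsum_le_tsum (fun n => by gcongr) (hsum (xc_pos hs).le le_rfl)

lemma genF_lt {s : ℝ} (hs : 1 < s) {x : ℝ} (h0 : 0 ≤ x) (hx : x < xc s) :
    genF s x < 1 / (s - 1) := by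
  refine lt_of_le_of_ne (genF_le hs h0 hx.le) fun h => ?_
  have := genFInv_genF hs h0 hx.le
  rw [h, genFInv_crit hs] at this
  exact hx.ne' this

lemma genFInv_nonneg {s F : ℝ} (hF : 0 ≤ F) : 0 ≤ genFInv s F :=
  div_nonneg hF (Real.rpow_nonneg (by linarith) _)

lemma genFInv_lt {s : ℝ} (hs : 1 < s) {F : ℝ} (h0 : 0 ≤ F) (hF : F < 1 / (s - 1)) :
    genFInv s F < xc s := by
  rw [← genFInv_crit hs]
  exact genFInv_strictMonoOn hs ⟨h0, hF.le⟩ ⟨h0.trans hF.le, le_rfl⟩ hF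

lemma genF_genFInv {s : ℝ} (hs : 1 < s) {F : ℝ} (h0 : 0 ≤ F) (hF : F < 1 / (s - 1)) :
    genF s (genFInv s F) = F := by
  have h := genFInv_lt hs h0 hF
  have hn := genFInv_nonneg (s := s) h0
  exact (genFInv_strictMonoOn hs).injOn ⟨genF_nonneg s hn, genF_le hs hn h.le⟩ ⟨h0, hF.le⟩
    (genFInv_genF hs hn h.le)

section
variable {s : ℝ} (hs : 1 < s) {x : ℝ} (h0 : 0 ≤ x) (hx : x < xc s)
include hs h0 hx

lemma summable_natCast_mul_fussCatalan :
    Summable (fun n : ℕ => (n : ℝ) * (fussCatalan s n * x ^ n)) := by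
  refine (summable_rpow_mul_fussCatalan hs h0 hx 1).of_nonneg_of_le
    (fun n => mul_nonneg (Nat.cast_nonneg n)
      (mul_nonneg (fussCatalan_pos hs n).le (pow_nonneg h0 n))) fun n => ?_
  rw [Real.rpow_one]
  have := mul_nonneg (fussCatalan_pos hs n).le (pow_nonneg h0 n)
  nlinarith

/-- The logarithmic derivative of the generating function, from the convolution identity. -/
lemma tsum_natCast_mul_fussCatalan :
    (∑' n : ℕ, (n : ℝ) * (fussCatalan s n * x ^ n)) * (1 - (s - 1) * genF s x)
      = (1 + genF s x) * genF s x := by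
  have hA := summable_fussCatalan hs h0 hx.le
  have hθ := summable_natCast_mul_fussCatalan hs h0 hx
  have hG : ∑' n : ℕ, fussCatalan s n * x ^ n = 1 + genF s x := by
    rw [← raneyGen_one hs h0 hx.le]
    simp [raneyGen, fussCatalan_eq_raney hs]
  set θ := ∑' n : ℕ, (n : ℝ) * (fussCatalan s n * x ^ n) with hθ'
  set G := ∑' n : ℕ, fussCatalan s n * x ^ n with hG'
  have h1 := tsum_mul_tsum_eq_tsum_sum_antidiagonal_of_summable_norm hA.norm hA.norm
  have h2 := tsum_mul_tsum_eq_tsum_sum_antidiagonal_of_summable_norm hθ.norm hA.norm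
  have h3 := tsum_mul_tsum_eq_tsum_sum_antidiagonal_of_summable_norm hA.norm hθ.norm
  have s1 := (summable_norm_sum_mul_antidiagonal_of_summable_norm hA.norm hA.norm).of_norm
  have s2 := (summable_norm_sum_mul_antidiagonal_of_summable_norm hθ.norm hA.norm).of_norm
  have s3 := (summable_norm_sum_mul_antidiagonal_of_summable_norm hA.norm hθ.norm).of_norm
  rw [← hG'] at h1 h2 h3
  rw [← hθ'] at h2 h3
  have key : (s - 1) * (θ * G + G * θ) + 2 * (G * G) = 2 * (s * θ + G) := by
    rw [h1, h2, h3, ← s2.tsum_add s3, ← tsum_mul_left, ← tsum_mul_left,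
      ← ((s2.add s3).mul_left (s - 1)).tsum_add (s1.mul_left 2), hθ', hG', ← tsum_mul_left (a := s),
      ← (hθ.mul_left s).tsum_add hA, ← tsum_mul_left]
    refine tsum_congr fun n => ?_
    have hc := fussCatalan_convolution hs n
    have e : ∀ q ∈ Finset.HasAntidiagonal.antidiagonal n,
        (s - 1) * ((q.1 : ℝ) * (fussCatalan s q.1 * x ^ q.1) * (fussCatalan s q.2 * x ^ q.2)
          + fussCatalan s q.1 * x ^ q.1 * ((q.2 : ℝ) * (fussCatalan s q.2 * x ^ q.2)))
          + 2 * (fussCatalan s q.1 * x ^ q.1 * (fussCatalan s q.2 * x ^ q.2))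
        = ((s - 1) * n + 2) * x ^ n * (fussCatalan s q.1 * fussCatalan s q.2) := by
      intro q hq
      rw [← Finset.HasAntidiagonal.mem_antidiagonal.mp hq, pow_add]; push_cast; ring
    rw [← Finset.sum_add_distrib, Finset.mul_sum, Finset.mul_sum, ← Finset.sum_add_distrib,
      Finset.sum_congr rfl e, ← Finset.mul_sum]
    linear_combination x ^ n * hc
  rw [hG] at key
  linear_combination -key / 2

end

/-- The derivative `F'(x) = ∑ (n + 1) A_{n + 1} x ^ n` of the generating function. -/
def genFDeriv (s x : ℝ) : ℝ := ∑' n : ℕ, ((n : ℝ) + 1) * (fussCatalan s (n + 1) * x ^ n)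

/-- The derivative of `F(x) / x = ∑ A_{n + 1} x ^ n`. -/
def genQuotDeriv (s x : ℝ) : ℝ := ∑' n : ℕ, ((n : ℝ) + 1) * (fussCatalan s (n + 2) * x ^ n)

lemma summable_fussCatalan_add {s : ℝ} (hs : 1 < s) {x : ℝ} (h0 : 0 ≤ x) (hx : x < xc s)
    (a : ℝ) (k : ℕ) :
    Summable (fun n : ℕ => ((n : ℝ) + k + 1) ^ a * (fussCatalan s (n + k) * x ^ n)) := by
  rcases h0.eq_or_lt with rfl | hpos
  · refine summable_of_ne_finset_zero (s := {0}) fun n hn => ?_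
    rw [zero_pow (by simpa using hn)]; ring
  · have h := ((summable_nat_add_iff k).2 (summable_rpow_mul_fussCatalan hs h0 hx a)).mul_left
      (x ^ k)⁻¹
    refine h.congr fun n => ?_
    push_cast
    rw [pow_add]
    field_simp

lemma summable_genFDeriv {s : ℝ} (hs : 1 < s) {x : ℝ} (h0 : 0 ≤ x) (hx : x < xc s) :
    Summable (fun n : ℕ => ((n : ℝ) + 1) * (fussCatalan s (n + 1) * x ^ n)) := by
  refine (summable_fussCatalan_add hs h0 hx 1 1).of_nonneg_of_le
    (fun n => mul_nonneg (by positivity)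
      (mul_nonneg (fussCatalan_pos hs _).le (pow_nonneg h0 n))) fun n => ?_
  have := mul_nonneg (fussCatalan_pos hs (n + 1)).le (pow_nonneg h0 n)
  rw [Real.rpow_one]
  push_cast
  nlinarith

lemma summable_genQuotDeriv {s : ℝ} (hs : 1 < s) {x : ℝ} (h0 : 0 ≤ x) (hx : x < xc s) :
    Summable (fun n : ℕ => ((n : ℝ) + 1) * (fussCatalan s (n + 2) * x ^ n)) := by
  refine (summable_fussCatalan_add hs h0 hx 1 2).of_nonneg_of_le
    (fun n => mul_nonneg (by positivity)
      (mul_nonneg (fussCatalan_pos hs _).le (pow_nonneg h0 n))) fun n => ?_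
  have := mul_nonneg (fussCatalan_pos hs (n + 2)).le (pow_nonneg h0 n)
  rw [Real.rpow_one]
  push_cast
  nlinarith

lemma one_sub_genF_pos {s : ℝ} (hs : 1 < s) {x : ℝ} (h0 : 0 ≤ x) (hx : x < xc s) :
    0 < 1 - (s - 1) * genF s x := by
  have h1 : 0 < s - 1 := by linarith
  have := (lt_div_iff₀ h1).1 (genF_lt hs h0 hx)
  linarith

lemma genF_zero (s : ℝ) : genF s 0 = 0 := by simp [genF]

theorem genFDeriv_eq {s : ℝ} (hs : 1 < s) {x : ℝ} (h0 : 0 ≤ x) (hx : x < xc s) :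
    genFDeriv s x * (1 - (s - 1) * genF s x) = (1 + genF s x) * (1 + genF s x) ^ s := by
  rcases h0.eq_or_lt with rfl | hpos
  · rw [genF_zero, genFDeriv, tsum_eq_single 0 (fun n hn => by simp [hn])]
    simp [fussCatalan_one hs]
  · have h := tsum_natCast_mul_fussCatalan hs h0 hx
    have e : ∑' n : ℕ, (n : ℝ) * (fussCatalan s n * x ^ n) = x * genFDeriv s x := by
      rw [(summable_natCast_mul_fussCatalan hs h0 hx).tsum_eq_zero_add, genFDeriv, ← tsum_mul_left]
      simp only [Nat.cast_zero, zero_mul, zero_add]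
      refine tsum_congr fun n => ?_
      push_cast; ring
    rw [e] at h
    have hF := genF_eq hs h0 hx.le
    apply mul_left_cancel₀ hpos.ne'
    linear_combination h + (1 + genF s x) * hF

theorem genQuotDeriv_eq {s : ℝ} (hs : 1 < s) {x : ℝ} (h0 : 0 ≤ x) (hx : x < xc s) :
    genQuotDeriv s x * (1 - (s - 1) * genF s x) = s * ((1 + genF s x) ^ s) ^ 2 := by
  rcases h0.eq_or_lt with rfl | hpos
  · rw [genF_zero, genQuotDeriv, tsum_eq_single 0 (fun n hn => by simp [hn])]
    simp [fussCatalan_eq_raney hs, raney_succ]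
    ring
  · have e : x * genQuotDeriv s x = genFDeriv s x - (1 + genF s x) ^ s := by
      rw [← tsum_fussCatalan_succ hs h0 hx.le, genFDeriv,
        ← (summable_genFDeriv hs h0 hx).tsum_sub (summable_fussCatalan_succ hs h0 hx.le),
        ((summable_genFDeriv hs h0 hx).sub
          (summable_fussCatalan_succ hs h0 hx.le)).tsum_eq_zero_add,
        genQuotDeriv, ← tsum_mul_left]
      simp only [Nat.cast_zero, zero_add, pow_zero, one_mul, sub_self]
      refine tsum_congr fun n => ?_
      push_cast; ring
    have hd := genFDeriv_eq hs h0 hx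
    have hF := genF_eq hs h0 hx.le
    apply mul_left_cancel₀ hpos.ne'
    linear_combination (1 - (s - 1) * genF s x) * e + hd + s * (1 + genF s x) ^ s * hF

/-! ### Closed forms on the invariant manifold -/

/-- The point of the manifold divided mode by mode by `f_n`. -/
def reducedAnsatz (b c p : ℂ) : ℕ → ℂ
  | 0 => b
  | n + 1 => c * p ^ n

lemma ansatz_eq {s : ℝ} (hs : 1 < s) (b c p : ℂ) (n : ℕ) :
    ansatz s b c p n = f s n * reducedAnsatz b c p n := by
  cases n with
  | zero => simp [ansatz, reducedAnsatz, f_zero hs]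
  | succ n => simp [ansatz, reducedAnsatz, mul_assoc]

/-- By the convolution identity for the Fuss–Catalan numbers, the inner sum is again of the form
of the manifold. -/
lemma reducedAnsatz_convolution {s : ℝ} (hs : 1 < s) (b c p : ℂ) (n : ℕ) :
    ((s - 1) / 2 * (n + 1) + 1 : ℂ) * ∑ q ∈ Finset.HasAntidiagonal.antidiagonal (n + 1),
        (fussCatalan s q.1 * fussCatalan s q.2 : ℂ) *
          (reducedAnsatz b c p q.1 * reducedAnsatz b c p q.2)
      = fussCatalan s (n + 1) *
          (((s - 1) * (n + 1) + 2) * (b * c * p ^ n) + n * (c ^ 2 * p ^ (n - 1))) := by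
  cases n with
  | zero =>
    have hanti : Finset.HasAntidiagonal.antidiagonal (0 + 1) = {((0 : ℕ), 1), (1, 0)} := rfl
    rw [hanti]
    simp [reducedAnsatz, fussCatalan_zero hs, fussCatalan_one hs]
    ring
  | succ n =>
    have hc := fussCatalan_convolution hs (n + 2)
    rw [Finset.Nat.antidiagonal_succ_succ', Finset.sum_cons, Finset.sum_cons,
      Finset.sum_map] at hc ⊢
    simp only [Function.Embedding.prodMap, Function.Embedding.coeFn_mk, Prod.map,
      Nat.succ_eq_add_one, reducedAnsatz, fussCatalan_zero hs, add_tsub_cancel_right] at hc ⊢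
    have hc' := congrArg (fun r : ℝ => (r : ℂ)) hc
    push_cast at hc'
    have e : ∀ q ∈ Finset.HasAntidiagonal.antidiagonal n,
        (fussCatalan s (q.1 + 1) * fussCatalan s (q.2 + 1) : ℂ) * (c * p ^ q.1 * (c * p ^ q.2))
        = c ^ 2 * p ^ n * (fussCatalan s (q.1 + 1) * fussCatalan s (q.2 + 1) : ℂ) := by
      intro q hq
      rw [← Finset.HasAntidiagonal.mem_antidiagonal.mp hq, pow_add]; ring
    rw [Finset.sum_congr rfl e, ← Finset.mul_sum]
    push_cast
    rw [show n + 1 + 1 = n + 2 from rfl]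
    rw [pow_succ]
    linear_combination (c ^ 2 * p ^ n / 2) * hc'

lemma _root_.HasSum.of_eq {M : Type*} [AddCommMonoid M] [TopologicalSpace M] {g h : ℕ → M} {x y : M}
    (hg : HasSum g x) (hgh : ∀ n, h n = g n) (hxy : y = x) : HasSum h y := by
  rw [show h = g from funext hgh, hxy]; exact hg

lemma interaction_of_eq_mul {s : ℝ} (hs : 1 < s) {a β : ℕ → ℂ} (h : ∀ n, a n = f s n * β n)
    (n m : ℕ) : interaction s a n m =
      f s n * (fussCatalan s m * (starRingEnd ℂ) (β m)) / fussCatalan s (n + m) *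
        (((s - 1) / 2 * (n + m) + 1) * ∑ q ∈ Finset.HasAntidiagonal.antidiagonal (n + m),
          (fussCatalan s q.1 * fussCatalan s q.2 : ℂ) * (β q.1 * β q.2)) := by
  unfold interaction coupling
  rw [Finset.mul_sum, Finset.mul_sum]
  refine Finset.sum_congr rfl fun q _ => ?_
  rw [h m, h q.1, h q.2, map_mul, Complex.conj_ofReal, f_sq hs]
  simp only [← f_sq hs]
  push_cast
  ring

lemma interaction_ansatz {s : ℝ} (hs : 1 < s) (b c p : ℂ) (n m l : ℕ) (hl : n + m = l + 1) :
    interaction s (ansatz s b c p) n m =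
      f s n * (fussCatalan s m * (starRingEnd ℂ) (reducedAnsatz b c p m)) *
        (((s - 1) * (l + 1) + 2) * (b * c * p ^ l) + l * (c ^ 2 * p ^ (l - 1))) := by
  have hcast : (n : ℂ) + m = l + 1 := by exact_mod_cast congrArg (fun k : ℕ => (k : ℂ)) hl
  have hA : (fussCatalan s (l + 1) : ℂ) ≠ 0 := by
    exact_mod_cast (fussCatalan_pos hs (l + 1)).ne'
  rw [interaction_of_eq_mul hs (ansatz_eq hs b c p), hl, hcast, reducedAnsatz_convolution hs]
  field_simp

section
variable {s : ℝ} (hs : 1 < s) (b c : ℂ) {p : ℂ} (hp : ‖p‖ ^ 2 < xc s)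
include hs hp

lemma hasSum_particleNumber_ansatz : HasSum (fun n => ‖ansatz s b c p n‖ ^ 2)
    (‖b‖ ^ 2 + ‖c‖ ^ 2 * (1 + genF s (‖p‖ ^ 2)) ^ s) := by
  have h0 : 0 ≤ ‖p‖ ^ 2 := sq_nonneg _
  rw [← hasSum_nat_add_iff' 1]
  have h := (summable_fussCatalan_succ hs h0 hp.le).hasSum.mul_left (‖c‖ ^ 2)
  rw [tsum_fussCatalan_succ hs h0 hp.le] at h
  refine h.of_eq (fun n => ?_) ?_
  · simp only [ansatz, norm_mul, Complex.norm_real, norm_pow, mul_pow, Real.norm_eq_abs, sq_abs,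
      f_sq hs]
    ring
  · simp [ansatz]

lemma particleNumber_ansatz : particleNumber (ansatz s b c p)
    = ‖b‖ ^ 2 + ‖c‖ ^ 2 * (1 + genF s (‖p‖ ^ 2)) ^ s :=
  (hasSum_particleNumber_ansatz hs b c hp).tsum_eq

lemma energy_ansatz : energy (ansatz s b c p) = ‖c‖ ^ 2 * genFDeriv s (‖p‖ ^ 2) := by
  have h0 : 0 ≤ ‖p‖ ^ 2 := sq_nonneg _
  refine HasSum.tsum_eq ?_
  rw [← hasSum_nat_add_iff' 1]
  refine ((summable_genFDeriv hs h0 hp).hasSum.mul_left (‖c‖ ^ 2)).of_eq (fun n => ?_) ?_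
  · simp only [ansatz, norm_mul, Complex.norm_real, norm_pow, mul_pow, Real.norm_eq_abs, sq_abs,
      f_sq hs]
    push_cast
    ring
  · simp [genFDeriv]

/-- The right-hand side of the equation of the zeroth mode. -/
lemma hasSum_interaction_zero : HasSum (fun m => interaction s (ansatz s b c p) 0 m)
    ((starRingEnd ℂ) b * b ^ 2 + (starRingEnd ℂ) c * c *
      (((s - 1) * genFDeriv s (‖p‖ ^ 2) + 2 * ((1 + genF s (‖p‖ ^ 2)) ^ s : ℝ)) * b
        + c * (starRingEnd ℂ) p * genQuotDeriv s (‖p‖ ^ 2))) := by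
  have h0 : 0 ≤ ‖p‖ ^ 2 := sq_nonneg _
  have hx : (starRingEnd ℂ) p * p = ((‖p‖ ^ 2 : ℝ) : ℂ) := by
    rw [Complex.conj_mul']; push_cast; rfl
  rw [← hasSum_nat_add_iff' 1]
  have z0 : interaction s (ansatz s b c p) 0 0 = (starRingEnd ℂ) b * b ^ 2 := by
    rw [interaction_of_eq_mul hs (ansatz_eq hs b c p)]
    have hanti : Finset.HasAntidiagonal.antidiagonal (0 + 0) = {((0 : ℕ), 0)} := rfl
    rw [hanti, Finset.sum_singleton]
    simp only [fussCatalan_zero hs, f_zero hs, reducedAnsatz]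
    push_cast
    ring
  have h1 := (((summable_genFDeriv hs h0 hp).hasSum.mul_left (s - 1)).add
    ((summable_fussCatalan_succ hs h0 hp.le).hasSum.mul_left 2))
  rw [tsum_fussCatalan_succ hs h0 hp.le] at h1
  have h1' := ((Complex.hasSum_ofReal.2 h1).mul_left ((starRingEnd ℂ) c * c * b))
  -- the second series starts with a vanishing term
  have h2 : HasSum (fun m : ℕ => (starRingEnd ℂ) c * c ^ 2 * ((starRingEnd ℂ) p ^ m *
      (m * fussCatalan s (m + 1) * p ^ (m - 1)))) ((starRingEnd ℂ) c * c ^ 2 *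
        ((starRingEnd ℂ) p * genQuotDeriv s (‖p‖ ^ 2))) := by
    refine HasSum.mul_left _ ?_
    rw [← hasSum_nat_add_iff' 1]
    have := (Complex.hasSum_ofReal.2 (summable_genQuotDeriv hs h0 hp).hasSum).mul_left
      ((starRingEnd ℂ) p)
    refine this.of_eq (fun m => ?_) ?_
    · push_cast
      rw [show ((‖p‖ : ℂ) ^ 2) = (starRingEnd ℂ) p * p by rw [hx]; push_cast; rfl, mul_pow]
      ring
    · simp [genQuotDeriv]
  refine (h1'.add h2).of_eq (fun m => ?_) ?_
  · rw [interaction_ansatz hs b c p 0 (m + 1) m (by ring)]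
    simp only [reducedAnsatz, f_zero hs, map_mul, map_pow]
    push_cast
    rw [show ((‖p‖ : ℂ) ^ 2) = (starRingEnd ℂ) p * p by rw [hx]; push_cast; rfl, mul_pow]
    ring
  · simp only [Finset.sum_range_one, z0]
    unfold genFDeriv
    push_cast
    ring

/-- The right-hand side of the equation of the mode `n + 1`. -/
lemma hasSum_interaction_succ (n : ℕ) : HasSum (fun m => interaction s (ansatz s b c p) (n + 1) m)
    (f s (n + 1) * ((starRingEnd ℂ) b *
        (((s - 1) * (n + 1) + 2) * (b * c * p ^ n) + n * (c ^ 2 * p ^ (n - 1)))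
      + p ^ n * ((starRingEnd ℂ) c * c) *
        ((((s - 1) * (n + 1) + 2) * ((1 + genF s (‖p‖ ^ 2)) ^ s : ℝ)
            + (s - 1) * genFDeriv s (‖p‖ ^ 2)) * (b * p)
          + (n * ((1 + genF s (‖p‖ ^ 2)) ^ s : ℝ) + genFDeriv s (‖p‖ ^ 2)) * c))) := by
  have h0 : 0 ≤ ‖p‖ ^ 2 := sq_nonneg _
  have hx : (starRingEnd ℂ) p * p = ((‖p‖ ^ 2 : ℝ) : ℂ) := by
    rw [Complex.conj_mul']; push_cast; rfl
  rw [← hasSum_nat_add_iff' 1]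
  have z0 : interaction s (ansatz s b c p) (n + 1) 0 = f s (n + 1) * ((starRingEnd ℂ) b *
        (((s - 1) * (n + 1) + 2) * (b * c * p ^ n) + n * (c ^ 2 * p ^ (n - 1)))) := by
    rw [interaction_ansatz hs b c p (n + 1) 0 n (by ring)]
    simp [fussCatalan_zero hs, reducedAnsatz]
    ring
  have hD := Complex.hasSum_ofReal.2 (summable_genFDeriv hs h0 hp).hasSum
  have hΦ := Complex.hasSum_ofReal.2 (summable_fussCatalan_succ hs h0 hp.le).hasSum
  rw [tsum_fussCatalan_succ hs h0 hp.le] at hΦ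
  have h1 := (((hΦ.mul_left (((s - 1) * (n + 1) + 2 : ℂ))).add (hD.mul_left (s - 1 : ℂ))).mul_right
    (b * p)).add (((hΦ.mul_left (n : ℂ)).add hD).mul_right c)
  have h2 := h1.mul_left (f s (n + 1) * (p ^ n * ((starRingEnd ℂ) c * c)))
  refine h2.of_eq (fun m => ?_) ?_
  · rw [interaction_ansatz hs b c p (n + 1) (m + 1) (n + m + 1) (by ring)]
    simp only [reducedAnsatz, map_mul, map_pow, add_tsub_cancel_right]
    push_cast
    rw [show ((‖p‖ : ℂ) ^ 2) = (starRingEnd ℂ) p * p by rw [hx]; push_cast; rfl, mul_pow]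
    ring
  · simp only [Finset.sum_range_one, z0]
    unfold genFDeriv
    push_cast
    ring

end

/-! ### Global solutions of ordinary differential equations with an a priori bound -/

/-- A bounded, globally Lipschitz vector field has global integral curves. -/
theorem exists_integralCurve_of_lipschitz_of_bounded {X : Type*} [NormedAddCommGroup X]
    [NormedSpace ℝ X] [CompleteSpace X] {w : X → X} {K L : NNReal} (hK : LipschitzWith K w)
    (hL : ∀ x, ‖w x‖ ≤ L) (t₀ : ℝ) (x₀ : X) :
    ∃ γ : ℝ → X, γ t₀ = x₀ ∧ ∀ t, HasDerivAt γ (w (γ t)) t := by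
  have loc : ∀ n : ℕ, ∃ γ : ℝ → X, γ t₀ = x₀ ∧
      ∀ t ∈ Set.Ioo (t₀ - (n + 1)) (t₀ + (n + 1)), HasDerivAt γ (w (γ t)) t := by
    intro n
    have hn : (0 : ℝ) ≤ n := Nat.cast_nonneg n
    have hmem : t₀ ∈ Set.Icc (t₀ - (n + 1)) (t₀ + (n + 1)) := ⟨by linarith, by linarith⟩
    have hPL : IsPicardLindelof (fun _ => w) (⟨t₀, hmem⟩ : Set.Icc (t₀ - (n + 1)) (t₀ + (n + 1)))
        x₀ (L * (n + 1)) 0 L K := by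
      refine IsPicardLindelof.of_time_independent (fun x _ => hL x) hK.lipschitzOnWith ?_
      simp
    obtain ⟨γ, h0, hγ⟩ := hPL.exists_eq_forall_mem_Icc_hasDerivWithinAt₀
    exact ⟨γ, h0, fun t ht =>
      (hγ t (Set.Ioo_subset_Icc_self ht)).hasDerivAt (Icc_mem_nhds ht.1 ht.2)⟩
  choose γ h0 hγ using loc
  have agree : ∀ n m : ℕ, n ≤ m →
      Set.EqOn (γ n) (γ m) (Set.Ioo (t₀ - (n + 1)) (t₀ + (n + 1))) := by
    intro n m hnm
    have hnm' : (n : ℝ) ≤ m := by exact_mod_cast hnm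
    have hn : (0 : ℝ) ≤ n := Nat.cast_nonneg n
    refine ODE_solution_unique_of_mem_Ioo (v := fun _ => w) (s := fun _ => Set.univ) (K := K)
      (t₀ := t₀) (fun t _ => hK.lipschitzOnWith) ⟨by linarith, by linarith⟩
      (fun t ht => ⟨hγ n t ht, trivial⟩)
      (fun t ht => ⟨hγ m t ⟨by linarith [ht.1], by linarith [ht.2]⟩, trivial⟩) (by rw [h0, h0])
  have hin : ∀ t : ℝ,
      t ∈ Set.Ioo (t₀ - ((⌈|t - t₀|⌉₊ : ℝ) + 1)) (t₀ + ((⌈|t - t₀|⌉₊ : ℝ) + 1)) := by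
    intro t
    have h1 := Nat.le_ceil |t - t₀|
    have h2 := abs_le.1 h1
    exact ⟨by linarith [h2.1], by linarith [h2.2]⟩
  have key : ∀ (n : ℕ) (t : ℝ), t ∈ Set.Ioo (t₀ - ((n : ℝ) + 1)) (t₀ + (n + 1)) →
      γ ⌈|t - t₀|⌉₊ t = γ n t := by
    intro n t ht
    rcases le_total n ⌈|t - t₀|⌉₊ with h | h
    · exact (agree _ _ h ht).symm
    · exact agree _ _ h (hin t)
  refine ⟨fun t => γ ⌈|t - t₀|⌉₊ t, by simp [h0], fun t => ?_⟩
  have h1 := hγ ⌈|t - t₀|⌉₊ t (hin t)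
  refine h1.congr_of_eventuallyEq ?_
  filter_upwards [Ioo_mem_nhds (hin t).1 (hin t).2] with τ hτ using key _ τ hτ

/-- If all time reparametrisations of integral curves from `x₀` stay in a ball, then there is a
global integral curve from `x₀`. The field is cut off outside of a larger ball, and integral curves
of the cut-off field are such reparametrisations. -/
theorem exists_integralCurve_of_bound {X : Type*} [NormedAddCommGroup X] [NormedSpace ℝ X]
    [FiniteDimensional ℝ X] {w : X → X} (hw : ContDiff ℝ 1 w) (t₀ : ℝ) (x₀ : X) (R : ℝ)
    (hR : ∀ (r : ℝ → ℝ) (γ : ℝ → X), γ t₀ = x₀ → (∀ t, HasDerivAt γ (r t • w (γ t)) t) →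
      ∀ t, ‖γ t‖ ≤ R) :
    ∃ γ : ℝ → X, γ t₀ = x₀ ∧ ∀ t, HasDerivAt γ (w (γ t)) t := by
  have : CompleteSpace X := FiniteDimensional.complete ℝ X
  have hpos : 0 < |R| + 1 := by positivity
  let χ : ContDiffBump (0 : X) := ⟨|R| + 1, |R| + 2, hpos, by linarith⟩
  have hcs : HasCompactSupport fun x => χ x • w x := χ.hasCompactSupport.smul_right
  have hcd : ContDiff ℝ 1 fun x => χ x • w x := (χ.contDiff).smul hw
  obtain ⟨K, hK⟩ := hcd.lipschitzWith_of_hasCompactSupport hcs one_ne_zero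
  obtain ⟨L, hL⟩ := hcs.exists_bound_of_continuous hcd.continuous
  obtain ⟨γ, h0, hγ⟩ := exists_integralCurve_of_lipschitz_of_bounded (L := Real.toNNReal L) hK
    (fun x => (hL x).trans (Real.le_coe_toNNReal L)) t₀ x₀
  have hb := hR (fun t => χ (γ t)) γ h0 hγ
  refine ⟨γ, h0, fun t => ?_⟩
  have h1 : χ (γ t) = 1 := by
    apply χ.one_of_mem_closedBall
    rw [mem_closedBall_zero_iff]
    exact (hb t).trans ((le_abs_self R).trans (by simp [χ]))
  simpa [h1] using hγ t

/-! ### The polynomial form of the dynamics on the manifold -/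

/-- `i` times the derivative of `b`, in the variables `u = p (1 + F) ^ (s / 2)` and
`v = c (1 + F) ^ (s / 2)`, for which `|u|² = F`. The equations for `b, u, v` are polynomial once the
energy `E`, which is conserved, is treated as a constant. -/
def gaugeB (s E : ℝ) (b u v : ℂ) : ℂ :=
  ((‖b‖ ^ 2 + (s - 1) * E + 2 * ‖v‖ ^ 2 : ℝ) : ℂ) * b
    + ((‖v‖ ^ 2 + (s - 1) * E : ℝ) : ℂ) * (v * (starRingEnd ℂ) u)

/-- `i` times the derivative of `u`. -/
def gaugeU (s : ℝ) (b u v : ℂ) : ℂ :=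
  (((s - 1) * ‖b‖ ^ 2 + ‖v‖ ^ 2 : ℝ) : ℂ) * u
    + ((1 + s / 2 * ‖u‖ ^ 2 : ℝ) : ℂ) * ((starRingEnd ℂ) b * v)
    + ((s / 2 - 1 : ℝ) : ℂ) * (b * (starRingEnd ℂ) v * u ^ 2)

/-- `i` times the derivative of `v`. -/
def gaugeV (s E : ℝ) (b u v : ℂ) : ℂ :=
  (((s + 1) * ‖b‖ ^ 2 + E : ℝ) : ℂ) * v
    + (((s / 2 + 1) * ‖v‖ ^ 2 + (s - 1) * E : ℝ) : ℂ) * (b * u)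
    + ((s / 2 : ℝ) : ℂ) * ((starRingEnd ℂ) b * (starRingEnd ℂ) u * v ^ 2)

/-- `(b, u, v)` is an integral curve of the polynomial system, up to the time reparametrisation
with speed `r`. -/
structure IsGaugeFlow (s E : ℝ) (r : ℝ → ℝ) (b u v : ℝ → ℂ) : Prop where
  deriv_b : ∀ t, HasDerivAt b (r t * (-Complex.I * gaugeB s E (b t) (u t) (v t))) t
  deriv_u : ∀ t, HasDerivAt u (r t * (-Complex.I * gaugeU s (b t) (u t) (v t))) t
  deriv_v : ∀ t, HasDerivAt v (r t * (-Complex.I * gaugeV s E (b t) (u t) (v t))) t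

/-- The quantity `b̄ v ū` whose imaginary part drives all moduli. -/
def gaugeZ (b u v : ℂ) : ℂ := (starRingEnd ℂ) b * v * (starRingEnd ℂ) u

namespace IsGaugeFlow
variable {s E : ℝ} {r : ℝ → ℝ} {b u v : ℝ → ℂ}

lemma hasDerivAt_normSq_b (h : IsGaugeFlow s E r b u v) (t : ℝ) :
    HasDerivAt (fun t => ‖b t‖ ^ 2)
      (r t * (2 * (gaugeZ (b t) (u t) (v t)).im * (‖v t‖ ^ 2 + (s - 1) * E))) t := by
  refine (h.deriv_b t).norm_sq.congr_deriv ?_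
  simp only [gaugeB, gaugeZ, Complex.inner, Complex.mul_re, Complex.mul_im, Complex.add_re,
    Complex.add_im, Complex.neg_re, Complex.neg_im, Complex.I_re, Complex.I_im, Complex.ofReal_re,
    Complex.ofReal_im, Complex.conj_re, Complex.conj_im, pow_two, Complex.norm_mul_self_eq_normSq,
    Complex.normSq_apply]
  ring

lemma hasDerivAt_normSq_u (h : IsGaugeFlow s E r b u v) (t : ℝ) :
    HasDerivAt (fun t => ‖u t‖ ^ 2)
      (r t * (2 * (gaugeZ (b t) (u t) (v t)).im * (1 + ‖u t‖ ^ 2))) t := by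
  refine (h.deriv_u t).norm_sq.congr_deriv ?_
  simp only [gaugeU, gaugeZ, Complex.inner, Complex.mul_re, Complex.mul_im, Complex.add_re,
    Complex.add_im, Complex.neg_re, Complex.neg_im, Complex.I_re, Complex.I_im, Complex.ofReal_re,
    Complex.ofReal_im, Complex.conj_re, Complex.conj_im, pow_two, Complex.norm_mul_self_eq_normSq,
    Complex.normSq_apply]
  ring

lemma hasDerivAt_normSq_v (h : IsGaugeFlow s E r b u v) (t : ℝ) :
    HasDerivAt (fun t => ‖v t‖ ^ 2)
      (r t * (-2 * (gaugeZ (b t) (u t) (v t)).im * (‖v t‖ ^ 2 + (s - 1) * E))) t := by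
  refine (h.deriv_v t).norm_sq.congr_deriv ?_
  simp only [gaugeV, gaugeZ, Complex.inner, Complex.mul_re, Complex.mul_im, Complex.add_re,
    Complex.add_im, Complex.neg_re, Complex.neg_im, Complex.I_re, Complex.I_im, Complex.ofReal_re,
    Complex.ofReal_im, Complex.conj_re, Complex.conj_im, pow_two, Complex.norm_mul_self_eq_normSq,
    Complex.normSq_apply]
  ring

/-- Conservation of the particle number. -/
lemma particle_const (h : IsGaugeFlow s E r b u v) (t t' : ℝ) :
    ‖b t‖ ^ 2 + ‖v t‖ ^ 2 = ‖b t'‖ ^ 2 + ‖v t'‖ ^ 2 := by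
  have hd : ∀ t, HasDerivAt (fun t => ‖b t‖ ^ 2 + ‖v t‖ ^ 2) 0 t := fun t =>
    ((h.hasDerivAt_normSq_b t).add (h.hasDerivAt_normSq_v t)).congr_deriv (by ring)
  exact is_const_of_deriv_eq_zero (fun t => (hd t).differentiableAt) (fun t => (hd t).deriv) t t'

/-- Conservation of the energy. -/
lemma energy_const (h : IsGaugeFlow s E r b u v) (t t' : ℝ) :
    ‖v t‖ ^ 2 * (1 + ‖u t‖ ^ 2) - E * (1 - (s - 1) * ‖u t‖ ^ 2)
      = ‖v t'‖ ^ 2 * (1 + ‖u t'‖ ^ 2) - E * (1 - (s - 1) * ‖u t'‖ ^ 2) := by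
  have hd : ∀ t, HasDerivAt
      (fun t => ‖v t‖ ^ 2 * (1 + ‖u t‖ ^ 2) - E * (1 - (s - 1) * ‖u t‖ ^ 2)) 0 t := fun t =>
    (((h.hasDerivAt_normSq_v t).mul ((h.hasDerivAt_normSq_u t).const_add 1)).sub
      ((((h.hasDerivAt_normSq_u t).const_mul (s - 1)).const_sub 1).const_mul E)).congr_deriv
        (by ring)
  exact is_const_of_deriv_eq_zero (fun t => (hd t).differentiableAt) (fun t => (hd t).deriv) t t'

end IsGaugeFlow

lemma contDiff_gaugeField (s E : ℝ) : ContDiff ℝ 1 (fun Y : ℂ × ℂ × ℂ =>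
    (-Complex.I * gaugeB s E Y.1 Y.2.1 Y.2.2, -Complex.I * gaugeU s Y.1 Y.2.1 Y.2.2,
      -Complex.I * gaugeV s E Y.1 Y.2.1 Y.2.2)) := by
  have hb : ContDiff ℝ 1 (fun Y : ℂ × ℂ × ℂ => Y.1) := contDiff_fst
  have hu : ContDiff ℝ 1 (fun Y : ℂ × ℂ × ℂ => Y.2.1) := contDiff_snd.fst
  have hv : ContDiff ℝ 1 (fun Y : ℂ × ℂ × ℂ => Y.2.2) := contDiff_snd.snd
  have hconj : ∀ {g : ℂ × ℂ × ℂ → ℂ}, ContDiff ℝ 1 g →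
      ContDiff ℝ 1 (fun Y => (starRingEnd ℂ) (g Y)) := fun hg => Complex.conjCLE.contDiff.comp hg
  have hreal : ∀ {g : ℂ × ℂ × ℂ → ℝ}, ContDiff ℝ 1 g → ContDiff ℝ 1 (fun Y => (g Y : ℂ)) :=
    fun hg => Complex.ofRealCLM.contDiff.comp hg
  have nb := hb.norm_sq ℝ
  have nu := hu.norm_sq ℝ
  have nv := hv.norm_sq ℝ
  have cst : ∀ a : ℝ, ContDiff ℝ 1 (fun _ : ℂ × ℂ × ℂ => a) := fun a => contDiff_const
  refine (contDiff_const.mul ?_).prodMk ((contDiff_const.mul ?_).prodMk (contDiff_const.mul ?_))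
  · exact ((hreal ((nb.add (cst _)).add ((cst 2).mul nv))).mul hb).add
      ((hreal (nv.add (cst _))).mul (hv.mul (hconj hu)))
  · exact (((hreal (((cst _).mul nb).add nv)).mul hu).add
      ((hreal ((cst 1).add ((cst _).mul nu))).mul ((hconj hb).mul hv))).add
      ((hreal (cst _)).mul ((hb.mul (hconj hv)).mul (hu.pow 2)))
  · exact (((hreal (((cst _).mul nb).add (cst _))).mul hv).add
      ((hreal (((cst _).mul nv).add (cst _))).mul (hb.mul hu))).add
      ((hreal (cst _)).mul (((hconj hb).mul (hconj hu)).mul (hv.pow 2)))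

/-- On the level set of the conserved quantities all three variables are bounded, so the
polynomial system has global solutions there. -/
theorem exists_gaugeFlow {s E : ℝ} (hs : 1 < s) (hE : 0 < E) (t₀ : ℝ) (b₀ u₀ v₀ : ℂ)
    (h₀ : ‖v₀‖ ^ 2 * (1 + ‖u₀‖ ^ 2) - E * (1 - (s - 1) * ‖u₀‖ ^ 2) = 0) :
    ∃ b u v : ℝ → ℂ, b t₀ = b₀ ∧ u t₀ = u₀ ∧ v t₀ = v₀ ∧ IsGaugeFlow s E (fun _ => 1) b u v := by
  have hs1 : 0 < s - 1 := by linarith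
  set N := ‖b₀‖ ^ 2 + ‖v₀‖ ^ 2 with hN
  obtain ⟨γ, h0, hγ⟩ := exists_integralCurve_of_bound (contDiff_gaugeField s E) t₀ (b₀, u₀, v₀)
    (max (√N) (√(1 / (s - 1)))) (by
      intro r γ h0 hγ t
      have hfl : IsGaugeFlow s E r (fun t => (γ t).1) (fun t => (γ t).2.1)
          (fun t => (γ t).2.2) := by
        refine ⟨fun t => ?_, fun t => ?_, fun t => ?_⟩
        · simpa using (hγ t).hasFDerivAt.fst.hasDerivAt
        · simpa using (hγ t).hasFDerivAt.snd.fst.hasDerivAt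
        · simpa using (hγ t).hasFDerivAt.snd.snd.hasDerivAt
      have i1 := hfl.particle_const t t₀
      have i2 := hfl.energy_const t t₀
      simp only [h0, h₀] at i1 i2
      rw [← hN] at i1
      have p1 := sq_nonneg ‖(γ t).1‖
      have p2 := sq_nonneg ‖(γ t).2.1‖
      have p3 := sq_nonneg ‖(γ t).2.2‖
      have hu : ‖(γ t).2.1‖ ^ 2 ≤ 1 / (s - 1) := by
        rw [le_div_iff₀ hs1]
        have : 0 ≤ E * (1 - (s - 1) * ‖(γ t).2.1‖ ^ 2) := by nlinarith
        nlinarith [nonneg_of_mul_nonneg_right this hE]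
      rw [Prod.norm_def, Prod.norm_def]
      refine max_le ?_ (max_le ?_ ?_)
      · exact le_max_of_le_left (Real.le_sqrt_of_sq_le (by linarith))
      · exact le_max_of_le_right (Real.le_sqrt_of_sq_le hu)
      · exact le_max_of_le_left (Real.le_sqrt_of_sq_le (by linarith)))
  refine ⟨fun t => (γ t).1, fun t => (γ t).2.1, fun t => (γ t).2.2, by simp [h0], by simp [h0],
    by simp [h0], ⟨fun t => ?_, fun t => ?_, fun t => ?_⟩⟩
  · simpa using (hγ t).hasFDerivAt.fst.hasDerivAt
  · simpa using (hγ t).hasFDerivAt.snd.fst.hasDerivAt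
  · simpa using (hγ t).hasFDerivAt.snd.snd.hasDerivAt

/-! ### The motion of the moduli -/

/-- A solution of the polynomial system with particle number `N` and energy `E`. -/
structure IsGaugeSolution (s N E : ℝ) (b u v : ℝ → ℂ) : Prop where
  flow : IsGaugeFlow s E (fun _ => 1) b u v
  particle : ∀ t, ‖b t‖ ^ 2 + ‖v t‖ ^ 2 = N
  energy : ∀ t, ‖v t‖ ^ 2 * (1 + ‖u t‖ ^ 2) = E * (1 - (s - 1) * ‖u t‖ ^ 2)

/-- `1 / (1 + F)`, the variable in which the motion of the moduli is harmonic. -/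
def gaugeY (u : ℂ) : ℝ := (1 + ‖u‖ ^ 2)⁻¹

lemma gaugeY_pos (u : ℂ) : 0 < gaugeY u := by unfold gaugeY; positivity

lemma gaugeY_le_one (u : ℂ) : gaugeY u ≤ 1 := by
  unfold gaugeY
  exact inv_le_one_of_one_le₀ (by linarith [sq_nonneg ‖u‖])

lemma gaugeY_mul (u : ℂ) : gaugeY u * ‖u‖ ^ 2 = 1 - gaugeY u := by
  have : 0 < 1 + ‖u‖ ^ 2 := by positivity
  unfold gaugeY
  field_simp
  ring

lemma gaugeZ_normSq (b u v : ℂ) :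
    (gaugeZ b u v).re ^ 2 + (gaugeZ b u v).im ^ 2 = ‖b‖ ^ 2 * ‖v‖ ^ 2 * ‖u‖ ^ 2 := by
  have : ‖gaugeZ b u v‖ ^ 2 = ‖b‖ ^ 2 * ‖v‖ ^ 2 * ‖u‖ ^ 2 := by
    simp only [gaugeZ, norm_mul, RCLike.norm_conj]; ring
  rw [← this, Complex.sq_norm, Complex.normSq_apply]; ring

/-- The conserved quantity `S / (2 s)`. -/
def gaugeK (s N E : ℝ) (b u v : ℂ) : ℝ :=
  gaugeY u * (N + 2 * (gaugeZ b u v).re)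
    + (1 - 2 * gaugeY u) * (E * (s * gaugeY u - (s - 1)))

lemma _root_.HasDerivAt.conj_complex {g : ℝ → ℂ} {g' : ℂ} {t : ℝ} (h : HasDerivAt g g' t) :
    HasDerivAt (fun τ => (starRingEnd ℂ) (g τ)) ((starRingEnd ℂ) g') t :=
  (Complex.conjCLE.hasFDerivAt.comp_hasDerivAt t h :)

lemma _root_.HasDerivAt.re_complex {g : ℝ → ℂ} {g' : ℂ} {t : ℝ} (h : HasDerivAt g g' t) :
    HasDerivAt (fun τ => (g τ).re) g'.re t :=
  (Complex.reCLM.hasFDerivAt.comp_hasDerivAt t h :)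

lemma _root_.HasDerivAt.im_complex {g : ℝ → ℂ} {g' : ℂ} {t : ℝ} (h : HasDerivAt g g' t) :
    HasDerivAt (fun τ => (g τ).im) g'.im t :=
  (Complex.imCLM.hasFDerivAt.comp_hasDerivAt t h :)

namespace IsGaugeSolution
variable {s N E : ℝ} {b u v : ℝ → ℂ}

lemma normSq_v (h : IsGaugeSolution s N E b u v) (t : ℝ) :
    ‖v t‖ ^ 2 = E * (s * gaugeY (u t) - (s - 1)) := by
  have h1 := h.energy t
  have h2 := gaugeY_mul (u t)
  linear_combination gaugeY (u t) * h1 - (E * (s - 1) + ‖v t‖ ^ 2) * h2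

lemma hasDerivAt_gaugeY (h : IsGaugeSolution s N E b u v) (t : ℝ) :
    HasDerivAt (fun t => gaugeY (u t))
      (-2 * gaugeY (u t) * (gaugeZ (b t) (u t) (v t)).im) t := by
  have h1 : 1 + ‖u t‖ ^ 2 ≠ 0 := by positivity
  refine (((h.flow.hasDerivAt_normSq_u t).const_add 1).inv h1).congr_deriv ?_
  unfold gaugeY
  field_simp

lemma hasDerivAt_gaugeZ (h : IsGaugeSolution s N E b u v) (t : ℝ) :
    HasDerivAt (fun t => gaugeZ (b t) (u t) (v t))
      (-Complex.I * (((‖b t‖ ^ 2 - 3 * ‖v t‖ ^ 2 - (s - 2) * E : ℝ) : ℂ) * gaugeZ (b t) (u t) (v t)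
        + gaugeZ (b t) (u t) (v t) ^ 2
        + ((E * (‖b t‖ ^ 2 - ‖v t‖ ^ 2) - 2 * ‖v t‖ ^ 2 * ‖b t‖ ^ 2
          + (‖v t‖ ^ 2) ^ 2 : ℝ) : ℂ))) t := by
  refine (((h.flow.deriv_b t).conj_complex.mul (h.flow.deriv_v t)).mul
    (h.flow.deriv_u t).conj_complex).congr_deriv ?_
  have h1 := h.energy t
  apply Complex.ext
  · simp only [Pi.mul_apply, gaugeB, gaugeU, gaugeV, gaugeZ, Complex.mul_re, Complex.mul_im,
      Complex.add_re, Complex.add_im, Complex.neg_re, Complex.neg_im, Complex.I_re, Complex.I_im,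
      Complex.ofReal_re, Complex.ofReal_im, Complex.conj_re, Complex.conj_im, pow_two,
      Complex.norm_mul_self_eq_normSq, Complex.normSq_apply] at h1 ⊢
    ring
  · simp only [Pi.mul_apply, gaugeB, gaugeU, gaugeV, gaugeZ, Complex.mul_re, Complex.mul_im,
      Complex.add_re, Complex.add_im, Complex.neg_re, Complex.neg_im, Complex.I_re, Complex.I_im,
      Complex.ofReal_re, Complex.ofReal_im, Complex.conj_re, Complex.conj_im, pow_two,
      Complex.norm_mul_self_eq_normSq, Complex.normSq_apply] at h1 ⊢
    linear_combination (-(((b t).re * (b t).re + (b t).im * (b t).im)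
      - ((v t).re * (v t).re + (v t).im * (v t).im))) * h1

/-- Conservation of `S`. -/
lemma gaugeK_const (h : IsGaugeSolution s N E b u v) (t t' : ℝ) :
    gaugeK s N E (b t) (u t) (v t) = gaugeK s N E (b t') (u t') (v t') := by
  have hd : ∀ t, HasDerivAt (fun t => gaugeK s N E (b t) (u t) (v t)) 0 t := by
    intro t
    have hy := h.hasDerivAt_gaugeY t
    have hR := (h.hasDerivAt_gaugeZ t).re_complex
    refine ((hy.mul ((hR.const_mul 2).const_add N)).add
      (((hy.const_mul 2).const_sub 1).mul (((hy.const_mul s).sub_const (s - 1)).const_mul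
        E))).congr_deriv ?_
    have h1 := h.normSq_v t
    have h2 := h.particle t
    rw [h1] at h2
    rw [h1, show ‖b t‖ ^ 2 = N - E * (s * gaugeY (u t) - (s - 1)) by linarith]
    simp only [Complex.mul_re, Complex.mul_im, Complex.add_re,
      Complex.add_im, Complex.neg_re, Complex.neg_im, Complex.I_re, Complex.I_im, Complex.ofReal_re,
      Complex.ofReal_im, pow_two]
    ring
  exact is_const_of_deriv_eq_zero (fun t => (hd t).differentiableAt) (fun t => (hd t).deriv) t t'

/-- The first-order equation of motion of `y`, squared. -/
lemma gaugeY_deriv_sq (h : IsGaugeSolution s N E b u v) (t : ℝ) :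
    (-2 * gaugeY (u t) * (gaugeZ (b t) (u t) (v t)).im) ^ 2
      + (gaugeK s N E (b t) (u t) (v t) - gaugeY (u t) * N
        - (1 - 2 * gaugeY (u t)) * (E * (s * gaugeY (u t) - (s - 1)))) ^ 2
      = 4 * gaugeY (u t) * (1 - gaugeY (u t)) * (N - E * (s * gaugeY (u t) - (s - 1)))
        * (E * (s * gaugeY (u t) - (s - 1))) := by
  have h1 := h.normSq_v t
  have h2 := h.particle t
  have h3 := gaugeZ_normSq (b t) (u t) (v t)
  have h4 := gaugeY_mul (u t)
  rw [h1, show ‖b t‖ ^ 2 = N - E * (s * gaugeY (u t) - (s - 1)) by linarith] at h3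
  unfold gaugeK
  linear_combination 4 * gaugeY (u t) ^ 2 * h3 + 4 * gaugeY (u t) *
    (N - E * (s * gaugeY (u t) - (s - 1))) * (E * (s * gaugeY (u t) - (s - 1))) * h4

/-- The second-order equation of motion of `y` is linear. -/
lemma hasDerivAt_gaugeY_deriv (h : IsGaugeSolution s N E b u v) (t : ℝ) :
    HasDerivAt (fun t => -2 * gaugeY (u t) * (gaugeZ (b t) (u t) (v t)).im)
      (2 * (1 - gaugeY (u t)) * (N - E * (s * gaugeY (u t) - (s - 1)))
          * (E * (s * gaugeY (u t) - (s - 1)))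
        + (N - 4 * (E * (s * gaugeY (u t) - (s - 1))) - (s - 2) * E)
          * (gaugeK s N E (b t) (u t) (v t) - gaugeY (u t) * N
              - (1 - 2 * gaugeY (u t)) * (E * (s * gaugeY (u t) - (s - 1))))
        + 2 * gaugeY (u t) * (E * (N - 2 * (E * (s * gaugeY (u t) - (s - 1))))
          - 2 * (E * (s * gaugeY (u t) - (s - 1))) * (N - E * (s * gaugeY (u t) - (s - 1)))
          + (E * (s * gaugeY (u t) - (s - 1))) ^ 2)) t := by
  have hy := h.hasDerivAt_gaugeY t
  have hJ := (h.hasDerivAt_gaugeZ t).im_complex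
  refine ((hy.const_mul (-2)).mul hJ).congr_deriv ?_
  have h1 := h.normSq_v t
  have h2 := h.particle t
  have h3 := gaugeZ_normSq (b t) (u t) (v t)
  have h4 := gaugeY_mul (u t)
  rw [h1, show ‖b t‖ ^ 2 = N - E * (s * gaugeY (u t) - (s - 1)) by linarith] at h3 ⊢
  unfold gaugeK
  simp only [Complex.mul_re, Complex.mul_im, Complex.add_re,
      Complex.add_im, Complex.neg_re, Complex.neg_im, Complex.I_re, Complex.I_im, Complex.ofReal_re,
      Complex.ofReal_im, pow_two] at h3 h4 ⊢
  linear_combination 2 * gaugeY (u t) * h3 + 2 *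
    (N - E * (s * gaugeY (u t) - (s - 1))) * (E * (s * gaugeY (u t) - (s - 1))) * h4

end IsGaugeSolution

/-! ### Solutions on the invariant manifold -/

/-- The factor `(1 + F) ^ (-s / 2)` relating the variables `u, v` to `p, c`. -/
def gaugeW (s : ℝ) (u : ℂ) : ℝ := gaugeY u ^ (s / 2)

lemma gaugeW_pos (s : ℝ) (u : ℂ) : 0 < gaugeW s u := Real.rpow_pos_of_pos (gaugeY_pos u) _

lemma gaugeW_sq (s : ℝ) (u : ℂ) : gaugeW s u ^ 2 = gaugeY u ^ s := by
  unfold gaugeW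
  rw [← Real.rpow_natCast, ← Real.rpow_mul (gaugeY_pos u).le]
  norm_num

lemma gaugeW_sq_mul (s : ℝ) (u : ℂ) : gaugeW s u ^ 2 * (1 + ‖u‖ ^ 2) ^ s = 1 := by
  have h : 0 < 1 + ‖u‖ ^ 2 := by positivity
  have h' : 0 < (1 + ‖u‖ ^ 2) ^ s := by positivity
  rw [gaugeW_sq, gaugeY, Real.inv_rpow h.le]
  field_simp

lemma norm_sq_mul_gaugeW (s : ℝ) (u v : ℂ) : ‖v * gaugeW s u‖ ^ 2 = ‖v‖ ^ 2 * gaugeW s u ^ 2 := by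
  rw [norm_mul, Complex.norm_real, mul_pow, Real.norm_eq_abs, sq_abs]

lemma norm_sq_mul_gaugeW_eq (s : ℝ) (u : ℂ) : ‖u * gaugeW s u‖ ^ 2 = genFInv s (‖u‖ ^ 2) := by
  have h' : 0 < (1 + ‖u‖ ^ 2) ^ s := by positivity
  rw [norm_sq_mul_gaugeW, genFInv, eq_div_iff h'.ne']
  linear_combination ‖u‖ ^ 2 * gaugeW_sq_mul s u

section
variable {s : ℝ} (hs : 1 < s) {u : ℂ} (hu : (s - 1) * ‖u‖ ^ 2 < 1)
include hs hu

lemma norm_sq_mul_gaugeW_lt : ‖u * gaugeW s u‖ ^ 2 < xc s := by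
  have hs1 : 0 < s - 1 := by linarith
  rw [norm_sq_mul_gaugeW_eq]
  exact genFInv_lt hs (sq_nonneg _) (by rw [lt_div_iff₀ hs1]; linarith)

lemma genF_mul_gaugeW : genF s (‖u * gaugeW s u‖ ^ 2) = ‖u‖ ^ 2 := by
  have hs1 : 0 < s - 1 := by linarith
  rw [norm_sq_mul_gaugeW_eq]
  exact genF_genFInv hs (sq_nonneg _) (by rw [lt_div_iff₀ hs1]; linarith)

end

lemma I_mul_gaugeZ_im (b u v : ℂ) : Complex.I * ((gaugeZ b u v).im : ℂ)
    = ((starRingEnd ℂ) b * v * (starRingEnd ℂ) u - b * (starRingEnd ℂ) v * u) / 2 := by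
  have h : gaugeZ b u v - (starRingEnd ℂ) (gaugeZ b u v) = 2 * (gaugeZ b u v).im * Complex.I := by
    apply Complex.ext <;> simp
    ring
  have h2 : (starRingEnd ℂ) (gaugeZ b u v) = b * (starRingEnd ℂ) v * u := by simp [gaugeZ]
  rw [h2] at h
  rw [gaugeZ] at h ⊢
  linear_combination -h / 2

lemma sq_norm_eq_conj_mul (z : ℂ) : ((‖z‖ : ℂ)) ^ 2 = (starRingEnd ℂ) z * z := by
  rw [Complex.conj_mul']

lemma gaugeV_sub (s E : ℝ) (b u v : ℂ) :
    gaugeV s E b u v - Complex.I * (gaugeZ b u v).im * (s * v)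
      = (((s + 1) * ‖b‖ ^ 2 + E : ℝ) : ℂ) * v
        + (((s + 1) * ‖v‖ ^ 2 + (s - 1) * E : ℝ) : ℂ) * (b * u) := by
  rw [I_mul_gaugeZ_im, gaugeV]
  push_cast
  rw [sq_norm_eq_conj_mul, sq_norm_eq_conj_mul]
  ring

lemma gaugeU_sub (s : ℝ) (b u v : ℂ) :
    gaugeU s b u v - Complex.I * (gaugeZ b u v).im * (s * u)
      = (((s - 1) * ‖b‖ ^ 2 + ‖v‖ ^ 2 : ℝ) : ℂ) * u + (starRingEnd ℂ) b * v
        + (s - 1) * (b * (starRingEnd ℂ) v * u ^ 2) := by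
  rw [I_mul_gaugeZ_im, gaugeU]
  push_cast
  rw [sq_norm_eq_conj_mul, sq_norm_eq_conj_mul, sq_norm_eq_conj_mul]
  ring

/-! ### Sobolev norms on the manifold -/

/-- A summable majorant of the Sobolev terms on the manifold. -/
def sobolevMajorant (s ξ q : ℝ) : ℕ → ℝ
  | 0 => 1
  | n + 1 => ((n : ℝ) + 1 + 1) ^ (2 * ξ) * (fussCatalan s (n + 1) * q ^ n)

lemma summable_sobolevMajorant {s : ℝ} (hs : 1 < s) (ξ : ℝ) {q : ℝ} (h0 : 0 ≤ q) (hq : q < xc s) :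
    Summable (sobolevMajorant s ξ q) := by
  rw [← summable_nat_add_iff 1]
  simpa [sobolevMajorant] using summable_fussCatalan_add hs h0 hq (2 * ξ) 1

lemma sobolevTerm_ansatz_succ {s : ℝ} (hs : 1 < s) (ξ : ℝ) (b c p : ℂ) (n : ℕ) :
    sobolevTerm ξ (ansatz s b c p) (n + 1)
      = ‖c‖ ^ 2 * (((n : ℝ) + 1 + 1) ^ (2 * ξ) * (fussCatalan s (n + 1) * (‖p‖ ^ 2) ^ n)) := by
  simp only [sobolevTerm, ansatz, norm_mul, Complex.norm_real, norm_pow, mul_pow,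
    Real.norm_eq_abs, sq_abs, f_sq hs]
  push_cast
  ring

lemma sobolevTerm_ansatz_zero (s ξ : ℝ) (b c p : ℂ) :
    sobolevTerm ξ (ansatz s b c p) 0 = ‖b‖ ^ 2 := by simp [sobolevTerm, ansatz]

lemma sobolevTerm_nonneg (ξ : ℝ) (a : ℕ → ℂ) (n : ℕ) : 0 ≤ sobolevTerm ξ a n := by
  unfold sobolevTerm; positivity

lemma sobolevTerm_ansatz_le {s : ℝ} (hs : 1 < s) (ξ : ℝ) {N q : ℝ} {b c p : ℂ} (hb : ‖b‖ ^ 2 ≤ N)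
    (hc : ‖c‖ ^ 2 ≤ N) (hp : ‖p‖ ^ 2 ≤ q) (n : ℕ) :
    sobolevTerm ξ (ansatz s b c p) n ≤ N * sobolevMajorant s ξ q n := by
  have hN : 0 ≤ N := (sq_nonneg _).trans hb
  cases n with
  | zero => simpa [sobolevTerm_ansatz_zero, sobolevMajorant] using hb
  | succ n =>
    rw [sobolevTerm_ansatz_succ hs, sobolevMajorant]
    have := (fussCatalan_pos hs (n + 1)).le
    gcongr

lemma summable_sobolevTerm_ansatz {s : ℝ} (hs : 1 < s) (ξ : ℝ) (b c : ℂ) {p : ℂ}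
    (hp : ‖p‖ ^ 2 < xc s) : Summable (sobolevTerm ξ (ansatz s b c p)) :=
  ((summable_sobolevMajorant hs ξ (sq_nonneg _) hp).mul_left
    (max (‖b‖ ^ 2) (‖c‖ ^ 2))).of_nonneg_of_le (sobolevTerm_nonneg ξ _)
    (sobolevTerm_ansatz_le hs ξ (le_max_left _ _) (le_max_right _ _) le_rfl)

namespace IsGaugeSolution
variable {s N E : ℝ} {b u v : ℝ → ℂ}

lemma hasDerivAt_gaugeW (h : IsGaugeSolution s N E b u v) (t : ℝ) :
    HasDerivAt (fun t => gaugeW s (u t))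
      (-s * (gaugeZ (b t) (u t) (v t)).im * gaugeW s (u t)) t := by
  have hy := gaugeY_pos (u t)
  refine ((h.hasDerivAt_gaugeY t).rpow_const (p := s / 2) (Or.inl hy.ne')).congr_deriv ?_
  rw [gaugeW, Real.rpow_sub_one hy.ne']
  field_simp

lemma hasDerivAt_mul_gaugeW (h : IsGaugeSolution s N E b u v) {g : ℝ → ℂ} {g' : ℂ} {t : ℝ}
    (hg : HasDerivAt g (-Complex.I * g') t) :
    HasDerivAt (fun t => g t * gaugeW s (u t)) (-Complex.I *
      ((g' - Complex.I * (gaugeZ (b t) (u t) (v t)).im * (s * g t)) * gaugeW s (u t))) t := by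
  refine (hg.mul (h.hasDerivAt_gaugeW t).ofReal_comp).congr_deriv ?_
  push_cast
  linear_combination (-((gaugeZ (b t) (u t) (v t)).im : ℂ) * (s * g t) * gaugeW s (u t))
    * Complex.I_mul_I

lemma continuous_u (h : IsGaugeSolution s N E b u v) : Continuous u :=
  continuous_iff_continuousAt.2 fun t => (h.flow.deriv_u t).continuousAt

/-- As long as `F` stays below its critical value, a solution of the polynomial system is a
solution of the Z-Hamiltonian system on the manifold. -/
theorem isSolutionOn (hs : 1 < s) (h : IsGaugeSolution s N E b u v) {J : Set ℝ}
    (hJ : ∀ t ∈ J, (s - 1) * ‖u t‖ ^ 2 < 1) :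
    IsSolutionOn s (fun t => ansatz s (b t) (v t * gaugeW s (u t)) (u t * gaugeW s (u t))) J := by
  have hs1 : 0 < s - 1 := by linarith
  refine ⟨⟨2, by norm_num, fun K hKJ hK => ?_⟩, fun t ht n => ?_⟩
  · rcases K.eq_empty_or_nonempty with rfl | hne
    · exact ⟨0, fun t ht => ht.elim⟩
    have hcont : Continuous fun t => genFInv s (‖u t‖ ^ 2) :=
      (continuousOn_genFInv s).comp_continuous (h.continuous_u.norm.pow 2)
        fun t => Set.mem_Ici.2 (sq_nonneg _)
    obtain ⟨τ, hτ, hmax⟩ := hK.exists_isMaxOn hne hcont.continuousOn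
    have hq : genFInv s (‖u τ‖ ^ 2) < xc s :=
      norm_sq_mul_gaugeW_eq s (u τ) ▸ norm_sq_mul_gaugeW_lt hs (hJ τ (hKJ hτ))
    have hmaj := summable_sobolevMajorant hs 2 (genFInv_nonneg (sq_nonneg _)) hq
    refine ⟨∑' n, N * sobolevMajorant s 2 (genFInv s (‖u τ‖ ^ 2)) n, fun t ht => ?_⟩
    have hlt := norm_sq_mul_gaugeW_lt hs (hJ t (hKJ ht))
    have hsum := summable_sobolevTerm_ansatz hs 2 (b t) (v t * gaugeW s (u t)) hlt
    refine ⟨hsum, hsum.tsum_le_tsum (sobolevTerm_ansatz_le hs 2 ?_ ?_ ?_) (hmaj.mul_left N)⟩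
    · linarith [h.particle t, sq_nonneg ‖v t‖]
    · have hw : gaugeW s (u t) ^ 2 ≤ 1 := by
        rw [gaugeW_sq]
        exact Real.rpow_le_one (gaugeY_pos _).le (gaugeY_le_one _) (by linarith)
      rw [norm_sq_mul_gaugeW]
      nlinarith [h.particle t, sq_nonneg ‖v t‖, sq_nonneg ‖b t‖]
    · rw [norm_sq_mul_gaugeW_eq]
      exact hmax ht
  · have hu := hJ t ht
    have hlt := norm_sq_mul_gaugeW_lt hs hu
    have hgF := genF_mul_gaugeW hs hu
    have hE := h.energy t
    have hW := gaugeW_sq_mul s (u t)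
    have hden : 1 - (s - 1) * ‖u t‖ ^ 2 ≠ 0 := by linarith
    have hD := genFDeriv_eq hs (sq_nonneg _) hlt
    have hQ := genQuotDeriv_eq hs (sq_nonneg _) hlt
    rw [hgF] at hD hQ
    set w := gaugeW s (u t) with hw
    set D := genFDeriv s (‖u t * w‖ ^ 2)
    set Q := genQuotDeriv s (‖u t * w‖ ^ 2)
    set Φ := (1 + ‖u t‖ ^ 2) ^ s with hΦ
    -- the three series, expressed through `v` and `E`
    have r1 : ‖v t‖ ^ 2 * w ^ 2 * Φ = ‖v t‖ ^ 2 := by linear_combination ‖v t‖ ^ 2 * hW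
    have r2 : ‖v t‖ ^ 2 * w ^ 2 * D = E := by
      apply mul_right_cancel₀ hden
      linear_combination ‖v t‖ ^ 2 * w ^ 2 * hD + ‖v t‖ ^ 2 * (1 + ‖u t‖ ^ 2) * hW + hE
    have r3 : ‖v t‖ ^ 2 * w ^ 4 * Q = ‖v t‖ ^ 2 + (s - 1) * E := by
      apply mul_right_cancel₀ hden
      linear_combination ‖v t‖ ^ 2 * w ^ 4 * hQ + ‖v t‖ ^ 2 * s * (w ^ 2 * Φ + 1) * hW
        + (s - 1) * hE
    have c1 := congrArg (fun r : ℝ => (r : ℂ)) r1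
    have c2 := congrArg (fun r : ℝ => (r : ℂ)) r2
    have c3 := congrArg (fun r : ℝ => (r : ℂ)) r3
    push_cast at c1 c2 c3
    have n1 := sq_norm_eq_conj_mul (v t)
    have n2 := sq_norm_eq_conj_mul (b t)
    cases n with
    | zero =>
      have hsum := hasSum_interaction_zero hs (b t) (v t * w) hlt
      rw [hgF] at hsum
      refine ⟨hsum.summable, ?_⟩
      rw [hsum.tsum_eq]
      refine HasDerivAt.hasDerivWithinAt ?_
      refine (h.flow.deriv_b t).congr_deriv ?_
      simp only [gaugeB, map_mul, Complex.conj_ofReal, ← hΦ]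
      change _ = -Complex.I * ((starRingEnd ℂ) (b t) * b t ^ 2 +
        (starRingEnd ℂ) (v t) * (w : ℂ) * (v t * w) * (((s - 1) * (D : ℂ) + 2 * (Φ : ℂ)) * b t +
          v t * w * ((starRingEnd ℂ) (u t) * w) * (Q : ℂ)))
      push_cast
      rw [n1] at c1 c2 c3 ⊢
      rw [n2]
      linear_combination Complex.I * (2 * b t * c1 + (s - 1) * b t * c2 +
        v t * (starRingEnd ℂ) (u t) * c3)
    | succ n =>
      have hsum := hasSum_interaction_succ hs (b t) (v t * w) hlt n
      rw [hgF] at hsum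
      refine ⟨hsum.summable, ?_⟩
      rw [hsum.tsum_eq]
      refine HasDerivAt.hasDerivWithinAt ?_
      have hv := h.flow.deriv_v t
      have hu' := h.flow.deriv_u t
      simp only [Complex.ofReal_one, one_mul] at hv hu'
      have hC := h.hasDerivAt_mul_gaugeW hv
      have hP := h.hasDerivAt_mul_gaugeW hu'
      rw [gaugeV_sub] at hC
      rw [gaugeU_sub] at hP
      refine ((hC.const_mul (f s (n + 1) : ℂ)).mul (hP.fun_pow n)).congr_deriv ?_
      simp only [map_mul, Complex.conj_ofReal, ← hΦ, ← hw]
      change _ = -Complex.I * ((f s (n + 1) : ℂ) * ((starRingEnd ℂ) (b t) *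
        (((s - 1) * (n + 1) + 2) * (b t * (v t * w) * (u t * w) ^ n) +
          n * ((v t * w) ^ 2 * (u t * w) ^ (n - 1))) +
        (u t * w) ^ n * ((starRingEnd ℂ) (v t) * w * (v t * w)) *
          ((((s - 1) * (n + 1) + 2) * (Φ : ℂ) + (s - 1) * (D : ℂ)) * (b t * (u t * w)) +
            (n * (Φ : ℂ) + (D : ℂ)) * (v t * w))))
      push_cast
      rw [n1] at c1 c2 c3 ⊢
      rw [n2]
      cases n with
      | zero =>
        simp only [pow_zero, Nat.cast_zero]
        linear_combination (Complex.I * f s (0 + 1)) *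
          ((((s - 1) * (0 + 1) + 2) * (b t * (u t * w))) * c1 +
            ((s - 1) * (b t * (u t * w)) + v t * w) * c2)
      | succ m =>
        simp only [add_tsub_cancel_right, pow_succ]
        push_cast
        linear_combination (Complex.I * f s (m + 1 + 1)) * ((u t * w) ^ m * (u t * w)) *
          ((((s - 1) * (m + 1 + 1) + 2) * (b t * (u t * w)) + (m + 1) * (v t * w)) * c1 +
            ((s - 1) * (b t * (u t * w)) + v t * w) * c2)

end IsGaugeSolution

/-! ### From data on the manifold to solutions of the polynomial system -/

lemma energy_ansatz_pos {s : ℝ} (hs : 1 < s) (b : ℂ) {c p : ℂ} (hc : c ≠ 0)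
    (hp : ‖p‖ ^ 2 < xc s) : 0 < energy (ansatz s b c p) := by
  have h0 : 0 ≤ ‖p‖ ^ 2 := sq_nonneg _
  have hF := genF_nonneg s h0
  have h1 := one_sub_genF_pos hs h0 hp
  have h2 := genFDeriv_eq hs h0 hp
  have h3 : 0 < genFDeriv s (‖p‖ ^ 2) := by
    refine pos_of_mul_pos_left ?_ h1.le
    rw [h2]
    positivity
  rw [energy_ansatz hs b c hp]
  positivity

lemma particleNumber_ansatz_pos {s : ℝ} (hs : 1 < s) (b : ℂ) {c p : ℂ} (hc : c ≠ 0)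
    (hp : ‖p‖ ^ 2 < xc s) : 0 < particleNumber (ansatz s b c p) := by
  have hF := genF_nonneg s (sq_nonneg ‖p‖)
  have : 0 < 1 + genF s (‖p‖ ^ 2) := by linarith
  rw [particleNumber_ansatz hs b c hp]
  positivity

/-- The value of `S` in the variables `b, u, v`. -/
lemma Sval_eq {s : ℝ} {b c p u v : ℂ}
    (hu : u * gaugeW s u = p) (hv : v * gaugeW s u = c) (hF : genF s (‖p‖ ^ 2) = ‖u‖ ^ 2) :
    Sval s b c p = 2 * s * gaugeK s (particleNumber (ansatz s b c p)) (energy (ansatz s b c p))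
      b u v := by
  have hW := gaugeW_sq_mul s u
  have hpos : 0 < 1 + ‖u‖ ^ 2 := by positivity
  have e1 : (1 + ‖u‖ ^ 2) ^ s * (b * p * (starRingEnd ℂ) c + (starRingEnd ℂ) b *
      (starRingEnd ℂ) p * c).re = 2 * (gaugeZ b u v).re := by
    rw [← hu, ← hv]
    simp only [gaugeZ, map_mul, Complex.mul_re, Complex.mul_im, Complex.add_re, Complex.conj_re,
      Complex.conj_im, Complex.conj_ofReal, Complex.ofReal_re, Complex.ofReal_im]
    linear_combination (2 * ((b.re * u.re - b.im * u.im) * v.re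
      + (b.re * u.im + b.im * u.re) * v.im)) * hW
  rw [Sval, gaugeK, hF, add_comm (‖u‖ ^ 2) 1, e1, gaugeY]
  field_simp
  ring

/-- Every point of the manifold lies on a global solution of the polynomial system. -/
theorem exists_gaugeSolution {s : ℝ} (hs : 1 < s) (b : ℂ) {c p : ℂ} (hc : c ≠ 0)
    (hp : ‖p‖ ^ 2 < xc s) :
    ∃ B u v : ℝ → ℂ,
      IsGaugeSolution s (particleNumber (ansatz s b c p)) (energy (ansatz s b c p)) B u v ∧
      B 0 = b ∧ v 0 * gaugeW s (u 0) = c ∧ u 0 * gaugeW s (u 0) = p ∧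
      (s - 1) * ‖u 0‖ ^ 2 < 1 ∧
      Sval s b c p = 2 * s * gaugeK s (particleNumber (ansatz s b c p))
        (energy (ansatz s b c p)) b (u 0) (v 0) := by
  have h0 : 0 ≤ ‖p‖ ^ 2 := sq_nonneg _
  have hF0 := genF_nonneg s h0
  have hE := energy_ansatz_pos hs b hc hp
  set F := genF s (‖p‖ ^ 2) with hF
  have hF1 : 0 < 1 + F := by linarith
  set W : ℝ := (1 + F) ^ (s / 2) with hW
  have hW0 : 0 < W := by positivity
  have hW2 : W ^ 2 = (1 + F) ^ s := by
    rw [hW, ← Real.rpow_natCast, ← Real.rpow_mul hF1.le]; norm_num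
  have nu : ‖p * W‖ ^ 2 = F := by
    rw [norm_mul, Complex.norm_real, mul_pow, Real.norm_eq_abs, sq_abs, hW2]
    exact (genF_eq hs h0 hp.le).symm
  have nv : ‖c * W‖ ^ 2 = ‖c‖ ^ 2 * (1 + F) ^ s := by
    rw [norm_mul, Complex.norm_real, mul_pow, Real.norm_eq_abs, sq_abs, hW2]
  have hw : gaugeW s (p * W) = W⁻¹ := by
    rw [gaugeW, gaugeY, nu, Real.inv_rpow hF1.le]
  have hD := genFDeriv_eq hs h0 hp
  have hN := particleNumber_ansatz hs b c hp
  have hen : ‖c * W‖ ^ 2 * (1 + ‖p * W‖ ^ 2)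
      = energy (ansatz s b c p) * (1 - (s - 1) * ‖p * W‖ ^ 2) := by
    rw [nu, nv, energy_ansatz hs b c hp]
    linear_combination -‖c‖ ^ 2 * hD
  obtain ⟨B, u, v, hB, hu, hv, hfl⟩ := exists_gaugeFlow hs hE 0 b (p * W) (c * W)
    (by linarith)
  have hWc : (W : ℂ) ≠ 0 := by exact_mod_cast hW0.ne'
  have up : u 0 * gaugeW s (u 0) = p := by
    rw [hu, hw]; push_cast; field_simp
  have vc : v 0 * gaugeW s (u 0) = c := by
    rw [hv, hu, hw]; push_cast; field_simp
  refine ⟨B, u, v, ⟨hfl, fun t => ?_, fun t => ?_⟩, hB, vc, up, ?_, ?_⟩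
  · rw [hfl.particle_const t 0, hB, hv, nv, hN]
  · have := hfl.energy_const t 0
    rw [hu, hv] at this
    linarith
  · rw [hu, nu]
    linarith [one_sub_genF_pos hs h0 hp]
  · exact Sval_eq up vc (by rw [hu, nu])

namespace IsGaugeSolution
variable {s N E : ℝ} {b u v : ℝ → ℂ}

lemma shift (h : IsGaugeSolution s N E b u v) (τ : ℝ) :
    IsGaugeSolution s N E (fun t => b (t - τ)) (fun t => u (t - τ)) (fun t => v (t - τ)) where
  flow := ⟨fun t => (h.flow.deriv_b (t - τ)).comp_sub_const t τ,
    fun t => (h.flow.deriv_u (t - τ)).comp_sub_const t τ,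
    fun t => (h.flow.deriv_v (t - τ)).comp_sub_const t τ⟩
  particle t := h.particle (t - τ)
  energy t := h.energy (t - τ)

lemma normSq_u_le (hE : 0 < E) (h : IsGaugeSolution s N E b u v) (t : ℝ) :
    (s - 1) * ‖u t‖ ^ 2 ≤ 1 := by
  have h1 := h.energy t
  have h2 : 0 ≤ E * (1 - (s - 1) * ‖u t‖ ^ 2) := by rw [← h1]; positivity
  linarith [nonneg_of_mul_nonneg_right h2 hE]

/-- If `S ≠ 2 (s - 1) N`, then `v` stays away from `0`. -/
lemma exists_le_normSq_v (hs : 1 < s) (hE : 0 < E) (h : IsGaugeSolution s N E b u v)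
    (hK : gaugeK s N E (b 0) (u 0) (v 0) ≠ (s - 1) / s * N) :
    ∃ δ : ℝ, 0 < δ ∧ ∀ t, δ ≤ ‖v t‖ ^ 2 := by
  have hs0 : 0 < s := by linarith
  have hs1 : 0 < s - 1 := by linarith
  have hN : 0 ≤ N := by rw [← h.particle 0]; positivity
  set κ := gaugeK s N E (b 0) (u 0) (v 0) with hκ
  have hκ0 : 0 < |κ - (s - 1) / s * N| := abs_pos.2 (sub_ne_zero.2 hK)
  set M := (N / (s * E) + 1) * √N + 2 * (√N * √(1 / (s - 1))) + 1 with hM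
  have hM0 : 0 < M := by positivity
  refine ⟨(|κ - (s - 1) / s * N| / M) ^ 2, by positivity, fun t => ?_⟩
  have hy0 := gaugeY_pos (u t)
  have hy1 := gaugeY_le_one (u t)
  have he := h.normSq_v t
  have hvN : ‖v t‖ ≤ √N := Real.le_sqrt_of_sq_le (by linarith [h.particle t, sq_nonneg ‖b t‖])
  have hbN : ‖b t‖ ≤ √N := Real.le_sqrt_of_sq_le (by linarith [h.particle t, sq_nonneg ‖v t‖])
  have hu : ‖u t‖ ≤ √(1 / (s - 1)) :=
    Real.le_sqrt_of_sq_le (by rw [le_div_iff₀ hs1]; linarith [h.normSq_u_le hE t])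
  have hR : |(gaugeZ (b t) (u t) (v t)).re| ≤ √N * √(1 / (s - 1)) * ‖v t‖ := by
    refine (Complex.abs_re_le_norm _).trans ?_
    simp only [gaugeZ, norm_mul, RCLike.norm_conj]
    calc ‖b t‖ * ‖v t‖ * ‖u t‖ ≤ √N * ‖v t‖ * √(1 / (s - 1)) := by gcongr
      _ = _ := by ring
  have hκt : κ = gaugeK s N E (b t) (u t) (v t) := h.gaugeK_const 0 t
  have hyc : gaugeY (u t) - (s - 1) / s = ‖v t‖ ^ 2 / (s * E) := by
    rw [he]; field_simp
  -- every term of the deviation contains a factor `v`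
  have e1 : κ - (s - 1) / s * N = ‖v t‖ ^ 2 / (s * E) * N
      + 2 * (gaugeY (u t) * (gaugeZ (b t) (u t) (v t)).re)
      + (1 - 2 * gaugeY (u t)) * ‖v t‖ ^ 2 := by
    rw [hκt, gaugeK, ← he, ← hyc]; ring
  have b1 : |gaugeY (u t) * (gaugeZ (b t) (u t) (v t)).re| ≤ √N * √(1 / (s - 1)) * ‖v t‖ := by
    rw [abs_mul, abs_of_pos hy0]
    exact (mul_le_of_le_one_left (abs_nonneg _) hy1).trans hR
  have b2 : |(1 - 2 * gaugeY (u t)) * ‖v t‖ ^ 2| ≤ √N * ‖v t‖ := by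
    rw [abs_mul, abs_of_nonneg (sq_nonneg ‖v t‖)]
    have : |1 - 2 * gaugeY (u t)| ≤ 1 := by rw [abs_le]; constructor <;> linarith
    calc |1 - 2 * gaugeY (u t)| * ‖v t‖ ^ 2 ≤ 1 * (‖v t‖ * ‖v t‖) := by rw [pow_two]; gcongr
      _ ≤ _ := by rw [one_mul]; gcongr
  have b3 : |‖v t‖ ^ 2 / (s * E) * N| ≤ N / (s * E) * √N * ‖v t‖ := by
    rw [abs_of_nonneg (by positivity)]
    calc ‖v t‖ ^ 2 / (s * E) * N = N / (s * E) * ‖v t‖ * ‖v t‖ := by ring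
      _ ≤ _ := by gcongr
  have hle : |κ - (s - 1) / s * N| ≤ M * ‖v t‖ := by
    rw [e1]
    have a1 := abs_le.1 b1
    have a2 := abs_le.1 b2
    have a3 := abs_le.1 b3
    have := norm_nonneg (v t)
    rw [abs_le, hM]
    constructor <;> nlinarith
  have : |κ - (s - 1) / s * N| / M ≤ ‖v t‖ := by
    rw [div_le_iff₀ hM0]; linarith
  gcongr

end IsGaugeSolution

/-! ### The condensing motion -/

/-- The discriminant `D = (N - s E)² + (s - 1) (N + s E)²`. -/
def discr (s N E : ℝ) : ℝ := (N - s * E) ^ 2 + (s - 1) * (N + s * E) ^ 2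

/-- The explicit motion of `1 / (1 + F)` for condensing solutions. -/
def ysol (s N E t : ℝ) : ℝ :=
  (s - 1) / s + 4 * (s - 1) * N * E / discr s N E * Real.cos (Omega s N E * t) ^ 2

section
variable {s N E : ℝ} (hs : 1 < s) (hN : 0 < N) (hE : 0 < E)
include hs hN hE

lemma discr_pos : 0 < discr s N E := by
  have hs1 : 0 < s - 1 := by linarith
  have hs0 : 0 < s := by linarith
  unfold discr
  positivity

lemma Omega_pos : 0 < Omega s N E :=
  Real.sqrt_pos.2 (div_pos (discr_pos hs hN hE) (by linarith))

lemma Omega_sq : 4 * Omega s N E ^ 2 = discr s N E / s := by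
  have hs0 : 0 < s := by linarith
  have h := discr_pos hs hN hE
  unfold discr at h ⊢
  rw [Omega, Real.sq_sqrt (by positivity)]
  field_simp

lemma Tc_pos : 0 < Tc s N E := div_pos Real.pi_pos (by linarith [Omega_pos hs hN hE])

lemma Fsol_eq (t : ℝ) : Fsol s N E t = (ysol s N E t)⁻¹ - 1 := by
  have hs1 : 0 < s - 1 := by linarith
  have hs0 : 0 < s := by linarith
  have hD := discr_pos hs hN hE
  have hq : 0 < N + s * E := by positivity
  set S := Real.sin (Omega s N E * t) ^ 2 with hS
  have hS0 : 0 ≤ S := sq_nonneg _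
  have hS1 : S ≤ 1 := Real.sin_sq_le_one _
  have hC : Real.cos (Omega s N E * t) ^ 2 = 1 - S := by rw [Real.cos_sq']
  have hsmall : 0 < (N + s * E) ^ 2 - 4 * N * E * S := by
    have : 4 * N * E * S ≤ 4 * N * E := mul_le_of_le_one_right (by positivity) hS1
    nlinarith [sq_nonneg (N - s * E), mul_pos hN hE, mul_pos (mul_pos hN hE) hs1]
  have hy : ysol s N E t = (s - 1) * ((N + s * E) ^ 2 - 4 * N * E * S) / discr s N E := by
    rw [ysol, hC]
    field_simp
    unfold discr
    ring
  have hden : s - (1 - F0 s N E / Fc s) * S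
      = s * ((N + s * E) ^ 2 - 4 * N * E * S) / (N + s * E) ^ 2 := by
    rw [F0, Fc_eq hs]
    field_simp
    ring
  rw [Fsol, ← hS, hden, hy, F0, Fc_eq hs]
  set Q := (N + s * E) ^ 2 - 4 * N * E * S with hQ
  have hdd : discr s N E = (N - s * E) ^ 2 + (s - 1) * (N + s * E) ^ 2 := rfl
  field_simp
  rw [hdd, hQ]
  ring

lemma ysol_pos (t : ℝ) : 0 < ysol s N E t := by
  have hs1 : 0 < s - 1 := by linarith
  have hs0 : 0 < s := by linarith
  have hD := discr_pos hs hN hE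
  unfold ysol
  positivity

lemma cos_pos_of_mem {t : ℝ} (ht : t ∈ Set.Ioo (-Tc s N E) (Tc s N E)) :
    0 < Real.cos (Omega s N E * t) := by
  have hO := Omega_pos hs hN hE
  have e : Omega s N E * Tc s N E = Real.pi / 2 := by rw [Tc]; field_simp
  apply Real.cos_pos_of_mem_Ioo
  constructor <;> nlinarith [ht.1, ht.2]

lemma lt_ysol {t : ℝ} (ht : t ∈ Set.Ioo (-Tc s N E) (Tc s N E)) : (s - 1) / s < ysol s N E t := by
  have hs1 : 0 < s - 1 := by linarith
  have hD := discr_pos hs hN hE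
  have hc := cos_pos_of_mem hs hN hE ht
  have : 0 < 4 * (s - 1) * N * E / discr s N E * Real.cos (Omega s N E * t) ^ 2 := by positivity
  unfold ysol
  linarith

/-- If `S = 2 (s - 1) N`, then `y = 1 / (1 + F)` performs, up to the choice of the origin of time,
the harmonic motion `ysol`. -/
theorem IsGaugeSolution.exists_gaugeY_eq {b u v : ℝ → ℂ} (h : IsGaugeSolution s N E b u v)
    (hK : gaugeK s N E (b 0) (u 0) (v 0) = (s - 1) / s * N) (hu : (s - 1) * ‖u 0‖ ^ 2 < 1) :
    ∃ t₀ ∈ Set.Ioo (-Tc s N E) (Tc s N E), ∀ t, gaugeY (u (t - t₀)) = ysol s N E t := by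
  have hs1 : 0 < s - 1 := by linarith
  have hs0 : 0 < s := by linarith
  have hD := discr_pos hs hN hE
  have hO := Omega_pos hs hN hE
  have hO2 := Omega_sq hs hN hE
  set Ω := Omega s N E with hΩ
  set D := discr s N E with hDdef
  set y : ℝ → ℝ := fun t => gaugeY (u t) with hy
  set y1 : ℝ → ℝ := fun t => -2 * gaugeY (u t) * (gaugeZ (b t) (u t) (v t)).im with hy1
  set a : ℝ := 4 * (s - 1) * N * E / D with ha
  have ha0 : 0 < a := by positivity
  set m : ℝ := (s - 1) / s + a / 2 with hm
  have hKt : ∀ t, gaugeK s N E (b t) (u t) (v t) = (s - 1) / s * N := fun t => by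
    rw [h.gaugeK_const t 0, hK]
  have haD : a * D = 4 * (s - 1) * N * E := by rw [ha]; field_simp
  have d1 : ∀ t, HasDerivAt y (y1 t) t := fun t => h.hasDerivAt_gaugeY t
  have d2 : ∀ t, HasDerivAt y1 (-(4 * Ω ^ 2) * (y t - m)) t := by
    intro t
    refine (h.hasDerivAt_gaugeY_deriv t).congr_deriv ?_
    rw [hKt t, hO2, hm, ha]
    change _ = -(D / s) * (gaugeY (u t) - _)
    have : D = (N - s * E) ^ 2 + (s - 1) * (N + s * E) ^ 2 := rfl
    field_simp
    rw [this]
    ring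
  have energy0 : (y1 0) ^ 2 = 4 * Ω ^ 2 * ((y 0 - (s - 1) / s) * (a - (y 0 - (s - 1) / s))) := by
    have e := h.gaugeY_deriv_sq 0
    rw [hKt 0] at e
    have : D = (N - s * E) ^ 2 + (s - 1) * (N + s * E) ^ 2 := rfl
    rw [hO2]
    change (-2 * gaugeY (u 0) * (gaugeZ (b 0) (u 0) (v 0)).im) ^ 2 = _
    rw [eq_sub_of_add_eq e]
    change _ = D / s * ((gaugeY (u 0) - (s - 1) / s) * (a - (gaugeY (u 0) - (s - 1) / s)))
    rw [show D / s * ((gaugeY (u 0) - (s - 1) / s) * (a - (gaugeY (u 0) - (s - 1) / s)))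
      = (gaugeY (u 0) - (s - 1) / s) * (a * D - D * (gaugeY (u 0) - (s - 1) / s)) / s by ring, haD,
      this]
    field_simp
    ring
  -- the phase of the harmonic motion at time `0`
  have hypos : (s - 1) / s < y 0 := by
    rw [div_lt_iff₀ hs0]
    have h2 := gaugeY_mul (u 0)
    have h3 := gaugeY_pos (u 0)
    change s - 1 < gaugeY (u 0) * s
    nlinarith
  set z : ℂ := ⟨y 0 - m, -(y1 0) / (2 * Ω)⟩ with hz
  have hznorm : ‖z‖ = a / 2 := by
    have : ‖z‖ ^ 2 = (a / 2) ^ 2 := by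
      rw [Complex.sq_norm, Complex.normSq_apply]
      change (y 0 - m) * (y 0 - m) + -(y1 0) / (2 * Ω) * (-(y1 0) / (2 * Ω)) = _
      have e : -(y1 0) / (2 * Ω) * (-(y1 0) / (2 * Ω)) = (y1 0) ^ 2 / (4 * Ω ^ 2) := by
        field_simp
        ring
      rw [e, energy0, hm]
      field_simp
      ring
    exact (pow_left_inj₀ (norm_nonneg _) (by positivity) two_ne_zero).1 this
  have hzc : a / 2 * Real.cos z.arg = y 0 - m := by rw [← hznorm]; exact Complex.norm_mul_cos_arg z
  have hzs : a / 2 * Real.sin z.arg = -(y1 0) / (2 * Ω) := by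
    rw [← hznorm]; exact Complex.norm_mul_sin_arg z
  have harg : z.arg < Real.pi := by
    refine lt_of_le_of_ne (Complex.arg_le_pi z) fun he => ?_
    rw [he, Real.cos_pi, hm] at hzc
    linarith
  have harg' : -Real.pi < z.arg := Complex.neg_pi_lt_arg z
  set t₀ := z.arg / (2 * Ω) with ht₀
  have hT : Tc s N E = Real.pi / (2 * Ω) := rfl
  refine ⟨t₀, ⟨?_, ?_⟩, ?_⟩
  · rw [hT, ht₀, ← neg_div]; gcongr
  · rw [hT, ht₀]; gcongr
  -- the deviation from the explicit motion has vanishing oscillator energy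
  set g : ℝ → ℝ := fun τ => y τ - m - a / 2 * Real.cos (2 * Ω * (τ + t₀)) with hg
  set g1 : ℝ → ℝ := fun τ => y1 τ + a * Ω * Real.sin (2 * Ω * (τ + t₀)) with hg1
  have dl : ∀ τ : ℝ, HasDerivAt (fun τ : ℝ => 2 * Ω * (τ + t₀)) (2 * Ω) τ := fun τ => by
    simpa using ((hasDerivAt_id τ).add_const t₀).const_mul (2 * Ω)
  have dg : ∀ τ, HasDerivAt g (g1 τ) τ := fun τ => by
    refine (((d1 τ).sub_const m).sub (((dl τ).cos).const_mul (a / 2))).congr_deriv ?_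
    simp only [hg1]; ring
  have dg1 : ∀ τ, HasDerivAt g1 (-(4 * Ω ^ 2) * g τ) τ := fun τ => by
    refine ((d2 τ).add (((dl τ).sin).const_mul (a * Ω))).congr_deriv ?_
    simp only [hg]; ring
  have dE : ∀ τ, HasDerivAt (fun τ => g1 τ ^ 2 + 4 * Ω ^ 2 * g τ ^ 2) 0 τ := fun τ => by
    refine (((dg1 τ).fun_pow 2).add (((dg τ).fun_pow 2).const_mul (4 * Ω ^ 2))).congr_deriv ?_
    simp
    ring
  have htheta : 2 * Ω * (0 + t₀) = z.arg := by rw [ht₀]; field_simp; ring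
  have g00 : g 0 = 0 := by simp only [hg]; rw [htheta, hzc]; ring
  have g10 : g1 0 = 0 := by
    simp only [hg1]
    rw [htheta]
    have : a * Ω * Real.sin z.arg = 2 * Ω * (a / 2 * Real.sin z.arg) := by ring
    rw [this, hzs]
    field_simp
    ring
  intro t
  have hc := is_const_of_deriv_eq_zero (fun τ => (dE τ).differentiableAt) (fun τ => (dE τ).deriv)
    (t - t₀) 0
  simp only [g00, g10] at hc
  have hg0 : g (t - t₀) = 0 := by
    have h1 : 0 ≤ g1 (t - t₀) ^ 2 := sq_nonneg _
    have h2 : 0 ≤ 4 * Ω ^ 2 * g (t - t₀) ^ 2 := by positivity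
    have h3 : 4 * Ω ^ 2 * g (t - t₀) ^ 2 = 0 := by linarith
    have h4 : 4 * Ω ^ 2 ≠ 0 := by positivity
    simpa [h4] using h3
  simp only [hg, sub_add_cancel] at hg0
  change y (t - t₀) = _
  rw [ysol, Real.cos_sq (Omega s N E * t), ← hΩ, ← hDdef, ← ha,
    show 2 * (Ω * t) = 2 * Ω * t by ring]
  rw [hm] at hg0
  linarith

end

/-! ### The quartic form of the interaction -/

lemma coupling_nonneg {s : ℝ} (hs : 1 < s) (n m k j : ℕ) : 0 ≤ coupling s n m k j := by
  have h1 : 0 ≤ (s - 1) / 2 := by linarith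
  have := f_pos hs n
  have := f_pos hs m
  have := f_pos hs k
  have := f_pos hs j
  unfold coupling
  positivity

/-- The couplings grow at most linearly. -/
lemma coupling_le {s : ℝ} (hs : 1 < s) {n m k j : ℕ} (h : n + m = k + j) :
    coupling s n m k j ≤ 2 * s ^ 2 / (s - 1) * ((k + 1) * (j + 1)) := by
  have hs1 : 0 < s - 1 := by linarith
  have key : ∀ a b : ℕ, f s a * f s b ≤ √(2 * s / (s - 1)) * f s (a + b) := by
    intro a b
    unfold f
    rw [← Real.sqrt_mul (fussCatalan_pos hs a).le, ← Real.sqrt_mul (by positivity)]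
    exact Real.sqrt_le_sqrt (fussCatalan_mul_le hs a b)
  have h1 := key n m
  have h2 := key k j
  rw [← h] at h2
  have hf := f_pos hs (n + m)
  have hK : √(2 * s / (s - 1)) * √(2 * s / (s - 1)) = 2 * s / (s - 1) :=
    Real.mul_self_sqrt (by positivity)
  have h3 : f s n * f s m * f s k * f s j / f s (n + m) ^ 2 ≤ 2 * s / (s - 1) := by
    rw [div_le_iff₀ (by positivity), ← hK]
    calc f s n * f s m * f s k * f s j = (f s n * f s m) * (f s k * f s j) := by ring
      _ ≤ (√(2 * s / (s - 1)) * f s (n + m)) * (√(2 * s / (s - 1)) * f s (n + m)) :=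
        mul_le_mul h1 h2 (mul_pos (f_pos hs k) (f_pos hs j)).le (by positivity)
      _ = _ := by ring
  have hM : (n : ℝ) + m = k + j := by exact_mod_cast h
  have h4 : (s - 1) / 2 * ((n : ℝ) + m) + 1 ≤ s * ((k + 1) * (j + 1)) := by
    rw [hM]
    have : (0 : ℝ) ≤ k := Nat.cast_nonneg k
    have : (0 : ℝ) ≤ j := Nat.cast_nonneg j
    have : (0 : ℝ) ≤ s * (k * j) := by positivity
    nlinarith
  unfold coupling
  have h5 : 0 ≤ f s n * f s m * f s k * f s j / f s (n + m) ^ 2 := by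
    have := f_pos hs n
    have := f_pos hs m
    have := f_pos hs k
    have := f_pos hs j
    positivity
  calc ((s - 1) / 2 * ((n : ℝ) + m) + 1) * (f s n * f s m * f s k * f s j / f s (n + m) ^ 2)
      ≤ (s * ((k + 1) * (j + 1))) * (2 * s / (s - 1)) := mul_le_mul h4 h3 h5 (by positivity)
    _ = _ := by ring

/-- The coupling as a kernel on all quadruples `((n, m), (k, j))`, extended by zero from the
resonant ones. -/
def kernel (s : ℝ) (q : (ℕ × ℕ) × (ℕ × ℕ)) : ℝ :=
  if q.1.1 + q.1.2 = q.2.1 + q.2.2 then coupling s q.1.1 q.1.2 q.2.1 q.2.2 else 0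

lemma kernel_nonneg {s : ℝ} (hs : 1 < s) (q : (ℕ × ℕ) × (ℕ × ℕ)) : 0 ≤ kernel s q := by
  unfold kernel
  split_ifs
  exacts [coupling_nonneg hs _ _ _ _, le_rfl]

lemma kernel_le {s : ℝ} (hs : 1 < s) (q : (ℕ × ℕ) × (ℕ × ℕ)) :
    kernel s q ≤ 2 * s ^ 2 / (s - 1) * ((q.2.1 + 1) * (q.2.2 + 1)) := by
  have hs1 : 0 < s - 1 := by linarith
  unfold kernel
  split_ifs with h
  exacts [coupling_le hs h, by positivity]

lemma kernel_swap_left (s : ℝ) (n m k j : ℕ) :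
    kernel s ((m, n), (k, j)) = kernel s ((n, m), (k, j)) := by
  simp only [kernel, coupling, add_comm m n]
  congr 1
  ring

lemma kernel_swap_right (s : ℝ) (n m k j : ℕ) :
    kernel s ((n, m), (j, k)) = kernel s ((n, m), (k, j)) := by
  simp only [kernel, coupling, add_comm j k]
  congr 1
  ring

lemma kernel_swap (s : ℝ) (p q : ℕ × ℕ) : kernel s (q, p) = kernel s (p, q) := by
  simp only [kernel, coupling]
  by_cases h : p.1 + p.2 = q.1 + q.2
  · have h' : (p.1 : ℝ) + p.2 = q.1 + q.2 := by exact_mod_cast h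
    rw [if_pos h, if_pos h.symm, h, h']
    ring
  · rw [if_neg h, if_neg fun h' => h h'.symm]

/-- The terms of the quartic form `∑ C_{nmkj} ā_n b̄_m c_k d_j`. -/
def quarticTerm (s : ℝ) (a b c d : ℕ → ℂ) (q : (ℕ × ℕ) × (ℕ × ℕ)) : ℂ :=
  (kernel s q : ℂ) * (((starRingEnd ℂ) (a q.1.1) * (starRingEnd ℂ) (b q.1.2)) * (c q.2.1 * d q.2.2))

/-- The quartic form `∑ C_{nmkj} ā_n b̄_m c_k d_j` of the interaction. -/
def quartic (s : ℝ) (a b c d : ℕ → ℂ) : ℂ := ∑' q, quarticTerm s a b c d q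

/-- The weighted `ℓ¹` norm in which all sums of the interaction converge absolutely. -/
def weightedNorm (a : ℕ → ℂ) : ℝ := ∑' n : ℕ, ((n : ℝ) + 1) * ‖a n‖

/-- The weighted `ℓ¹` space. -/
def IsWeighted (a : ℕ → ℂ) : Prop := Summable fun n : ℕ => ((n : ℝ) + 1) * ‖a n‖

namespace IsWeighted
variable {a b c d : ℕ → ℂ}

lemma add (ha : IsWeighted a) (hb : IsWeighted b) : IsWeighted (a + b) := by
  refine (Summable.add ha hb).of_nonneg_of_le (fun n => by positivity) fun n => ?_
  rw [← mul_add]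
  gcongr
  exact norm_add_le _ _

lemma sub (ha : IsWeighted a) (hb : IsWeighted b) : IsWeighted (a - b) := by
  refine (Summable.add ha hb).of_nonneg_of_le (fun n => by positivity) fun n => ?_
  rw [← mul_add]
  gcongr
  exact norm_sub_le _ _

lemma summable_norm (ha : IsWeighted a) : Summable fun n => ‖a n‖ :=
  Summable.of_nonneg_of_le (fun n => norm_nonneg _)
    (fun n => le_mul_of_one_le_left (norm_nonneg _)
      (by linarith [(Nat.cast_nonneg n : (0 : ℝ) ≤ n)])) ha

lemma le_weightedNorm (ha : IsWeighted a) (n : ℕ) : ((n : ℝ) + 1) * ‖a n‖ ≤ weightedNorm a :=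
  Summable.le_tsum ha n fun _ _ => by positivity

lemma norm_le (ha : IsWeighted a) (n : ℕ) : ‖a n‖ ≤ weightedNorm a :=
  (le_mul_of_one_le_left (norm_nonneg _)
    (by linarith [(Nat.cast_nonneg n : (0 : ℝ) ≤ n)])).trans (ha.le_weightedNorm n)

lemma tsum_norm_le (ha : IsWeighted a) : ∑' n, ‖a n‖ ≤ weightedNorm a :=
  ha.summable_norm.tsum_le_tsum (fun n => le_mul_of_one_le_left (norm_nonneg _)
    (by linarith [(Nat.cast_nonneg n : (0 : ℝ) ≤ n)])) ha

lemma summable_sq (ha : IsWeighted a) : Summable fun n => ‖a n‖ ^ 2 :=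
  (ha.summable_norm.mul_left (weightedNorm a)).of_nonneg_of_le (fun n => sq_nonneg _)
    fun n => by rw [pow_two]; gcongr; exact ha.norm_le n

end IsWeighted

lemma weightedNorm_nonneg (a : ℕ → ℂ) : 0 ≤ weightedNorm a := tsum_nonneg fun _ => by positivity

lemma weightedNorm_sub_le {a b : ℕ → ℂ} (ha : IsWeighted a) (hb : IsWeighted b) :
    weightedNorm (a - b) ≤ weightedNorm a + weightedNorm b := by
  rw [weightedNorm, weightedNorm, weightedNorm, ← Summable.tsum_add ha hb]
  refine Summable.tsum_le_tsum (fun n => ?_) (ha.sub hb) (Summable.add ha hb)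
  rw [← mul_add]
  gcongr
  exact norm_sub_le _ _

lemma quartic_swap_left (s : ℝ) (a b c d : ℕ → ℂ) : quartic s b a c d = quartic s a b c d := by
  unfold quartic
  rw [← (Equiv.prodCongr (Equiv.prodComm ℕ ℕ) (Equiv.refl (ℕ × ℕ))).tsum_eq]
  refine tsum_congr fun q => ?_
  simp only [quarticTerm, Equiv.prodCongr_apply, Prod.map, Equiv.prodComm_apply, Prod.swap,
    Equiv.refl_apply]
  rw [kernel_swap_left]
  ring

lemma quartic_swap_right (s : ℝ) (a b c d : ℕ → ℂ) : quartic s a b d c = quartic s a b c d := by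
  unfold quartic
  rw [← (Equiv.prodCongr (Equiv.refl (ℕ × ℕ)) (Equiv.prodComm ℕ ℕ)).tsum_eq]
  refine tsum_congr fun q => ?_
  simp only [quarticTerm, Equiv.prodCongr_apply, Prod.map, Equiv.prodComm_apply, Prod.swap,
    Equiv.refl_apply]
  rw [kernel_swap_right]
  ring

lemma conj_quartic (s : ℝ) (a b c d : ℕ → ℂ) :
    (starRingEnd ℂ) (quartic s a b c d) = quartic s c d a b := by
  unfold quartic
  rw [Complex.conj_tsum, ← (Equiv.prodComm (ℕ × ℕ) (ℕ × ℕ)).tsum_eq]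
  refine tsum_congr fun q => ?_
  simp only [quarticTerm, Equiv.prodComm_apply, Prod.swap, map_mul, Complex.conj_ofReal,
    Complex.conj_conj]
  rw [kernel_swap]
  ring

lemma tsum_quarticTerm_right (s : ℝ) (a c : ℕ → ℂ) (p : ℕ × ℕ) :
    ∑' q : ℕ × ℕ, quarticTerm s a c c c (p, q)
      = (starRingEnd ℂ) (a p.1) * interaction s c p.1 p.2 := by
  rw [tsum_eq_sum (s := Finset.HasAntidiagonal.antidiagonal (p.1 + p.2)) (fun q hq => by
    have : p.1 + p.2 ≠ q.1 + q.2 := fun h => hq (by simp [h])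
    simp [quarticTerm, kernel, this]), interaction, Finset.mul_sum]
  refine Finset.sum_congr rfl fun q hq => ?_
  have h : p.1 + p.2 = q.1 + q.2 := (Finset.HasAntidiagonal.mem_antidiagonal.mp hq).symm
  simp only [quarticTerm, kernel, if_pos h]
  ring

section
variable {s : ℝ} (hs : 1 < s) {a b c d : ℕ → ℂ}
include hs

lemma norm_quarticTerm_le (q : (ℕ × ℕ) × (ℕ × ℕ)) : ‖quarticTerm s a b c d q‖
    ≤ 2 * s ^ 2 / (s - 1) * ((‖a q.1.1‖ * ‖b q.1.2‖) *
      ((((q.2.1 : ℝ) + 1) * ‖c q.2.1‖) * (((q.2.2 : ℝ) + 1) * ‖d q.2.2‖))) := by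
  have h := mul_le_mul_of_nonneg_right (kernel_le hs q)
    (show 0 ≤ (‖a q.1.1‖ * ‖b q.1.2‖) * (‖c q.2.1‖ * ‖d q.2.2‖) by positivity)
  simp only [quarticTerm, norm_mul, Complex.norm_real, RCLike.norm_conj,
    Real.norm_of_nonneg (kernel_nonneg hs q)]
  linarith

lemma summable_quarticTerm (ha : IsWeighted a) (hb : IsWeighted b) (hc : IsWeighted c)
    (hd : IsWeighted d) : Summable (quarticTerm s a b c d) := by
  have h1 := ha.summable_norm.mul_of_nonneg hb.summable_norm (fun _ => norm_nonneg _)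
    fun _ => norm_nonneg _
  have h2 := Summable.mul_of_nonneg hc hd (fun _ => by positivity) fun _ => by positivity
  have h3 := h1.mul_of_nonneg h2 (fun _ => by positivity) fun _ => by positivity
  exact Summable.of_norm_bounded (h3.mul_left (2 * s ^ 2 / (s - 1))) (norm_quarticTerm_le hs)

/-- Two factors of the quartic form are controlled in `ℓ²`. -/
lemma norm_quartic_le (ha : IsWeighted a) (hc : IsWeighted c) (hd : IsWeighted d) :
    ‖quartic s a a c d‖ ≤
      2 * s ^ 2 / (s - 1) * (weightedNorm c * weightedNorm d) * ∑' n, ‖a n‖ ^ 2 := by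
  have hs1 : 0 < s - 1 := by linarith
  have hsum := (summable_quarticTerm hs ha ha hc hd).norm
  refine (norm_tsum_le_tsum_norm hsum).trans ?_
  rw [← (Equiv.prodComm (ℕ × ℕ) (ℕ × ℕ)).tsum_eq]
  have hsum' := (Equiv.prodComm (ℕ × ℕ) (ℕ × ℕ)).summable_iff.2 hsum
  have h2 := Summable.mul_of_nonneg hc hd (fun _ => by positivity) fun _ => by positivity
  rw [Summable.tsum_prod (f := fun q => ‖quarticTerm s a a c d ((Equiv.prodComm _ _) q)‖) hsum']
  set A := ∑' n, ‖a n‖ ^ 2 with hA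
  have hA0 : 0 ≤ A := tsum_nonneg fun n => sq_nonneg _
  have inner : ∀ p : ℕ × ℕ, ∑' q : ℕ × ℕ, ‖quarticTerm s a a c d ((Equiv.prodComm _ _) (p, q))‖
      ≤ 2 * s ^ 2 / (s - 1) * A * ((((p.1 : ℝ) + 1) * ‖c p.1‖) * (((p.2 : ℝ) + 1) * ‖d p.2‖)) := by
    intro p
    rw [tsum_eq_sum (s := Finset.HasAntidiagonal.antidiagonal (p.1 + p.2)) (fun q hq => by
      have : q.1 + q.2 ≠ p.1 + p.2 := by simpa using hq
      simp [quarticTerm, kernel, this])]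
    have hanti : ∑ q ∈ Finset.HasAntidiagonal.antidiagonal (p.1 + p.2), ‖a q.1‖ * ‖a q.2‖ ≤ A := by
      have e1 : ∑ q ∈ Finset.HasAntidiagonal.antidiagonal (p.1 + p.2), ‖a q.1‖ ^ 2 ≤ A := by
        rw [Finset.Nat.sum_antidiagonal_eq_sum_range_succ_mk]
        exact ha.summable_sq.sum_le_tsum _ fun n _ => sq_nonneg _
      have e2 : ∑ q ∈ Finset.HasAntidiagonal.antidiagonal (p.1 + p.2), ‖a q.2‖ ^ 2 ≤ A := by
        rw [← Finset.Nat.sum_antidiagonal_swap]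
        exact e1
      have e3 : ∑ q ∈ Finset.HasAntidiagonal.antidiagonal (p.1 + p.2), ‖a q.1‖ * ‖a q.2‖
          ≤ ∑ q ∈ Finset.HasAntidiagonal.antidiagonal (p.1 + p.2),
            (‖a q.1‖ ^ 2 / 2 + ‖a q.2‖ ^ 2 / 2) :=
        Finset.sum_le_sum fun q _ => by nlinarith [sq_nonneg (‖a q.1‖ - ‖a q.2‖)]
      rw [Finset.sum_add_distrib, ← Finset.sum_div, ← Finset.sum_div] at e3
      linarith
    calc ∑ q ∈ Finset.HasAntidiagonal.antidiagonal (p.1 + p.2),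
          ‖quarticTerm s a a c d ((Equiv.prodComm _ _) (p, q))‖
        ≤ ∑ q ∈ Finset.HasAntidiagonal.antidiagonal (p.1 + p.2), (2 * s ^ 2 / (s - 1) *
          ((((p.1 : ℝ) + 1) * ‖c p.1‖) * (((p.2 : ℝ) + 1) * ‖d p.2‖))) * (‖a q.1‖ * ‖a q.2‖) :=
        Finset.sum_le_sum fun q _ => (norm_quarticTerm_le hs _).trans_eq (by
          simp only [Equiv.prodComm_apply, Prod.swap]; ring)
      _ ≤ (2 * s ^ 2 / (s - 1) *
          ((((p.1 : ℝ) + 1) * ‖c p.1‖) * (((p.2 : ℝ) + 1) * ‖d p.2‖))) * A := by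
        rw [← Finset.mul_sum]; gcongr
      _ = _ := by ring
  refine (hsum'.prod.tsum_le_tsum inner (h2.mul_left _)).trans_eq ?_
  rw [tsum_mul_left, ← Summable.tsum_mul_tsum hc hd h2]
  unfold weightedNorm
  ring

lemma hasSum_conj_mul_interaction (ha : IsWeighted a) (hc : IsWeighted c) :
    HasSum (fun n => (starRingEnd ℂ) (a n) * ∑' m, interaction s c n m) (quartic s a c c c) := by
  have h := summable_quarticTerm hs ha hc hc hc
  have h1 := h.prod
  simp only [tsum_quarticTerm_right] at h1
  have e : quartic s a c c c = ∑' n, (starRingEnd ℂ) (a n) * ∑' m, interaction s c n m := by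
    rw [quartic, h.tsum_prod]
    simp only [tsum_quarticTerm_right]
    rw [h1.tsum_prod]
    simp only [tsum_mul_left]
  rw [e]
  refine Summable.hasSum ?_
  simpa only [tsum_mul_left] using h1.prod

lemma norm_tsum_interaction_le (hc : IsWeighted c) (n : ℕ) :
    ‖∑' m, interaction s c n m‖ ≤ 2 * s ^ 2 / (s - 1) * weightedNorm c ^ 3 := by
  have hs1 : 0 < s - 1 := by linarith
  have hw := weightedNorm_nonneg c
  have h2 := Summable.mul_of_nonneg hc hc (fun _ => by positivity) fun _ => by positivity
  have hb : ∀ m, ‖interaction s c n m‖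
      ≤ (2 * s ^ 2 / (s - 1) * weightedNorm c ^ 2) * ‖c m‖ := by
    intro m
    have e : ∑ q ∈ Finset.HasAntidiagonal.antidiagonal (n + m),
        (((q.1 : ℝ) + 1) * ‖c q.1‖) * (((q.2 : ℝ) + 1) * ‖c q.2‖) ≤ weightedNorm c ^ 2 := by
      refine (h2.sum_le_tsum _ fun q _ => by positivity).trans_eq ?_
      rw [← Summable.tsum_mul_tsum hc hc h2, pow_two]
      rfl
    unfold interaction
    refine (norm_sum_le _ _).trans ?_
    calc ∑ q ∈ Finset.HasAntidiagonal.antidiagonal (n + m),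
          ‖(coupling s n m q.1 q.2 : ℂ) * (starRingEnd ℂ) (c m) * c q.1 * c q.2‖
        ≤ ∑ q ∈ Finset.HasAntidiagonal.antidiagonal (n + m), (2 * s ^ 2 / (s - 1) * ‖c m‖) *
          ((((q.1 : ℝ) + 1) * ‖c q.1‖) * (((q.2 : ℝ) + 1) * ‖c q.2‖)) := by
          refine Finset.sum_le_sum fun q hq => ?_
          have h : n + m = q.1 + q.2 := (Finset.HasAntidiagonal.mem_antidiagonal.mp hq).symm
          have := mul_le_mul_of_nonneg_right (coupling_le hs h)
            (show 0 ≤ ‖c m‖ * ‖c q.1‖ * ‖c q.2‖ by positivity)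
          simp only [norm_mul, Complex.norm_real, RCLike.norm_conj,
            Real.norm_of_nonneg (coupling_nonneg hs n m q.1 q.2)]
          linarith
      _ ≤ (2 * s ^ 2 / (s - 1) * ‖c m‖) * weightedNorm c ^ 2 := by
          rw [← Finset.mul_sum]; gcongr
      _ = _ := by ring
  have hsum := hc.summable_norm.mul_left (2 * s ^ 2 / (s - 1) * weightedNorm c ^ 2)
  refine (tsum_of_norm_bounded hsum.hasSum hb).trans ?_
  rw [tsum_mul_left]
  have := mul_le_mul_of_nonneg_left hc.tsum_norm_le
    (show 0 ≤ 2 * s ^ 2 / (s - 1) * weightedNorm c ^ 2 by positivity)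
  linarith

lemma quartic_add_two {b' : ℕ → ℂ} (ha : IsWeighted a) (hb : IsWeighted b) (hb' : IsWeighted b')
    (hc : IsWeighted c) (hd : IsWeighted d) :
    quartic s a (b + b') c d = quartic s a b c d + quartic s a b' c d := by
  rw [quartic, quartic, quartic, ← (summable_quarticTerm hs ha hb hc hd).tsum_add
    (summable_quarticTerm hs ha hb' hc hd)]
  refine tsum_congr fun q => ?_
  simp only [quarticTerm, Pi.add_apply, map_add]
  ring

lemma quartic_add_three {c' : ℕ → ℂ} (ha : IsWeighted a) (hb : IsWeighted b) (hc : IsWeighted c)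
    (hc' : IsWeighted c') (hd : IsWeighted d) :
    quartic s a b (c + c') d = quartic s a b c d + quartic s a b c' d := by
  rw [quartic, quartic, quartic, ← (summable_quarticTerm hs ha hb hc hd).tsum_add
    (summable_quarticTerm hs ha hb hc' hd)]
  refine tsum_congr fun q => ?_
  simp only [quarticTerm, Pi.add_apply]
  ring

lemma quartic_add_four {d' : ℕ → ℂ} (ha : IsWeighted a) (hb : IsWeighted b) (hc : IsWeighted c)
    (hd : IsWeighted d) (hd' : IsWeighted d') :
    quartic s a b c (d + d') = quartic s a b c d + quartic s a b c d' := by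
  rw [← quartic_swap_right s a b c (d + d'), quartic_add_three hs ha hb hd hd' hc,
    quartic_swap_right s a b c d, quartic_swap_right s a b c d']

/-- The only terms of the difference equation that lose a derivative are Hermitian, and therefore
do not contribute to the growth of the `ℓ²` norm of the difference `d`. -/
lemma abs_im_quartic_sub_le (ha : IsWeighted a) (hd : IsWeighted d) :
    |(quartic s d (a + d) (a + d) (a + d) - quartic s d a a a).im| ≤
      2 * s ^ 2 / (s - 1) * (weightedNorm (a + d) * weightedNorm (a + d)
        + weightedNorm d * weightedNorm a) * ∑' n, ‖d n‖ ^ 2 := by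
  have hb := ha.add hd
  have e1 := quartic_add_two hs hd ha hd hb hb
  have e2 := quartic_add_three hs hd ha ha hd hb
  have e3 := quartic_add_four hs hd ha ha ha hd
  have e4 := quartic_add_four hs hd ha hd ha hd
  have e5 : quartic s d a d a = quartic s d a a d := quartic_swap_right s d a a d
  have real : (quartic s d a a d).im = 0 := by
    rw [← Complex.conj_eq_iff_im, conj_quartic, ← quartic_swap_left, quartic_swap_right]
  have e6 : (quartic s d a d d).im = -(quartic s d d d a).im := by
    rw [← conj_quartic s d a d d, Complex.conj_im, neg_neg]
  have b1 := (Complex.abs_im_le_norm _).trans (norm_quartic_le hs hd hb hb)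
  have b2 := (Complex.abs_im_le_norm _).trans (norm_quartic_le hs hd hd ha)
  have tot : (quartic s d (a + d) (a + d) (a + d) - quartic s d a a a).im
      = (quartic s d d (a + d) (a + d)).im - (quartic s d d d a).im := by
    rw [e1, e2, e3, e4, e5]
    simp only [Complex.sub_im, Complex.add_im, real, e6]
    ring
  rw [tot]
  refine (abs_sub _ _).trans ?_
  linarith

end

/-! ### Uniqueness of solutions -/

/-- For `ξ > 3 / 2` the norm `H ^ ξ` controls the weighted `ℓ¹` norm, because
`∑ (n + 1) ^ (2 - 2 ξ)` converges. -/
lemma isWeighted_of_sobolev {ξ : ℝ} (hξ : 3 / 2 < ξ) : ∃ Z : ℝ, 0 ≤ Z ∧ ∀ (a : ℕ → ℂ) (M : ℝ),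
    Summable (sobolevTerm ξ a) → ∑' n, sobolevTerm ξ a n ≤ M →
      IsWeighted a ∧ weightedNorm a ≤ M + Z := by
  have hz : Summable fun n : ℕ => ((n : ℝ) + 1) ^ (2 - 2 * ξ) := by
    have := (summable_nat_add_iff 1).2 (Real.summable_nat_rpow.2 (show 2 - 2 * ξ < -1 by linarith))
    simpa using this
  have hz0 : 0 ≤ ∑' n : ℕ, ((n : ℝ) + 1) ^ (2 - 2 * ξ) := tsum_nonneg fun n => by positivity
  refine ⟨∑' n : ℕ, ((n : ℝ) + 1) ^ (2 - 2 * ξ), hz0, fun a M hs hM => ?_⟩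
  have hle : ∀ n : ℕ, ((n : ℝ) + 1) * ‖a n‖ ≤ sobolevTerm ξ a n + ((n : ℝ) + 1) ^ (2 - 2 * ξ) := by
    intro n
    have hn : (0 : ℝ) < (n : ℝ) + 1 := by positivity
    have e1 : ((n : ℝ) + 1) ^ (2 * ξ) = (((n : ℝ) + 1) ^ ξ) ^ 2 := by
      rw [mul_comm, Real.rpow_mul hn.le, Real.rpow_two]
    have e2 : ((n : ℝ) + 1) ^ (2 - 2 * ξ) = (((n : ℝ) + 1) ^ (1 - ξ)) ^ 2 := by
      rw [show 2 - 2 * ξ = (1 - ξ) * 2 by ring, Real.rpow_mul hn.le, Real.rpow_two]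
    have e3 : (n : ℝ) + 1 = ((n : ℝ) + 1) ^ ξ * ((n : ℝ) + 1) ^ (1 - ξ) := by
      rw [← Real.rpow_add hn]; simp
    have p : 0 ≤ ((n : ℝ) + 1) ^ ξ * ‖a n‖ := by positivity
    have q : 0 ≤ ((n : ℝ) + 1) ^ (1 - ξ) := by positivity
    have : ((n : ℝ) + 1) * ‖a n‖ = (((n : ℝ) + 1) ^ ξ * ‖a n‖) * ((n : ℝ) + 1) ^ (1 - ξ) := by
      nth_rewrite 1 [e3]; ring
    rw [sobolevTerm, e1, e2, this, ← mul_pow]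
    nlinarith [sq_nonneg (((n : ℝ) + 1) ^ ξ * ‖a n‖ - ((n : ℝ) + 1) ^ (1 - ξ))]
  have hsum : IsWeighted a := (hs.add hz).of_nonneg_of_le (fun n => by positivity) hle
  refine ⟨hsum, ?_⟩
  have := Summable.tsum_le_tsum hle hsum (hs.add hz)
  rw [hs.tsum_add hz] at this
  exact this.trans (by linarith)

lemma IsWeighted.tsum_tail_le {a : ℕ → ℂ} (ha : IsWeighted a) (L : ℕ) :
    ∑' n, ‖a (n + L)‖ ≤ weightedNorm a / (L + 1) := by
  have hL : (0 : ℝ) < (L : ℝ) + 1 := by positivity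
  rw [le_div_iff₀ hL, mul_comm, ← tsum_mul_left]
  have h1 := (summable_nat_add_iff L).2 ha
  have h2 := (summable_nat_add_iff L).2 ha.summable_norm
  have h3 : ∑' n : ℕ, (((n + L : ℕ) : ℝ) + 1) * ‖a (n + L)‖ ≤ weightedNorm a := by
    have := Summable.sum_add_tsum_nat_add L ha
    have h0 : 0 ≤ ∑ n ∈ Finset.range L, ((n : ℝ) + 1) * ‖a n‖ :=
      Finset.sum_nonneg fun n _ => by positivity
    rw [weightedNorm]
    linarith
  refine le_trans (Summable.tsum_le_tsum (fun n => ?_) (h2.mul_left _) h1) h3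
  push_cast
  have : (0 : ℝ) ≤ n := Nat.cast_nonneg n
  gcongr
  linarith

/-- A Grönwall inequality on an interval of either orientation. -/
lemma abs_le_gronwallBound_uIcc {g g' : ℝ → ℝ} {t₀ t₁ K ε : ℝ}
    (hg : ∀ t ∈ Set.uIcc t₀ t₁, HasDerivWithinAt g (g' t) (Set.uIcc t₀ t₁) t) (h0 : g t₀ = 0)
    (hb : ∀ t ∈ Set.uIcc t₀ t₁, |g' t| ≤ K * |g t| + ε) :
    |g t₁| ≤ gronwallBound 0 K ε |t₁ - t₀| := by
  have forward : ∀ {g g' : ℝ → ℝ} {t₀ t₁ : ℝ}, t₀ ≤ t₁ →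
      (∀ t ∈ Set.Icc t₀ t₁, HasDerivWithinAt g (g' t) (Set.Icc t₀ t₁) t) → g t₀ = 0 →
      (∀ t ∈ Set.Icc t₀ t₁, |g' t| ≤ K * |g t| + ε) → |g t₁| ≤ gronwallBound 0 K ε (t₁ - t₀) := by
    intro g g' t₀ t₁ hle hg h0 hb
    refine norm_le_gronwallBound_of_norm_deriv_right_le (f' := g')
      (fun t ht => (hg t ht).continuousWithinAt) (fun t ht => ?_) (by simp [h0])
      (fun t ht => hb t (Set.Ico_subset_Icc_self ht)) t₁ ⟨hle, le_rfl⟩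
    exact (hg t (Set.Ico_subset_Icc_self ht)).mono_of_mem_nhdsWithin
      (mem_of_superset (Icc_mem_nhdsGE ht.2) (Set.Icc_subset_Icc_left ht.1))
  rcases le_total t₀ t₁ with h | h
  · rw [Set.uIcc_of_le h] at hg hb
    rw [abs_of_nonneg (sub_nonneg.2 h)]
    exact forward h hg h0 hb
  · rw [Set.uIcc_of_ge h] at hg hb
    rw [abs_of_nonpos (sub_nonpos.2 h), show -(t₁ - t₀) = -t₁ - -t₀ by ring]
    have := forward (g := fun τ => g (-τ)) (g' := fun τ => -g' (-τ)) (neg_le_neg h) (fun τ hτ => ?_)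
      (by simpa using h0) (fun τ hτ => ?_)
    · simpa using this
    · have hm : -τ ∈ Set.Icc t₁ t₀ := ⟨by linarith [hτ.2], by linarith [hτ.1]⟩
      have := (hg (-τ) hm).comp τ (hasDerivWithinAt_neg τ (Set.Icc (-t₀) (-t₁)))
        (fun x hx => ⟨by linarith [hx.2], by linarith [hx.1]⟩)
      refine this.congr_deriv ?_
      ring
    · have hm : -τ ∈ Set.Icc t₁ t₀ := ⟨by linarith [hτ.2], by linarith [hτ.1]⟩
      simpa using hb (-τ) hm

/-- The growth of the truncated `ℓ²` distance of two solutions. A finite sum of modes is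
differentiable without further estimates; the error of the truncation vanishes as `L → ∞`, uniformly
in time, by the weighted `ℓ¹` bound. -/
lemma abs_im_sum_le {s : ℝ} (hs : 1 < s) {a d : ℕ → ℂ} {M : ℝ} (ha : IsWeighted a)
    (hd : IsWeighted d) (hM : 1 ≤ M) (haM : weightedNorm a ≤ M) (hbM : weightedNorm (a + d) ≤ M)
    (hdM : weightedNorm d ≤ 2 * M) (L : ℕ) :
    |(∑ n ∈ Finset.range L, (starRingEnd ℂ) (d n) *
        (∑' m, interaction s (a + d) n m - ∑' m, interaction s a n m)).im|
      ≤ 2 * s ^ 2 / (s - 1) * (3 * M ^ 2) * (∑ n ∈ Finset.range L, ‖d n‖ ^ 2)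
        + 16 * (2 * s ^ 2 / (s - 1)) * M ^ 4 / (L + 1) := by
  have hs1 : 0 < s - 1 := by linarith
  set κ := 2 * s ^ 2 / (s - 1) with hκ
  have hκ0 : 0 < κ := by positivity
  have hb := ha.add hd
  have hM0 : 0 ≤ M := by linarith
  have w1 := weightedNorm_nonneg a
  have w2 := weightedNorm_nonneg d
  have w3 := weightedNorm_nonneg (a + d)
  set X : ℕ → ℂ := fun n => ∑' m, interaction s (a + d) n m - ∑' m, interaction s a n m with hX
  have hXb : ∀ n, ‖X n‖ ≤ 2 * κ * M ^ 3 := by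
    intro n
    have h1 := norm_tsum_interaction_le hs hb n
    have h2 := norm_tsum_interaction_le hs ha n
    have h3 : weightedNorm (a + d) ^ 3 ≤ M ^ 3 := by gcongr
    have h4 : weightedNorm a ^ 3 ≤ M ^ 3 := by gcongr
    refine (norm_sub_le _ _).trans ?_
    have h5 := mul_le_mul_of_nonneg_left h3 hκ0.le
    have h6 := mul_le_mul_of_nonneg_left h4 hκ0.le
    linarith
  have hsum : HasSum (fun n => (starRingEnd ℂ) (d n) * X n)
      (quartic s d (a + d) (a + d) (a + d) - quartic s d a a a) := by
    have := (hasSum_conj_mul_interaction hs hd hb).sub (hasSum_conj_mul_interaction hs hd ha)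
    simpa only [hX, mul_sub] using this
  have htail := hd.tsum_tail_le L
  have hL : (0 : ℝ) < (L : ℝ) + 1 := by positivity
  have htail' : ∑' n, ‖d (n + L)‖ ≤ 2 * M / (L + 1) := htail.trans (by gcongr)
  have hds := (summable_nat_add_iff L).2 hd.summable_norm
  -- the full sum and the tails
  have split := hsum.summable.sum_add_tsum_nat_add L
  rw [hsum.tsum_eq] at split
  have tailbound : ‖∑' n, (starRingEnd ℂ) (d (n + L)) * X (n + L)‖
      ≤ 2 * κ * M ^ 3 * (2 * M / (L + 1)) := by
    refine (tsum_of_norm_bounded (hds.mul_left (2 * κ * M ^ 3)).hasSum fun n => ?_).trans ?_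
    · rw [norm_mul, RCLike.norm_conj, mul_comm]
      gcongr
      exact hXb _
    · rw [tsum_mul_left]; gcongr
  have full := abs_im_quartic_sub_le hs ha hd
  have hsq : ∑' n, ‖d n‖ ^ 2 ≤ (∑ n ∈ Finset.range L, ‖d n‖ ^ 2) + 2 * M * (2 * M / (L + 1)) := by
    rw [← hd.summable_sq.sum_add_tsum_nat_add L]
    gcongr
    refine (Summable.tsum_le_tsum (fun n => ?_) ((summable_nat_add_iff L).2 hd.summable_sq)
      (hds.mul_left (2 * M))).trans ?_
    · rw [pow_two]
      gcongr
      exact (hd.norm_le _).trans hdM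
    · rw [tsum_mul_left]; gcongr
  have hw : weightedNorm (a + d) * weightedNorm (a + d) + weightedNorm d * weightedNorm a
      ≤ 3 * M ^ 2 := by
    have h1 : weightedNorm (a + d) * weightedNorm (a + d) ≤ M * M := by gcongr
    have h2 : weightedNorm d * weightedNorm a ≤ 2 * M * M := by gcongr
    nlinarith
  have hy0 : 0 ≤ ∑' n, ‖d n‖ ^ 2 := tsum_nonneg fun n => sq_nonneg _
  have full' : |(quartic s d (a + d) (a + d) (a + d) - quartic s d a a a).im| ≤
      κ * (3 * M ^ 2) * ((∑ n ∈ Finset.range L, ‖d n‖ ^ 2) + 2 * M * (2 * M / (L + 1))) := by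
    refine full.trans ?_
    gcongr
  have e : (∑ n ∈ Finset.range L, (starRingEnd ℂ) (d n) * X n).im
      = (quartic s d (a + d) (a + d) (a + d) - quartic s d a a a).im
        - (∑' n, (starRingEnd ℂ) (d (n + L)) * X (n + L)).im := by
    rw [← split, Complex.add_im]; ring
  rw [e]
  refine (abs_sub _ _).trans
    ((add_le_add full' ((Complex.abs_im_le_norm _).trans tailbound)).trans ?_)
  have : κ * (3 * M ^ 2) * (2 * M * (2 * M / (L + 1))) + 2 * κ * M ^ 3 * (2 * M / (L + 1))
      = 16 * κ * M ^ 4 / (L + 1) := by ring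
  linarith

/-- Solutions in the class `H ^ ξ`, `ξ > 3 / 2`, are determined by their value at one time. -/
theorem isSolutionOn_unique {s : ℝ} (hs : 1 < s) {J : Set ℝ} (hJ : J.OrdConnected) {t₀ : ℝ}
    (ht₀ : t₀ ∈ J) {α β : ℝ → ℕ → ℂ} (hα : IsSolutionOn s α J) (hβ : IsSolutionOn s β J)
    (h0 : α t₀ = β t₀) {t₁ : ℝ} (ht₁ : t₁ ∈ J) : α t₁ = β t₁ := by
  have hs1 : 0 < s - 1 := by linarith
  have hsub : Set.uIcc t₀ t₁ ⊆ J := hJ.uIcc_subset ht₀ ht₁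
  obtain ⟨⟨ξ, hξ, hαK⟩, hαd⟩ := hα
  obtain ⟨⟨η, hη, hβK⟩, hβd⟩ := hβ
  obtain ⟨M₁, hM₁⟩ := hαK _ hsub isCompact_uIcc
  obtain ⟨M₂, hM₂⟩ := hβK _ hsub isCompact_uIcc
  obtain ⟨Z₁, hZ₁, hw₁⟩ := isWeighted_of_sobolev hξ
  obtain ⟨Z₂, hZ₂, hw₂⟩ := isWeighted_of_sobolev hη
  set M := max 1 (max (M₁ + Z₁) (M₂ + Z₂)) with hM
  have hM1 : 1 ≤ M := le_max_left _ _
  have hαw : ∀ t ∈ Set.uIcc t₀ t₁, IsWeighted (α t) ∧ weightedNorm (α t) ≤ M := fun t ht => by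
    have := hw₁ _ _ (hM₁ t ht).1 (hM₁ t ht).2
    exact ⟨this.1, this.2.trans ((le_max_left _ _).trans (le_max_right _ _))⟩
  have hβw : ∀ t ∈ Set.uIcc t₀ t₁, IsWeighted (β t) ∧ weightedNorm (β t) ≤ M := fun t ht => by
    have := hw₂ _ _ (hM₂ t ht).1 (hM₂ t ht).2
    exact ⟨this.1, this.2.trans ((le_max_right _ _).trans (le_max_right _ _))⟩
  set κ := 2 * s ^ 2 / (s - 1) with hκ
  have hκ0 : 0 < κ := by positivity
  set K := 2 * (κ * (3 * M ^ 2)) with hK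
  set c := 2 * (16 * κ * M ^ 4) with hc
  have main : ∀ L : ℕ, ∑ n ∈ Finset.range L, ‖β t₁ n - α t₁ n‖ ^ 2
      ≤ gronwallBound 0 K (c * (1 / ((L : ℝ) + 1))) |t₁ - t₀| := by
    intro L
    set g : ℝ → ℝ := fun t => ∑ n ∈ Finset.range L, ‖β t n - α t n‖ ^ 2 with hg
    set g' : ℝ → ℝ := fun t => 2 * (∑ n ∈ Finset.range L, (starRingEnd ℂ) ((β t - α t) n) *
      (∑' m, interaction s (α t + (β t - α t)) n m - ∑' m, interaction s (α t) n m)).im with hg'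
    have hg0 : ∀ t, 0 ≤ g t := fun t => Finset.sum_nonneg fun n _ => sq_nonneg _
    have hderiv : ∀ t ∈ Set.uIcc t₀ t₁, HasDerivWithinAt g (g' t) (Set.uIcc t₀ t₁) t := by
      intro t ht
      have hd : ∀ n ∈ Finset.range L, HasDerivWithinAt (fun t => ‖β t n - α t n‖ ^ 2)
          (2 * ((starRingEnd ℂ) ((β t - α t) n) * (∑' m, interaction s (α t + (β t - α t)) n m
            - ∑' m, interaction s (α t) n m)).im) (Set.uIcc t₀ t₁) t := by
        intro n _
        have h1 := ((hβd t (hsub ht) n).2.sub (hαd t (hsub ht) n).2).mono hsub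
        refine h1.norm_sq.congr_deriv ?_
        rw [add_sub_cancel]
        simp only [Complex.inner, Pi.sub_apply, ← mul_sub, Complex.mul_re, Complex.mul_im,
          Complex.conj_re, Complex.conj_im, Complex.neg_re, Complex.neg_im, Complex.I_re,
          Complex.I_im]
        ring
      refine (HasDerivWithinAt.fun_sum hd).congr_deriv ?_
      simp only [hg']
      rw [Complex.im_sum, Finset.mul_sum]
    have hbound : ∀ t ∈ Set.uIcc t₀ t₁, |g' t| ≤ K * |g t| + c * (1 / ((L : ℝ) + 1)) := by
      intro t ht
      have ha := hαw t ht
      have hb := hβw t ht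
      have hd : IsWeighted (β t - α t) := hb.1.sub ha.1
      have hdM : weightedNorm (β t - α t) ≤ 2 * M :=
        (weightedNorm_sub_le hb.1 ha.1).trans (by linarith [ha.2, hb.2])
      have key := abs_im_sum_le hs ha.1 hd hM1 ha.2 (by rw [add_sub_cancel]; exact hb.2) hdM L
      rw [abs_of_nonneg (hg0 t)]
      simp only [hg']
      rw [abs_mul, abs_two]
      calc 2 * |_| ≤ 2 * (κ * (3 * M ^ 2) * (∑ n ∈ Finset.range L, ‖(β t - α t) n‖ ^ 2)
            + 16 * κ * M ^ 4 / (L + 1)) := by gcongr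
        _ = K * g t + c * (1 / ((L : ℝ) + 1)) := by
          simp only [hg, hK, hc, Pi.sub_apply]
          ring
    have := abs_le_gronwallBound_uIcc hderiv (by simp [hg, h0]) hbound
    rwa [abs_of_nonneg (hg0 t₁)] at this
  have hlim : Tendsto (fun L : ℕ => gronwallBound 0 K (c * (1 / ((L : ℝ) + 1))) |t₁ - t₀|) atTop
      (𝓝 0) := by
    have h1 : Tendsto (fun L : ℕ => c * (1 / ((L : ℝ) + 1))) atTop (𝓝 (c * 0)) :=
      tendsto_one_div_add_atTop_nhds_zero_nat.const_mul c
    have h2 := ((gronwallBound_continuous_ε 0 K |t₁ - t₀|).tendsto (c * 0)).comp h1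
    rw [mul_zero, gronwallBound_ε0_δ0] at h2
    exact h2
  funext n
  have hn : ‖β t₁ n - α t₁ n‖ ^ 2 ≤ 0 := by
    refine ge_of_tendsto hlim ?_
    filter_upwards [eventually_gt_atTop n] with L hL
    exact (Finset.single_le_sum (f := fun n => ‖β t₁ n - α t₁ n‖ ^ 2) (fun k _ => sq_nonneg _)
      (Finset.mem_range.2 hL)).trans (main L)
  have : ‖β t₁ n - α t₁ n‖ = 0 := by
    have := le_antisymm hn (sq_nonneg _)
    exact pow_eq_zero_iff two_ne_zero |>.1 this
  exact (sub_eq_zero.1 (norm_eq_zero.1 this)).symm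

/-! ### An Abelian theorem for power series -/

/-- The coefficients `a (a + 1) ⋯ (a + n - 1) / n!` of the binomial series of `(1 - q) ^ (-a)`. -/
def binomCoeff (a : ℝ) (n : ℕ) : ℝ := (∏ j ∈ Finset.range n, (a + j)) / n.factorial

lemma binomCoeff_pos {a : ℝ} (ha : 0 < a) (n : ℕ) : 0 < binomCoeff a n :=
  div_pos (Finset.prod_pos fun j _ => by positivity) (by exact_mod_cast n.factorial_pos)

lemma binomCoeff_eq_choose (a : ℝ) (n : ℕ) : binomCoeff a n = Ring.choose (a + n - 1) n := by
  have h := Ring.factorial_nsmul_multichoose_eq_ascPochhammer a n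
  have hf : (n.factorial : ℝ) ≠ 0 := by exact_mod_cast n.factorial_ne_zero
  rw [← Ring.multichoose_eq, binomCoeff, div_eq_iff hf, mul_comm, ← nsmul_eq_mul, h,
    Polynomial.ascPochhammer_smeval_eq_eval]
  clear h hf
  induction n with
  | zero => simp
  | succ n ih => rw [Finset.prod_range_succ, ih, ascPochhammer_succ_eval]

lemma hasSum_binomCoeff (a : ℝ) {q : ℝ} (h0 : 0 ≤ q) (h1 : q < 1) :
    HasSum (fun n => binomCoeff a n * q ^ n) ((1 - q) ^ (-a)) := by
  have h := (Real.one_div_one_sub_rpow_hasFPowerSeriesOnBall_zero a).hasSum (y := q)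
    (by simp [enorm_eq_nnnorm, abs_of_nonneg h0, ← NNReal.coe_lt_coe, h1])
  simpa [FormalMultilinearSeries.ofScalars_apply_eq, binomCoeff_eq_choose, mul_comm,
    Real.rpow_neg (sub_nonneg.2 h1.le)] using h

lemma tendsto_binomCoeff {a : ℝ} (ha : 0 < a) :
    Tendsto (fun n : ℕ => binomCoeff a n * (n : ℝ) ^ (1 - a)) atTop (𝓝 (Real.Gamma a)⁻¹) := by
  have h1 := (Real.GammaSeq_tendsto_Gamma a).inv₀ (Real.Gamma_pos_of_pos ha).ne'
  have h2 : Tendsto (fun n : ℕ => (n : ℝ) / (n + a)) atTop (𝓝 1) :=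
    tendsto_natCast_div_add_atTop a
  have h3 := h1.mul h2
  rw [mul_one] at h3
  refine h3.congr' ?_
  filter_upwards [eventually_gt_atTop 0] with n hn
  have hn0 : (0 : ℝ) < n := by exact_mod_cast hn
  have hf : (n.factorial : ℝ) ≠ 0 := by exact_mod_cast n.factorial_ne_zero
  have hna : (n : ℝ) + a ≠ 0 := by positivity
  rw [Real.GammaSeq, Finset.prod_range_succ, binomCoeff, Real.rpow_sub hn0, Real.rpow_one,
    add_comm a (n : ℝ)]
  have hp : ∏ j ∈ Finset.range n, (a + j) ≠ 0 :=
    (Finset.prod_pos fun j _ => by positivity).ne'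
  have := (Real.rpow_pos_of_pos hn0 a).ne'
  field_simp

/-- If `c n ~ K n ^ (a - 1)` with `a > 0`, then `∑ c n q ^ n ~ K Γ(a) (1 - q) ^ (-a)` as
`q → 1`. -/
theorem tendsto_one_sub_rpow_mul_tsum {a : ℝ} (ha : 0 < a) {c : ℕ → ℝ} {K : ℝ}
    (hc : Tendsto (fun n : ℕ => c n * (n : ℝ) ^ (1 - a)) atTop (𝓝 K)) :
    Tendsto (fun q : ℝ => (1 - q) ^ a * ∑' n, c n * q ^ n) (𝓝[<] 1)
      (𝓝 (K * Real.Gamma a)) := by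
  have hG := Real.Gamma_pos_of_pos ha
  -- subtract the binomial series with the same leading behaviour
  set L := K * Real.Gamma a with hL
  set d : ℕ → ℝ := fun n => c n - L * binomCoeff a n with hd
  have hd0 : Tendsto (fun n => d n / binomCoeff a n) atTop (𝓝 0) := by
    have h := (hc.div (tendsto_binomCoeff ha) (inv_pos.2 hG).ne').sub_const L
    rw [div_inv_eq_mul, ← hL, sub_self] at h
    refine h.congr' ?_
    filter_upwards [eventually_gt_atTop 0] with n hn
    have hn0 : (0 : ℝ) < n := by exact_mod_cast hn
    have h1 := (Real.rpow_pos_of_pos hn0 (1 - a)).ne'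
    have h2 := (binomCoeff_pos ha n).ne'
    simp only [hd, Pi.div_apply]
    field_simp
  rw [Metric.tendsto_nhds]
  intro ε hε
  obtain ⟨n₀, hn₀⟩ := eventually_atTop.1 (hd0.abs.eventually
    (ge_mem_nhds (show |(0 : ℝ)| < ε / 2 by simpa using half_pos hε)))
  set g : ℕ → ℝ := fun n => if n ∈ Finset.range n₀ then |d n| else 0 with hg
  have hdg : ∀ n, |d n| ≤ g n + ε / 2 * binomCoeff a n := fun n => by
    have hb := binomCoeff_pos ha n
    by_cases h : n ∈ Finset.range n₀
    · simp only [hg, h, if_true]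
      have : 0 ≤ ε / 2 * binomCoeff a n := by positivity
      linarith
    · simp only [hg, h, if_false, zero_add]
      have h1 : |d n / binomCoeff a n| ≤ ε / 2 := hn₀ n (by simpa using h)
      rwa [abs_div, abs_of_pos hb, div_le_iff₀ hb] at h1
  set M := ∑ n ∈ Finset.range n₀, |d n| with hM
  have hM0 : 0 ≤ M := Finset.sum_nonneg fun _ _ => abs_nonneg _
  have hlim : Tendsto (fun q : ℝ => (1 - q) ^ a * M) (𝓝[<] 1) (𝓝 0) := by
    have : ContinuousAt (fun q : ℝ => (1 - q) ^ a * M) 1 :=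
      ((continuousAt_const.sub continuousAt_id).rpow_const (Or.inr ha.le)).mul continuousAt_const
    have h := this.tendsto
    simp only [sub_self, Real.zero_rpow ha.ne', zero_mul] at h
    exact h.mono_left nhdsWithin_le_nhds
  filter_upwards [hlim.eventually (gt_mem_nhds (half_pos hε)), self_mem_nhdsWithin,
    Ico_mem_nhdsLT (zero_lt_one' ℝ)] with q hq hq1 hq0
  have hq1 : q < 1 := hq1
  have hq0 : 0 ≤ q := hq0.1
  have hpos : 0 < 1 - q := by linarith
  have hbs := hasSum_binomCoeff a hq0 hq1
  have hgs : HasSum (fun n => g n * q ^ n) (∑ n ∈ Finset.range n₀, |d n| * q ^ n) := by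
    rw [show ∑ n ∈ Finset.range n₀, |d n| * q ^ n = ∑ n ∈ Finset.range n₀, g n * q ^ n from
      Finset.sum_congr rfl fun n hn => by simp only [hg, hn, if_true]]
    exact hasSum_sum_of_ne_finset_zero fun n hn => by simp only [hg, hn, if_false, zero_mul]
  have hgM : ∑ n ∈ Finset.range n₀, |d n| * q ^ n ≤ M :=
    Finset.sum_le_sum fun n _ =>
      mul_le_of_le_one_right (abs_nonneg _) (pow_le_one₀ hq0 hq1.le)
  have hmaj := hgs.add (hbs.mul_left (ε / 2))
  have hle : ∀ n, ‖d n * q ^ n‖ ≤ g n * q ^ n + ε / 2 * (binomCoeff a n * q ^ n) := fun n => by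
    rw [norm_mul, Real.norm_eq_abs, Real.norm_eq_abs, abs_of_nonneg (pow_nonneg hq0 n)]
    calc |d n| * q ^ n ≤ (g n + ε / 2 * binomCoeff a n) * q ^ n := by gcongr; exact hdg n
      _ = _ := by ring
  have hds : Summable fun n => d n * q ^ n := hmaj.summable.of_norm_bounded hle
  have hdn : |∑' n, d n * q ^ n| ≤ M + ε / 2 * (1 - q) ^ (-a) := by
    have := tsum_of_norm_bounded hmaj hle
    rw [Real.norm_eq_abs] at this
    linarith
  have hcs : ∑' n, c n * q ^ n = (∑' n, d n * q ^ n) + L * (1 - q) ^ (-a) := by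
    rw [← (hds.hasSum.add (hbs.mul_left L)).tsum_eq]
    exact tsum_congr fun n => by simp only [hd]; ring
  have hone : (1 - q) ^ a * (1 - q) ^ (-a) = 1 := by
    rw [← Real.rpow_add hpos, add_neg_cancel, Real.rpow_zero]
  have hpa : 0 < (1 - q) ^ a := Real.rpow_pos_of_pos hpos a
  rw [Real.dist_eq, hcs, show (1 - q) ^ a * ((∑' n, d n * q ^ n) + L * (1 - q) ^ (-a)) - L
    = (1 - q) ^ a * ∑' n, d n * q ^ n by linear_combination L * hone, abs_mul, abs_of_pos hpa]
  calc (1 - q) ^ a * |∑' n, d n * q ^ n|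
      ≤ (1 - q) ^ a * (M + ε / 2 * (1 - q) ^ (-a)) := by gcongr
    _ = (1 - q) ^ a * M + ε / 2 := by linear_combination ε / 2 * hone
    _ < ε := by linarith

/-! ### Spectrum and Sobolev norms near the critical point -/

/-- The Sobolev sum of the modes `n ≥ 1` on the manifold, for `|c| = 1` and `|p|² = x`. -/
def sobolevTail (s ξ x : ℝ) : ℝ :=
  ∑' n : ℕ, ((n : ℝ) + 1 + 1) ^ (2 * ξ) * (fussCatalan s (n + 1) * x ^ n)

lemma sobolevNorm_ansatz {s : ℝ} (hs : 1 < s) (ξ : ℝ) (b c : ℂ) {p : ℂ} (hp : ‖p‖ ^ 2 < xc s) :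
    sobolevNorm ξ (ansatz s b c p) = √(‖b‖ ^ 2 + ‖c‖ ^ 2 * sobolevTail s ξ (‖p‖ ^ 2)) := by
  rw [sobolevNorm, (summable_sobolevTerm_ansatz hs ξ b c hp).tsum_eq_zero_add,
    sobolevTerm_ansatz_zero, sobolevTail, ← tsum_mul_left]
  congr 2
  exact tsum_congr fun n => sobolevTerm_ansatz_succ hs ξ b c p n

/-- The constant of the power-law spectrum. -/
def spectrumConst (s : ℝ) : ℝ := fussCatalanConst s / xc s

lemma spectrumConst_pos {s : ℝ} (hs : 1 < s) : 0 < spectrumConst s :=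
  div_pos (fussCatalanConst_pos s) (xc_pos hs)

lemma tendsto_sobolevTail {s : ℝ} (hs : 1 < s) {ξ : ℝ} (hξ : 1 / 2 < ξ) :
    Tendsto (fun x => (1 - x / xc s) ^ (2 * ξ - 1 / 2) * sobolevTail s ξ x) (𝓝[<] (xc s))
      (𝓝 (spectrumConst s * Real.Gamma (2 * ξ - 1 / 2))) := by
  have hx := xc_pos hs
  have hc : Tendsto (fun n : ℕ => ((n : ℝ) + 1 + 1) ^ (2 * ξ) *
      (fussCatalan s (n + 1) * xc s ^ n) * (n : ℝ) ^ (1 - (2 * ξ - 1 / 2))) atTop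
      (𝓝 (spectrumConst s)) := by
    have h1 := (tendsto_fussCatalan hs).comp (tendsto_add_atTop_nat 1)
    have h2 : Tendsto (fun n : ℕ => (n : ℝ) / (n + 1)) atTop (𝓝 1) :=
      tendsto_natCast_div_add_atTop (1 : ℝ)
    have h3 : Tendsto (fun n : ℕ => (n : ℝ) / (n + 2)) atTop (𝓝 1) :=
      tendsto_natCast_div_add_atTop (2 : ℝ)
    have h4 := (h2.rpow_const (p := 3 / 2) (Or.inl one_ne_zero))
    have h5 := (h3.rpow_const (p := -(2 * ξ)) (Or.inl one_ne_zero))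
    have h := ((h1.mul h4).mul h5).div_const (xc s)
    simp only [Real.one_rpow, mul_one] at h
    refine h.congr' ?_
    filter_upwards [eventually_gt_atTop 0] with n hn
    have hn0 : (0 : ℝ) < n := by exact_mod_cast hn
    have e : (n : ℝ) ^ (1 - (2 * ξ - 1 / 2)) = (n : ℝ) ^ (3 / 2 : ℝ) * (n : ℝ) ^ (-(2 * ξ)) := by
      rw [← Real.rpow_add hn0]; congr 1; ring
    have e2 : (n : ℝ) + 1 + 1 = n + 2 := by ring
    simp only [Function.comp]
    rw [Real.div_rpow hn0.le (by positivity), Real.div_rpow hn0.le (by positivity), e, e2,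
      Real.rpow_neg (by positivity : (0 : ℝ) ≤ (n : ℝ) + 2)]
    push_cast
    have p1 : ((n : ℝ) + 1) ^ (3 / 2 : ℝ) ≠ 0 := (Real.rpow_pos_of_pos (by positivity) _).ne'
    have p2 : ((n : ℝ) + 2) ^ (2 * ξ) ≠ 0 := (Real.rpow_pos_of_pos (by positivity) _).ne'
    rw [pow_succ]
    field_simp

  have habel := tendsto_one_sub_rpow_mul_tsum (by linarith) hc
  have hq : Tendsto (fun x => x / xc s) (𝓝[<] (xc s)) (𝓝[<] 1) := by
    refine tendsto_nhdsWithin_iff.2 ⟨?_, ?_⟩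
    · have : Tendsto (fun x => x / xc s) (𝓝 (xc s)) (𝓝 (xc s / xc s)) :=
        (continuous_id.div_const _).tendsto _
      rw [div_self hx.ne'] at this
      exact this.mono_left nhdsWithin_le_nhds
    · filter_upwards [self_mem_nhdsWithin] with x hxx
      exact (div_lt_one hx).2 hxx
  refine (habel.comp hq).congr fun x => ?_
  simp only [Function.comp, sobolevTail]
  congr 1
  refine tsum_congr fun n => ?_
  rw [div_pow]
  have := (pow_pos hx n).ne'
  field_simp

/-- The `-3/2` power law of the spectrum, uniformly over the manifold. -/
lemma exists_spectrum {s : ℝ} (hs : 1 < s) {ε : ℝ} (hε : 0 < ε) :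
    ∃ n₀ : ℕ, 1 ≤ n₀ ∧ ∀ n : ℕ, n₀ ≤ n → ∀ b c p : ℂ,
      |‖ansatz s b c p n‖ ^ 2 - spectrumConst s * (‖c‖ ^ 2 * (n : ℝ) ^ (-(3 / 2) : ℝ)
          * (‖p‖ ^ 2 / xc s) ^ (n - 1))|
        ≤ ε * (‖c‖ ^ 2 * (n : ℝ) ^ (-(3 / 2) : ℝ) * (‖p‖ ^ 2 / xc s) ^ (n - 1)) := by
  have hx := xc_pos hs
  obtain ⟨n₁, h₁⟩ := eventually_atTop.1 (((tendsto_fussCatalan hs).div_const (xc s)).eventually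
    (Metric.closedBall_mem_nhds _ hε))
  refine ⟨n₁ + 1, by omega, fun n hn b c p => ?_⟩
  obtain ⟨m, rfl⟩ : ∃ m, n = m + 1 := ⟨n - 1, by omega⟩
  have h := h₁ (m + 1) (by omega)
  rw [Real.dist_eq] at h
  have hm : (0 : ℝ) < ((m + 1 : ℕ) : ℝ) := by positivity
  set X := ‖c‖ ^ 2 * ((m + 1 : ℕ) : ℝ) ^ (-(3 / 2) : ℝ) * (‖p‖ ^ 2 / xc s) ^ (m + 1 - 1) with hX
  have hX0 : 0 ≤ X := by positivity
  have e : ‖ansatz s b c p (m + 1)‖ ^ 2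
      = fussCatalan s (m + 1) * ((m + 1 : ℕ) : ℝ) ^ (3 / 2 : ℝ) * xc s ^ (m + 1) / xc s * X := by
    have hr : ((m + 1 : ℕ) : ℝ) ^ (3 / 2 : ℝ) ≠ 0 := (Real.rpow_pos_of_pos hm _).ne'
    simp only [ansatz, norm_mul, Complex.norm_real, norm_pow, mul_pow, Real.norm_eq_abs, sq_abs,
      f_sq hs, hX, Nat.add_sub_cancel]
    rw [Real.rpow_neg hm.le, div_pow, pow_succ (xc s)]
    field_simp
    ring
  rw [e, spectrumConst, ← sub_mul, abs_mul, abs_of_nonneg hX0]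
  exact mul_le_mul_of_nonneg_right h hX0

/-! ### Asymptotics of condensing solutions -/

/-- The product form of the inverse of `F` in the variable `y = 1 / (1 + F)`. -/
lemma genFInv_inv_sub_one {s y : ℝ} (hy : 0 < y) :
    genFInv s (y⁻¹ - 1) = (1 - y) * y ^ (s - 1) := by
  rw [genFInv, add_sub_cancel, Real.inv_rpow hy.le, Real.rpow_sub hy, Real.rpow_one]
  have := (Real.rpow_pos_of_pos hy s).ne'
  field_simp

lemma hasDerivAt_one_sub_mul_rpow (s : ℝ) {y : ℝ} (hy : 0 < y) :
    HasDerivAt (fun y : ℝ => (1 - y) * y ^ (s - 1)) (y ^ (s - 2) * (s - 1 - s * y)) y := by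
  have h := ((hasDerivAt_id y).const_sub 1).mul
    (Real.hasDerivAt_rpow_const (p := s - 1) (Or.inl hy.ne'))
  refine h.congr_deriv ?_
  rw [show s - 1 = s - 2 + 1 by ring, Real.rpow_add_one hy.ne']
  simp
  ring

lemma one_sub_mul_rpow_crit {s : ℝ} (hs : 1 < s) :
    (1 - (s - 1) / s) * ((s - 1) / s) ^ (s - 1) = xc s := by
  have hs1 : 0 < s - 1 := by linarith
  have hs0 : 0 < s := by linarith
  rw [← genFInv_inv_sub_one (by positivity), ← genFInv_crit hs]
  congr 1
  field_simp
  ring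

/-- Second-order expansion of `x` at its maximum `x_c`. -/
lemma tendsto_one_sub_div_xc {s : ℝ} (hs : 1 < s) :
    Tendsto (fun y : ℝ => (1 - (1 - y) * y ^ (s - 1) / xc s) / (y - (s - 1) / s) ^ 2)
      (𝓝[>] ((s - 1) / s)) (𝓝 (s * ((s - 1) / s) ^ (s - 2) / (2 * xc s))) := by
  have hs1 : 0 < s - 1 := by linarith
  have hs0 : 0 < s := by linarith
  have hx := xc_pos hs
  set yc := (s - 1) / s with hyc
  have hyc0 : 0 < yc := by positivity
  have hev : ∀ᶠ y : ℝ in 𝓝[>] yc, yc < y := self_mem_nhdsWithin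
  have hd1 : ∀ y : ℝ, 0 < y → HasDerivAt (fun y : ℝ => 1 - (1 - y) * y ^ (s - 1) / xc s)
      (-(y ^ (s - 2) * (s - 1 - s * y) / xc s)) y := fun y hy =>
    ((hasDerivAt_one_sub_mul_rpow s hy).div_const _).const_sub 1
  have hd2 : ∀ y : ℝ, HasDerivAt (fun y : ℝ => (y - yc) ^ 2) (2 * (y - yc)) y := fun y => by
    simpa using ((hasDerivAt_id y).sub_const yc).fun_pow 2
  refine HasDerivAt.lhopital_zero_nhdsGT (f' := fun y => -(y ^ (s - 2) * (s - 1 - s * y) / xc s))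
    (g' := fun y => 2 * (y - yc)) ?_ ?_ ?_ ?_ ?_ ?_
  · filter_upwards [hev] with y hy using hd1 y (hyc0.trans hy)
  · filter_upwards with y using hd2 y
  · filter_upwards [hev] with y hy
    have : 0 < y - yc := sub_pos.2 hy
    positivity
  · have h := (hd1 yc hyc0).continuousAt.tendsto
    rw [one_sub_mul_rpow_crit hs, div_self hx.ne', sub_self] at h
    exact h.mono_left nhdsWithin_le_nhds
  · have h := (hd2 yc).continuousAt.tendsto
    rw [sub_self, zero_pow two_ne_zero] at h
    exact h.mono_left nhdsWithin_le_nhds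
  · have h : Tendsto (fun y : ℝ => s * y ^ (s - 2) / (2 * xc s)) (𝓝[>] yc)
        (𝓝 (s * yc ^ (s - 2) / (2 * xc s))) :=
      ((((continuousAt_id (x := yc)).rpow_const (Or.inl hyc0.ne')).const_mul s).div_const
        _).tendsto.mono_left nhdsWithin_le_nhds
    refine h.congr' ?_
    filter_upwards [hev] with y hy
    have h1 : y - yc ≠ 0 := (sub_pos.2 hy).ne'
    have h2 : s - 1 - s * y = -(s * (y - yc)) := by rw [hyc]; field_simp; ring
    rw [h2]
    field_simp

/-- A transfer of the Abelian theorem along a curve on which `|c|²` and `1 - |p|² / x_c` vanish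
to orders two and four. -/
lemma tendsto_sobolevNorm {s : ℝ} (hs : 1 < s) {ξ : ℝ} (hξ : 1 / 2 < ξ) {T N C₁ C₂ : ℝ}
    (hC₂ : 0 < C₂) {B C P : ℝ → ℂ} (hB : ∀ᶠ t in 𝓝[<] T, ‖B t‖ ^ 2 ≤ N)
    (hlt : ∀ᶠ t in 𝓝[<] T, ‖P t‖ ^ 2 < xc s)
    (hP : Tendsto (fun t => ‖P t‖ ^ 2) (𝓝[<] T) (𝓝 (xc s)))
    (h1 : Tendsto (fun t => ‖C t‖ ^ 2 / (T - t) ^ 2) (𝓝[<] T) (𝓝 C₁))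
    (h2 : Tendsto (fun t => (1 - ‖P t‖ ^ 2 / xc s) / (T - t) ^ 4) (𝓝[<] T) (𝓝 C₂)) :
    Tendsto (fun t => sobolevNorm ξ (ansatz s (B t) (C t) (P t)) / (T - t) ^ (2 * (1 - 2 * ξ)))
      (𝓝[<] T) (𝓝 (√(C₁ * (spectrumConst s * Real.Gamma (2 * ξ - 1 / 2)) *
        C₂ ^ (-(2 * ξ - 1 / 2))))) := by
  have hx := xc_pos hs
  have htail := (tendsto_sobolevTail hs hξ).comp (tendsto_nhdsWithin_iff.2 ⟨hP, hlt⟩)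
  have hw : Tendsto (fun t : ℝ => (T - t) ^ (8 * ξ - 4)) (𝓝[<] T) (𝓝 0) := by
    have h : ContinuousAt (fun t : ℝ => (T - t) ^ (8 * ξ - 4)) T :=
      (continuousAt_const.sub continuousAt_id).rpow_const (Or.inr (by linarith))
    have h' := h.tendsto
    rw [sub_self, Real.zero_rpow (by linarith)] at h'
    exact h'.mono_left nhdsWithin_le_nhds
  have hb : Tendsto (fun t => ‖B t‖ ^ 2 * (T - t) ^ (8 * ξ - 4)) (𝓝[<] T) (𝓝 0) := by
    have hN := hw.const_mul N
    rw [mul_zero] at hN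
    refine squeeze_zero' ?_ ?_ hN
    · filter_upwards [self_mem_nhdsWithin] with t ht
      have : 0 ≤ T - t := (sub_pos.2 ht).le
      positivity
    · filter_upwards [self_mem_nhdsWithin, hB] with t ht hbt
      have : 0 ≤ T - t := (sub_pos.2 ht).le
      gcongr
  have hmain := (hb.add ((h1.mul htail).mul
    (h2.rpow_const (p := -(2 * ξ - 1 / 2)) (Or.inl hC₂.ne')))).sqrt
  rw [zero_add] at hmain
  refine hmain.congr' ?_
  filter_upwards [self_mem_nhdsWithin, hlt] with t ht hpt
  have hT : 0 < T - t := sub_pos.2 ht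
  have hq : 0 < 1 - ‖P t‖ ^ 2 / xc s := sub_pos.2 ((div_lt_one hx).2 hpt)
  rw [sobolevNorm_ansatz hs ξ (B t) (C t) hpt]
  have e1 : (T - t) ^ (2 * (1 - 2 * ξ)) = √((T - t) ^ (4 - 8 * ξ)) := by
    rw [Real.sqrt_eq_rpow, ← Real.rpow_mul hT.le]
    congr 1
    ring
  rw [e1, ← Real.sqrt_div' _ (by positivity)]
  congr 1
  have e2 : (T - t) ^ (4 - 8 * ξ) = ((T - t) ^ (8 * ξ - 4))⁻¹ := by
    rw [← Real.rpow_neg hT.le]; congr 1; ring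
  have e3 : ((T - t) ^ 4) ^ (-(2 * ξ - 1 / 2)) * (T - t) ^ (8 * ξ - 4) * (T - t) ^ 2 = 1 := by
    rw [← Real.rpow_natCast (T - t) 4, ← Real.rpow_mul hT.le, ← Real.rpow_natCast (T - t) 2,
      ← Real.rpow_add hT, ← Real.rpow_add hT]
    convert Real.rpow_zero (T - t) using 2
    push_cast
    ring
  have e4 : ((1 - ‖P t‖ ^ 2 / xc s) ^ (-(2 * ξ - 1 / 2)))
      * (1 - ‖P t‖ ^ 2 / xc s) ^ (2 * ξ - 1 / 2) = 1 := by
    rw [← Real.rpow_add hq, neg_add_cancel, Real.rpow_zero]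
  rw [e2, div_inv_eq_mul, Real.div_rpow hq.le (by positivity)]
  have hT4 : ((T - t) ^ 4) ^ (-(2 * ξ - 1 / 2)) ≠ 0 := (Real.rpow_pos_of_pos (by positivity) _).ne'
  have hT2 : (T - t) ^ 2 ≠ 0 := by positivity
  simp only [Function.comp]
  generalize ((T - t) ^ 4) ^ (-(2 * ξ - 1 / 2)) = X at e3 hT4 ⊢
  generalize (1 - ‖P t‖ ^ 2 / xc s) ^ (-(2 * ξ - 1 / 2)) = Q₁ at e4 ⊢
  generalize (1 - ‖P t‖ ^ 2 / xc s) ^ (2 * ξ - 1 / 2) = Q₂ at e4 ⊢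
  have e5 : (T - t) ^ (8 * ξ - 4)
      = X⁻¹ * ((T - t) ^ 2)⁻¹ := by
    field_simp
    linear_combination e3
  rw [e5, add_mul]
  congr 1
  rw [div_eq_mul_inv, div_eq_mul_inv]
  linear_combination (‖C t‖ ^ 2 * sobolevTail s ξ (‖P t‖ ^ 2) *
    (X⁻¹ * ((T - t) ^ 2)⁻¹)) * e4

section
variable {s N E : ℝ} (hs : 1 < s) (hN : 0 < N) (hE : 0 < E)
include hs hN hE

/-- Rate at which `y = 1 / (1 + F)` reaches its critical value. -/
lemma tendsto_ysol_sub_div :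
    Tendsto (fun t => (ysol s N E t - (s - 1) / s) / (Tc s N E - t) ^ 2) (𝓝[<] (Tc s N E))
      (𝓝 (4 * (s - 1) * N * E / discr s N E * Omega s N E ^ 2)) := by
  have hO := Omega_pos hs hN hE
  have e : Omega s N E * Tc s N E = Real.pi / 2 := by rw [Tc]; field_simp
  have hd : HasDerivAt (fun t => Real.cos (Omega s N E * t)) (-Omega s N E) (Tc s N E) := by
    have h := ((hasDerivAt_id (Tc s N E)).const_mul (Omega s N E)).cos
    simpa [e] using h
  have h := hd.tendsto_slope.mono_left
    (nhdsWithin_mono (Tc s N E) (fun t (ht : t < Tc s N E) => ht.ne))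
  have h2 := (h.pow 2).const_mul (4 * (s - 1) * N * E / discr s N E)
  rw [neg_sq] at h2
  refine h2.congr' ?_
  filter_upwards [self_mem_nhdsWithin] with t ht
  have hT : Tc s N E - t ≠ 0 := (sub_pos.2 ht).ne'
  have hT' : t - Tc s N E ≠ 0 := (sub_neg.2 ht).ne
  rw [slope_def_field, e, Real.cos_pi_div_two, ysol, sub_zero]
  have : (t - Tc s N E) ^ 2 = (Tc s N E - t) ^ 2 := by ring
  rw [div_pow, this]
  ring

lemma tendsto_ysol :
    Tendsto (ysol s N E) (𝓝[<] (Tc s N E)) (𝓝[>] ((s - 1) / s)) := by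
  have hO := Omega_pos hs hN hE
  have hT := Tc_pos hs hN hE
  have e : Omega s N E * Tc s N E = Real.pi / 2 := by rw [Tc]; field_simp
  refine tendsto_nhdsWithin_iff.2 ⟨?_, ?_⟩
  · have hc : Continuous (ysol s N E) := by unfold ysol; fun_prop
    have h := hc.tendsto (Tc s N E)
    have : ysol s N E (Tc s N E) = (s - 1) / s := by
      rw [ysol, e, Real.cos_pi_div_two]; ring
    rw [this] at h
    exact h.mono_left nhdsWithin_le_nhds
  · filter_upwards [Ioo_mem_nhdsLT (show -Tc s N E < Tc s N E by linarith)] with t ht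
    exact lt_ysol hs hN hE ht

lemma tendsto_Fsol : Tendsto (Fsol s N E) (𝓝[<] (Tc s N E)) (𝓝 (Fc s)) := by
  have hs1 : 0 < s - 1 := by linarith
  have hs0 : 0 < s := by linarith
  have h := ((tendsto_nhdsWithin_iff.1 (tendsto_ysol hs hN hE)).1.inv₀
    (by positivity)).sub_const 1
  have e : ((s - 1) / s)⁻¹ - 1 = Fc s := by rw [Fc_eq hs]; field_simp; ring
  rw [e] at h
  exact h.congr fun t => (Fsol_eq hs hN hE t).symm

namespace IsGaugeSolution
variable {b u v : ℝ → ℂ} (h : IsGaugeSolution s N E b u v)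
  (hy : ∀ t, gaugeY (u t) = ysol s N E t)
include hy

lemma normSq_u_eq_Fsol (t : ℝ) : ‖u t‖ ^ 2 = Fsol s N E t := by
  rw [Fsol_eq hs hN hE, ← hy t, gaugeY, inv_inv, add_sub_cancel_left]

lemma normSq_u_lt {t : ℝ} (ht : t ∈ Set.Ioo (-Tc s N E) (Tc s N E)) :
    (s - 1) * ‖u t‖ ^ 2 < 1 := by
  have hs1 : 0 < s - 1 := by linarith
  have hs0 : 0 < s := by linarith
  have h1 := lt_ysol hs hN hE ht
  rw [← hy t, div_lt_iff₀ hs0] at h1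
  have h2 := gaugeY_mul (u t)
  have h3 := gaugeY_pos (u t)
  refine lt_of_mul_lt_mul_left ?_ h3.le
  linear_combination h1 + (s - 1) * h2

lemma normSq_p_eq (t : ℝ) : ‖u t * gaugeW s (u t)‖ ^ 2
    = (1 - ysol s N E t) * ysol s N E t ^ (s - 1) := by
  rw [norm_sq_mul_gaugeW_eq, normSq_u_eq_Fsol hs hN hE hy, Fsol_eq hs hN hE,
    genFInv_inv_sub_one (ysol_pos hs hN hE t)]

lemma tendsto_normSq_p :
    Tendsto (fun t => ‖u t * gaugeW s (u t)‖ ^ 2) (𝓝[<] (Tc s N E)) (𝓝 (xc s)) := by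
  have hs1 : 0 < s - 1 := by linarith
  have hs0 : 0 < s := by linarith
  have hyc : 0 < (s - 1) / s := by positivity
  have hc := (hasDerivAt_one_sub_mul_rpow s hyc).continuousAt.tendsto
  rw [one_sub_mul_rpow_crit hs] at hc
  exact (hc.comp (tendsto_nhdsWithin_iff.1 (tendsto_ysol hs hN hE)).1).congr fun t =>
    (normSq_p_eq hs hN hE hy t).symm

lemma tendsto_one_sub_normSq_p :
    Tendsto (fun t => (1 - ‖u t * gaugeW s (u t)‖ ^ 2 / xc s) / (Tc s N E - t) ^ 4)
      (𝓝[<] (Tc s N E)) (𝓝 (s * ((s - 1) / s) ^ (s - 2) / (2 * xc s) *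
        (4 * (s - 1) * N * E / discr s N E * Omega s N E ^ 2) ^ 2)) := by
  have hlim := ((tendsto_one_sub_div_xc hs).comp (tendsto_ysol hs hN hE)).mul
    ((tendsto_ysol_sub_div hs hN hE).pow 2)
  refine hlim.congr' ?_
  have hT := Tc_pos hs hN hE
  filter_upwards [Ioo_mem_nhdsLT (show -Tc s N E < Tc s N E by linarith)] with t ht
  have h1 : ysol s N E t - (s - 1) / s ≠ 0 := (sub_pos.2 (lt_ysol hs hN hE ht)).ne'
  have h2 : Tc s N E - t ≠ 0 := (sub_pos.2 ht.2).ne'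
  rw [normSq_p_eq hs hN hE hy]
  simp only [Function.comp]
  generalize ysol s N E t - (s - 1) / s = A at h1 ⊢
  generalize Tc s N E - t = B at h2 ⊢
  generalize 1 - (1 - ysol s N E t) * ysol s N E t ^ (s - 1) / xc s = X
  field_simp

include h

omit hN hE in
lemma normSq_c_eq (t : ℝ) : ‖v t * gaugeW s (u t)‖ ^ 2
    = E * s * (ysol s N E t - (s - 1) / s) * ysol s N E t ^ s := by
  have hs0 : 0 < s := by linarith
  rw [norm_sq_mul_gaugeW, gaugeW_sq, h.normSq_v, hy]
  field_simp

lemma tendsto_normSq_c :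
    Tendsto (fun t => ‖v t * gaugeW s (u t)‖ ^ 2 / (Tc s N E - t) ^ 2)
      (𝓝[<] (Tc s N E)) (𝓝 (E * s * (4 * (s - 1) * N * E / discr s N E * Omega s N E ^ 2) *
        ((s - 1) / s) ^ s)) := by
  have hs1 : 0 < s - 1 := by linarith
  have hs0 : 0 < s := by linarith
  have hyc : 0 < (s - 1) / s := by positivity
  have h1 := ((tendsto_nhdsWithin_iff.1 (tendsto_ysol hs hN hE)).1.rpow_const (p := s)
    (Or.inl hyc.ne'))
  refine (((tendsto_ysol_sub_div hs hN hE).const_mul (E * s)).mul h1).congr fun t => ?_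
  rw [normSq_c_eq hs h hy]
  ring

lemma tendsto_normSq_c_zero :
    Tendsto (fun t => ‖v t * gaugeW s (u t)‖ ^ 2) (𝓝[<] (Tc s N E)) (𝓝 0) := by
  have h1 : Tendsto (fun t : ℝ => (Tc s N E - t) ^ 2) (𝓝[<] (Tc s N E)) (𝓝 0) := by
    have : Continuous fun t : ℝ => (Tc s N E - t) ^ 2 := by fun_prop
    have h' := this.tendsto (Tc s N E)
    rw [sub_self, zero_pow two_ne_zero] at h'
    exact h'.mono_left nhdsWithin_le_nhds
  have h2 := (tendsto_normSq_c hs hN hE h hy).mul h1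
  rw [mul_zero] at h2
  refine h2.congr' ?_
  filter_upwards [self_mem_nhdsWithin] with t ht
  have : Tc s N E - t ≠ 0 := (sub_pos.2 ht).ne'
  field_simp

/-- The explicit solution condenses at `T`. -/
theorem condensesAt : CondensesAt
    (fun t => ansatz s (b t) (v t * gaugeW s (u t)) (u t * gaugeW s (u t))) N (Tc s N E) := by
  have hs1 : 0 < s - 1 := by linarith
  have hs0 : 0 < s := by linarith
  intro n
  cases n with
  | zero =>
    have h1 := (((tendsto_nhdsWithin_iff.1 (tendsto_ysol hs hN hE)).1.sub_const
      ((s - 1) / s)).const_mul (E * s)).const_sub N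
    rw [sub_self, mul_zero, sub_zero] at h1
    refine h1.congr fun t => ?_
    have h2 := h.particle t
    have h3 := h.normSq_v t
    rw [hy] at h3
    simp only [ansatz]
    have : E * s * (ysol s N E t - (s - 1) / s) = E * (s * ysol s N E t - (s - 1)) := by
      field_simp
    rw [this]
    linarith
  | succ n =>
    have h1 := ((tendsto_normSq_c_zero hs hN hE h hy).mul
      ((tendsto_normSq_p hs hN hE hy).pow n)).const_mul (fussCatalan s (n + 1))
    rw [zero_mul, mul_zero] at h1
    simp only [Nat.add_eq_zero_iff, one_ne_zero, and_false, if_false]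
    refine h1.congr fun t => ?_
    generalize v t * (gaugeW s (u t) : ℂ) = c
    generalize u t * (gaugeW s (u t) : ℂ) = p
    simp only [ansatz, norm_mul, norm_pow, mul_pow, Complex.norm_real, Real.norm_eq_abs, sq_abs,
      f_sq hs]
    ring

end IsGaugeSolution

end

/-! ### The explicit condensing data -/

/-- The value at the explicit data of the variable `u`, so that `p = u (1 + |u|²) ^ (-s / 2)`. -/
def uInit (s N E : ℝ) : ℝ := (s * E - N) / (√(s - 1) * (N + s * E))

/-- The value at the explicit data of the variable `v`, so that `c = v (1 + |u|²) ^ (-s / 2)`. -/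
def vInit (s N E : ℝ) : ℝ := 2 * E * (√(s * N / discr s N E) * √(s - 1))

section
variable {s N E : ℝ} (hs : 1 < s) (hN : 0 < N) (hE : 0 < E)
include hs hN hE

lemma normSq_uInit :
    ‖(uInit s N E : ℂ)‖ ^ 2 = (N - s * E) ^ 2 / ((s - 1) * (N + s * E) ^ 2) := by
  have hs1 : 0 < s - 1 := by linarith
  have hq : 0 < N + s * E := by positivity
  rw [Complex.norm_real, Real.norm_eq_abs, sq_abs, uInit, div_pow, mul_pow, Real.sq_sqrt hs1.le]
  ring

lemma normSq_vInit :
    ‖(vInit s N E : ℂ)‖ ^ 2 = 4 * E ^ 2 * (s * N / discr s N E * (s - 1)) := by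
  have hs1 : 0 < s - 1 := by linarith
  have hD := discr_pos hs hN hE
  rw [Complex.norm_real, Real.norm_eq_abs, sq_abs, vInit, mul_pow, mul_pow, mul_pow,
    Real.sq_sqrt hs1.le, Real.sq_sqrt (by positivity)]
  ring

lemma gaugeY_uInit :
    gaugeY (uInit s N E : ℂ) = (s - 1) * (N + s * E) ^ 2 / discr s N E := by
  have hs1 : 0 < s - 1 := by linarith
  have hq : 0 < N + s * E := by positivity
  have hD := discr_pos hs hN hE
  rw [gaugeY, normSq_uInit hs hN hE]
  unfold discr at hD ⊢
  field_simp
  ring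

lemma uInit_mul_gaugeW :
    (uInit s N E : ℂ) * gaugeW s (uInit s N E) = (pInit s N E : ℂ) := by
  rw [gaugeW, gaugeY_uInit hs hN hE, pInit, uInit, discr]
  push_cast
  rfl

lemma vInit_mul_gaugeW :
    (vInit s N E : ℂ) * gaugeW s (uInit s N E) = (cInit s N E : ℂ) := by
  have hs1 : 0 < s - 1 := by linarith
  have hq : 0 < N + s * E := by positivity
  have hD := discr_pos hs hN hE
  have hD' : cInit s N E = 2 * E * (s * N) ^ (1 / 2 : ℝ) * (N + s * E) ^ s *
      ((s - 1) / discr s N E) ^ ((s + 1) / 2) := rfl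
  rw [gaugeW, gaugeY_uInit hs hN hE, hD', ← Complex.ofReal_mul, vInit]
  congr 1
  have e1 : (s - 1) * (N + s * E) ^ 2 / discr s N E
      = (s - 1) / discr s N E * (N + s * E) ^ (2 : ℝ) := by
    rw [Real.rpow_two]; ring
  rw [e1, Real.mul_rpow (by positivity) (by positivity), ← Real.rpow_mul hq.le,
    show (s + 1) / 2 = s / 2 + 1 / 2 by ring, Real.rpow_add (by positivity),
    ← Real.sqrt_eq_rpow, ← Real.sqrt_eq_rpow, Real.sqrt_div' _ hD.le, Real.sqrt_div' _ hD.le,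
    show 2 * (s / 2) = s by ring]
  ring

lemma normSq_uInit_lt : (s - 1) * ‖(uInit s N E : ℂ)‖ ^ 2 < 1 := by
  have hs1 : 0 < s - 1 := by linarith
  have hq : 0 < N + s * E := by positivity
  have : (s - 1) * ‖(uInit s N E : ℂ)‖ ^ 2 = (N - s * E) ^ 2 / (N + s * E) ^ 2 := by
    rw [normSq_uInit hs hN hE]; field_simp
  rw [this, div_lt_one (by positivity)]
  have : 0 < s * (N * E) := by positivity
  nlinarith

lemma genF_pInit : genF s (‖(pInit s N E : ℂ)‖ ^ 2) = ‖(uInit s N E : ℂ)‖ ^ 2 := by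
  rw [← uInit_mul_gaugeW hs hN hE]
  exact genF_mul_gaugeW hs (normSq_uInit_lt hs hN hE)

lemma pInit_lt : ‖(pInit s N E : ℂ)‖ ^ 2 < xc s := by
  rw [← uInit_mul_gaugeW hs hN hE]
  exact norm_sq_mul_gaugeW_lt hs (normSq_uInit_lt hs hN hE)

lemma genF_pInit_eq_F0 : genF s (‖(pInit s N E : ℂ)‖ ^ 2) = F0 s N E := by
  rw [genF_pInit hs hN hE, normSq_uInit hs hN hE, F0, Fc_eq hs]
  have hs1 : 0 < s - 1 := by linarith
  have hq : 0 < N + s * E := by positivity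
  field_simp

lemma cInit_ne_zero : (cInit s N E : ℂ) ≠ 0 := by
  have hs1 : 0 < s - 1 := by linarith
  have hD := discr_pos hs hN hE
  rw [← vInit_mul_gaugeW hs hN hE, ← Complex.ofReal_mul, Complex.ofReal_ne_zero]
  have := gaugeW_pos s (uInit s N E)
  unfold vInit
  positivity

omit hs hN hE in
lemma bInit_eq : bInit s N E = (N + (s - 2) * E) * √(s * N / discr s N E) := by
  rw [Real.sqrt_eq_rpow]; rfl

lemma normSq_cInit_mul :
    ‖(cInit s N E : ℂ)‖ ^ 2 * (1 + genF s (‖(pInit s N E : ℂ)‖ ^ 2)) ^ s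
      = ‖(vInit s N E : ℂ)‖ ^ 2 := by
  rw [genF_pInit hs hN hE, ← vInit_mul_gaugeW hs hN hE, norm_sq_mul_gaugeW, mul_assoc,
    gaugeW_sq_mul, mul_one]

lemma particleNumber_init :
    particleNumber (ansatz s (bInit s N E) (cInit s N E) (pInit s N E)) = N := by
  have hs1 : 0 < s - 1 := by linarith
  have hs0 : 0 < s := by linarith
  have hD := discr_pos hs hN hE
  rw [particleNumber_ansatz hs _ _ (pInit_lt hs hN hE), normSq_cInit_mul hs hN hE,
    normSq_vInit hs hN hE, bInit_eq, Complex.norm_real, Real.norm_eq_abs, sq_abs, mul_pow,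
    Real.sq_sqrt (by positivity)]
  unfold discr at hD ⊢
  field_simp
  ring

lemma energy_init :
    energy (ansatz s (bInit s N E) (cInit s N E) (pInit s N E)) = E := by
  have hs1 : 0 < s - 1 := by linarith
  have hs0 : 0 < s := by linarith
  have hq : 0 < N + s * E := by positivity
  have hD := discr_pos hs hN hE
  have hp := pInit_lt hs hN hE
  have h1 := one_sub_genF_pos hs (sq_nonneg _) hp
  have h2 := genFDeriv_eq hs (sq_nonneg _) hp
  have h3 := normSq_cInit_mul hs hN hE
  rw [energy_ansatz hs _ _ hp]
  refine mul_right_cancel₀ h1.ne' ?_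
  rw [mul_assoc, h2, mul_comm (1 + _), ← mul_assoc, h3, genF_pInit hs hN hE,
    normSq_vInit hs hN hE, normSq_uInit hs hN hE]
  unfold discr at hD ⊢
  field_simp
  ring

lemma Sval_init :
    Sval s (bInit s N E) (cInit s N E) (pInit s N E) = 2 * (s - 1) * N := by
  have hs1 : 0 < s - 1 := by linarith
  have hs0 : 0 < s := by linarith
  have hq : 0 < N + s * E := by positivity
  have hD := discr_pos hs hN hE
  have hr : √(s * N / discr s N E) ^ 2 = s * N / discr s N E := Real.sq_sqrt (by positivity)
  have hz : (gaugeZ (bInit s N E) (uInit s N E) (vInit s N E)).re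
      = (N + (s - 2) * E) * (2 * E) * (s * N / discr s N E) * ((s * E - N) / (N + s * E)) := by
    rw [gaugeZ, Complex.conj_ofReal, Complex.conj_ofReal, ← Complex.ofReal_mul,
      ← Complex.ofReal_mul, Complex.ofReal_re, bInit_eq, uInit, vInit]
    generalize √(s * N / discr s N E) = r at hr ⊢
    rw [← hr]
    have : √(s - 1) ≠ 0 := (Real.sqrt_pos.2 hs1).ne'
    field_simp
  rw [Sval_eq (uInit_mul_gaugeW hs hN hE) (vInit_mul_gaugeW hs hN hE) (genF_pInit hs hN hE),
    particleNumber_init hs hN hE, energy_init hs hN hE, gaugeK, hz, gaugeY_uInit hs hN hE]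
  unfold discr at hD ⊢
  field_simp
  ring

end

/-! ### Condensation and the conserved quantity `S` -/

section
variable {s : ℝ} (hs : 1 < s) (b : ℂ) {c p : ℂ} (hc : c ≠ 0) (hp : ‖p‖ ^ 2 < xc s)
include hs hc hp

/-- If `S = 2 (s - 1) N`, then the data are reached by the explicit motion at some time `t₀`
before condensation. -/
lemma exists_condensing {N E : ℝ} (hN : particleNumber (ansatz s b c p) = N)
    (hE : energy (ansatz s b c p) = E) (hS : Sval s b c p = 2 * (s - 1) * N) :
    ∃ t₀ ∈ Set.Ioo (-Tc s N E) (Tc s N E), ∃ B u v : ℝ → ℂ, IsGaugeSolution s N E B u v ∧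
      B t₀ = b ∧ v t₀ * gaugeW s (u t₀) = c ∧ u t₀ * gaugeW s (u t₀) = p ∧
      ∀ t, gaugeY (u t) = ysol s N E t := by
  have hs0 : 0 < s := by linarith
  obtain ⟨B, u, v, h, hB, hv, hu, hlt, hK⟩ := exists_gaugeSolution hs b hc hp
  have hN0 := particleNumber_ansatz_pos hs b hc hp
  have hE0 := energy_ansatz_pos hs b hc hp
  rw [hN, hE] at h hK
  rw [hN] at hN0
  rw [hE] at hE0
  have hK' : gaugeK s N E (B 0) (u 0) (v 0) = (s - 1) / s * N := by
    rw [hB]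
    rw [hS] at hK
    field_simp
    linarith
  obtain ⟨t₀, ht₀, hy⟩ := h.exists_gaugeY_eq hs hN0 hE0 hK' hlt
  exact ⟨t₀, ht₀, _, _, _, h.shift t₀, by simpa using hB, by simpa using hv, by simpa using hu, hy⟩

/-- If `S ≠ 2 (s - 1) N`, then the solution is global and `c` stays away from `0`. -/
lemma exists_global (hS : Sval s b c p ≠ 2 * (s - 1) * particleNumber (ansatz s b c p)) :
    ∃ B u v : ℝ → ℂ,
      IsGaugeSolution s (particleNumber (ansatz s b c p)) (energy (ansatz s b c p)) B u v ∧
      B 0 = b ∧ v 0 * gaugeW s (u 0) = c ∧ u 0 * gaugeW s (u 0) = p ∧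
      ∃ δ > 0, ∀ t, (s - 1) * ‖u t‖ ^ 2 ≤ 1 - δ ∧ δ ≤ ‖v t * gaugeW s (u t)‖ ^ 2 := by
  have hs0 : 0 < s := by linarith
  have hs1 : 0 < s - 1 := by linarith
  obtain ⟨B, u, v, h, hB, hv, hu, hlt, hK⟩ := exists_gaugeSolution hs b hc hp
  have hE := energy_ansatz_pos hs b hc hp
  set N := particleNumber (ansatz s b c p)
  set E := energy (ansatz s b c p)
  obtain ⟨δ, hδ, hvδ⟩ := h.exists_le_normSq_v hs hE (by
    rw [hB]
    intro hcon
    rw [hcon] at hK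
    refine hS (hK.trans ?_)
    field_simp)
  have hyc : 0 < (s - 1) / s := by positivity
  refine ⟨B, u, v, h, hB, hv, hu, min (δ / E) (δ * ((s - 1) / s) ^ s), by positivity,
    fun t => ⟨?_, ?_⟩⟩
  · have h1 := h.energy t
    have h2 : δ ≤ E * (1 - (s - 1) * ‖u t‖ ^ 2) := by
      rw [← h1]
      nlinarith [hvδ t, sq_nonneg ‖u t‖]
    have h3 : δ / E ≤ 1 - (s - 1) * ‖u t‖ ^ 2 := by
      rw [div_le_iff₀ hE]; linarith
    linarith [min_le_left (δ / E) (δ * ((s - 1) / s) ^ s)]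
  · refine (min_le_right _ _).trans ?_
    rw [norm_sq_mul_gaugeW, gaugeW_sq]
    have h1 := h.normSq_u_le hE t
    have h2 : (s - 1) / s ≤ gaugeY (u t) := by
      have h3 := gaugeY_mul (u t)
      have h4 := gaugeY_pos (u t)
      rw [div_le_iff₀ hs0]
      nlinarith
    have := hvδ t
    gcongr

/-- Data with `S = 2 (s - 1) N` condense in finite time. -/
lemma condensesInFiniteTime_of_Sval_eq
    (hS : Sval s b c p = 2 * (s - 1) * particleNumber (ansatz s b c p)) :
    CondensesInFiniteTime s (ansatz s b c p) := by
  have hN0 := particleNumber_ansatz_pos hs b hc hp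
  have hE0 := energy_ansatz_pos hs b hc hp
  obtain ⟨t₀, ht₀, B, u, v, h, hB, hv, hu, hy⟩ := exists_condensing hs b hc hp rfl rfl hS
  set N := particleNumber (ansatz s b c p)
  set E := energy (ansatz s b c p)
  have h' := h.shift (-t₀)
  simp only [sub_neg_eq_add] at h'
  refine ⟨Tc s N E - t₀, sub_pos.2 ht₀.2, _, h'.isSolutionOn hs fun t ht => ?_, ?_, fun n => ?_⟩
  · refine IsGaugeSolution.normSq_u_lt hs hN0 hE0 hy ⟨?_, ?_⟩
    · linarith [ht.1, ht₀.1]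
    · linarith [ht.2]
  · simp only [zero_add, hB, hv, hu]
  · have hshift : Tendsto (fun t => t + t₀) (𝓝[<] (Tc s N E - t₀)) (𝓝[<] (Tc s N E)) := by
      refine tendsto_nhdsWithin_iff.2 ⟨?_, ?_⟩
      · have : Tendsto (fun t => t + t₀) (𝓝 (Tc s N E - t₀)) (𝓝 (Tc s N E - t₀ + t₀)) :=
          (continuous_id.add continuous_const).tendsto _
        rw [sub_add_cancel] at this
        exact this.mono_left nhdsWithin_le_nhds
      · filter_upwards [self_mem_nhdsWithin] with t ht
        exact lt_sub_iff_add_lt.1 (Set.mem_Iio.1 ht)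
    exact (IsGaugeSolution.condensesAt hs hN0 hE0 h hy n).comp hshift

/-- Condensing data satisfy `S = 2 (s - 1) N`: otherwise, by uniqueness, the condensing solution
is the global one, whose first mode stays away from `0`. -/
lemma Sval_eq_of_condensesInFiniteTime (h : CondensesInFiniteTime s (ansatz s b c p)) :
    Sval s b c p = 2 * (s - 1) * particleNumber (ansatz s b c p) := by
  by_contra hS
  obtain ⟨T, hT, α, hα, hα0, hcond⟩ := h
  obtain ⟨B, u, v, h, hB, hv, hu, δ, hδ, hlt⟩ := exists_global hs b hc hp hS
  have hsol := h.isSolutionOn hs (J := Set.Ico 0 T) fun t _ => by linarith [(hlt t).1]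
  have heq : ∀ t ∈ Set.Ico 0 T, α t
      = ansatz s (B t) (v t * gaugeW s (u t)) (u t * gaugeW s (u t)) := fun t ht =>
    isSolutionOn_unique hs Set.ordConnected_Ico (Set.left_mem_Ico.2 hT) hα hsol
      (by rw [hα0, hB, hv, hu]) ht
  have h1 := hcond 1
  rw [if_neg one_ne_zero] at h1
  obtain ⟨t, hlt', ht⟩ := ((h1.eventually (gt_mem_nhds hδ)).and
    (Ico_mem_nhdsLT hT)).exists
  rw [heq t ht] at hlt'
  have h2 : f s 1 ^ 2 = 1 := by rw [f_sq hs, fussCatalan_one hs]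
  have h3 : ‖ansatz s (B t) (v t * gaugeW s (u t)) (u t * gaugeW s (u t)) 1‖ ^ 2
      = ‖v t * gaugeW s (u t)‖ ^ 2 := by
    simp only [ansatz, norm_mul, zero_add, pow_zero, mul_one, mul_pow, Complex.norm_real,
      Real.norm_eq_abs, sq_abs, h2, one_mul]
  linarith [(hlt t).2]

end

end ZHam

end

theorem mainTheorem1 (s : ℝ) (hs : 1 < s) :
    -- the critical value of `F`
    ZHam.Fc s = 1 / (s - 1) ∧
    -- the solution with given data on the manifold is unique
    (∀ b c p : ℂ, c ≠ 0 → ‖p‖ ^ 2 < ZHam.xc s →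
      ∀ (J : Set ℝ) (t₀ : ℝ) (α β : ℝ → ℕ → ℂ), J.OrdConnected → t₀ ∈ J →
        ZHam.IsSolutionOn s α J → ZHam.IsSolutionOn s β J →
        α t₀ = ZHam.ansatz s b c p → β t₀ = ZHam.ansatz s b c p →
        ∀ t ∈ J, α t = β t) ∧
    -- condensation in finite time happens exactly when `S = 2(s-1)N`
    (∀ b c p : ℂ, c ≠ 0 → ‖p‖ ^ 2 < ZHam.xc s →
      (ZHam.CondensesInFiniteTime s (ZHam.ansatz s b c p) ↔
        ZHam.Sval s b c p = 2 * (s - 1) * ZHam.particleNumber (ZHam.ansatz s b c p))) ∧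
    -- otherwise the solution is global, stays on the manifold, and `F_c` is never reached
    (∀ b c p : ℂ, c ≠ 0 → ‖p‖ ^ 2 < ZHam.xc s →
      ZHam.Sval s b c p ≠ 2 * (s - 1) * ZHam.particleNumber (ZHam.ansatz s b c p) →
      ∃ B C P : ℝ → ℂ, B 0 = b ∧ C 0 = c ∧ P 0 = p ∧
        ZHam.IsSolutionOn s (fun t => ZHam.ansatz s (B t) (C t) (P t)) Set.univ ∧
        ∃ δ : ℝ, 0 < δ ∧ ∀ t : ℝ, ‖P t‖ ^ 2 < ZHam.xc s ∧
          ZHam.genF s (‖P t‖ ^ 2) ≤ ZHam.Fc s - δ) ∧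
    -- every pair `N, E > 0` is realised by explicit condensing data, which start at `F = F_0`
    (∀ N E : ℝ, 0 < N → 0 < E →
      (ZHam.cInit s N E : ℂ) ≠ 0 ∧
      ‖(ZHam.pInit s N E : ℂ)‖ ^ 2 < ZHam.xc s ∧
      ZHam.particleNumber
        (ZHam.ansatz s (ZHam.bInit s N E) (ZHam.cInit s N E) (ZHam.pInit s N E)) = N ∧
      ZHam.energy
        (ZHam.ansatz s (ZHam.bInit s N E) (ZHam.cInit s N E) (ZHam.pInit s N E)) = E ∧
      ZHam.Sval s (ZHam.bInit s N E) (ZHam.cInit s N E) (ZHam.pInit s N E) = 2 * (s - 1) * N ∧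
      ZHam.genF s (‖(ZHam.pInit s N E : ℂ)‖ ^ 2) = ZHam.F0 s N E) ∧
    -- description of all condensing solutions; `κ` depends on `s`, the constants `C₁`, `C₂` on
    -- `s, N, E`, and `A ξ` on `s, N, E, ξ` only
    (∃ κ : ℝ, 0 < κ ∧ ∀ N E : ℝ, 0 < N → 0 < E →
      ∃ (C₁ C₂ : ℝ) (A : ℝ → ℝ), 0 < C₁ ∧ 0 < C₂ ∧ (∀ ξ : ℝ, 1 / 2 < ξ → 0 < A ξ) ∧
      ∀ b c p : ℂ, ‖p‖ ^ 2 < ZHam.xc s →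
        ZHam.particleNumber (ZHam.ansatz s b c p) = N →
        ZHam.energy (ZHam.ansatz s b c p) = E →
        ZHam.Sval s b c p = 2 * (s - 1) * N →
        ∃ t₀ ∈ Set.Ioo (-ZHam.Tc s N E) (ZHam.Tc s N E), ∃ B C P : ℝ → ℂ,
          -- a solution on `(-T, T)` through the given data (at time `t₀`), on the manifold
          B t₀ = b ∧ C t₀ = c ∧ P t₀ = p ∧
          ZHam.IsSolutionOn s (fun t => ZHam.ansatz s (B t) (C t) (P t))
            (Set.Ioo (-ZHam.Tc s N E) (ZHam.Tc s N E)) ∧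
          (∀ t ∈ Set.Ioo (-ZHam.Tc s N E) (ZHam.Tc s N E),
            ‖P t‖ ^ 2 < ZHam.xc s ∧
            -- the explicit formulas
            ZHam.genF s (‖P t‖ ^ 2) = ZHam.Fsol s N E t ∧
            ‖P t‖ ^ 2 = ZHam.Fsol s N E t / (1 + ZHam.Fsol s N E t) ^ s ∧
            ‖B t‖ ^ 2 = N - E / (ZHam.Fsol s N E t + 1)
              * (1 - ZHam.Fsol s N E t / ZHam.Fc s) ∧
            ‖C t‖ ^ 2 = E / (ZHam.Fsol s N E t + 1) ^ (s + 1)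
              * (1 - ZHam.Fsol s N E t / ZHam.Fc s) ∧
            -- all Sobolev norms are finite before `T`
            ∀ ξ : ℝ, Summable (ZHam.sobolevTerm ξ (ZHam.ansatz s (B t) (C t) (P t)))) ∧
          -- `F_c` is reached at `T` and the system condenses
          Tendsto (ZHam.Fsol s N E) (𝓝[<] (ZHam.Tc s N E)) (𝓝 (ZHam.Fc s)) ∧
          Tendsto (fun t => ‖P t‖ ^ 2) (𝓝[<] (ZHam.Tc s N E)) (𝓝 (ZHam.xc s)) ∧
          ZHam.CondensesAt (fun t => ZHam.ansatz s (B t) (C t) (P t)) N (ZHam.Tc s N E) ∧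
          -- `|α_n|² ~ κ |c|² n^{-3/2} (x/x_c)^{n-1}` as `n → ∞`, uniformly in time, with
          -- `|c|² ~ C₁ (T-t)²` and `1 - x/x_c ~ C₂ (T-t)⁴` as `t → T`
          (∀ ε : ℝ, 0 < ε → ∃ n₀ : ℕ, 1 ≤ n₀ ∧ ∀ n : ℕ, n₀ ≤ n →
            ∀ t ∈ Set.Ioo (-ZHam.Tc s N E) (ZHam.Tc s N E),
            |‖ZHam.ansatz s (B t) (C t) (P t) n‖ ^ 2
                - κ * (‖C t‖ ^ 2 * (n : ℝ) ^ (-(3 / 2) : ℝ)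
                    * (‖P t‖ ^ 2 / ZHam.xc s) ^ (n - 1))|
              ≤ ε * (‖C t‖ ^ 2 * (n : ℝ) ^ (-(3 / 2) : ℝ)
                    * (‖P t‖ ^ 2 / ZHam.xc s) ^ (n - 1))) ∧
          Tendsto (fun t => ‖C t‖ ^ 2 / (ZHam.Tc s N E - t) ^ 2)
            (𝓝[<] (ZHam.Tc s N E)) (𝓝 C₁) ∧
          Tendsto (fun t => (1 - ‖P t‖ ^ 2 / ZHam.xc s) / (ZHam.Tc s N E - t) ^ 4)
            (𝓝[<] (ZHam.Tc s N E)) (𝓝 C₂) ∧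
          -- blow-up of the Sobolev norms
          (∀ ξ : ℝ, 1 / 2 < ξ →
            Tendsto (fun t => ZHam.sobolevNorm ξ (ZHam.ansatz s (B t) (C t) (P t))
                / (ZHam.Tc s N E - t) ^ (2 * (1 - 2 * ξ)))
              (𝓝[<] (ZHam.Tc s N E)) (𝓝 (A ξ)))) := by
  refine ⟨ZHam.Fc_eq hs, ?_, ?_, ?_, ?_, ?_⟩
  · intro b c p _ _ J t₀ α β hJ ht₀ hα hβ hα0 hβ0 t ht
    exact ZHam.isSolutionOn_unique hs hJ ht₀ hα hβ (hα0.trans hβ0.symm) ht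
  · intro b c p hc hp
    exact ⟨ZHam.Sval_eq_of_condensesInFiniteTime hs b hc hp,
      ZHam.condensesInFiniteTime_of_Sval_eq hs b hc hp⟩
  · intro b c p hc hp hS
    have hs1 : 0 < s - 1 := by linarith
    obtain ⟨B, u, v, h, hB, hv, hu, δ, hδ, hlt⟩ := ZHam.exists_global hs b hc hp hS
    have hlt' : ∀ t, (s - 1) * ‖u t‖ ^ 2 < 1 := fun t => by linarith [(hlt t).1]
    -- `(s - 1) F ≤ 1 - δ` and `F_c = 1 / (s - 1)`
    refine ⟨B, _, _, hB, hv, hu, h.isSolutionOn hs fun t _ => hlt' t, δ / (s - 1),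
      by positivity, fun t => ⟨ZHam.norm_sq_mul_gaugeW_lt hs (hlt' t), ?_⟩⟩
    rw [ZHam.genF_mul_gaugeW hs (hlt' t), ZHam.Fc_eq hs, ← sub_div, le_div_iff₀ hs1]
    linarith [(hlt t).1]
  · intro N E hN hE
    exact ⟨ZHam.cInit_ne_zero hs hN hE, ZHam.pInit_lt hs hN hE, ZHam.particleNumber_init hs hN hE,
      ZHam.energy_init hs hN hE, ZHam.Sval_init hs hN hE, ZHam.genF_pInit_eq_F0 hs hN hE⟩
  · refine ⟨ZHam.spectrumConst s, ZHam.spectrumConst_pos hs, fun N E hN hE => ?_⟩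
    have hs0 : 0 < s := by linarith
    have hs1 : 0 < s - 1 := by linarith
    have hD := ZHam.discr_pos hs hN hE
    have hO := ZHam.Omega_pos hs hN hE
    have hx := ZHam.xc_pos hs
    have hκ := ZHam.spectrumConst_pos hs
    -- the limit of `(y - y_c) / (T - t)²`, from which all constants are built
    set R := 4 * (s - 1) * N * E / ZHam.discr s N E * ZHam.Omega s N E ^ 2 with hR
    have hR0 : 0 < R := by positivity
    set C₁ := E * s * R * ((s - 1) / s) ^ s with hC₁
    have hC₁0 : 0 < C₁ := by positivity
    set C₂ := s * ((s - 1) / s) ^ (s - 2) / (2 * ZHam.xc s) * R ^ 2 with hC₂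
    have hC₂0 : 0 < C₂ := by positivity
    refine ⟨C₁, C₂, fun ξ => √(C₁ * (ZHam.spectrumConst s * Real.Gamma (2 * ξ - 1 / 2)) *
      C₂ ^ (-(2 * ξ - 1 / 2))), hC₁0, hC₂0, fun ξ hξ => ?_, ?_⟩
    · have hG : 0 < Real.Gamma (2 * ξ - 1 / 2) := Real.Gamma_pos_of_pos (by linarith)
      positivity
    intro b c p hp hNp hEp hS
    have hc : c ≠ 0 := by
      rintro rfl
      rw [ZHam.energy_ansatz hs b 0 hp] at hEp
      simp at hEp
      exact hE.ne hEp
    obtain ⟨t₀, ht₀, B, u, v, h, hB, hv, hu, hy⟩ := ZHam.exists_condensing hs b hc hp hNp hEp hS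
    have hu1 : ∀ t ∈ Set.Ioo (-ZHam.Tc s N E) (ZHam.Tc s N E), (s - 1) * ‖u t‖ ^ 2 < 1 :=
      fun t ht => ZHam.IsGaugeSolution.normSq_u_lt hs hN hE hy ht
    have hP : ∀ t ∈ Set.Ioo (-ZHam.Tc s N E) (ZHam.Tc s N E),
        ‖u t * ZHam.gaugeW s (u t)‖ ^ 2 < ZHam.xc s :=
      fun t ht => ZHam.norm_sq_mul_gaugeW_lt hs (hu1 t ht)
    have hT := ZHam.Tc_pos hs hN hE
    have hev : ∀ᶠ t in 𝓝[<] (ZHam.Tc s N E), t ∈ Set.Ioo (-ZHam.Tc s N E) (ZHam.Tc s N E) :=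
      Ioo_mem_nhdsLT (by linarith)
    have hPlim := ZHam.IsGaugeSolution.tendsto_normSq_p hs hN hE hy
    have hlimC := h.tendsto_normSq_c hs hN hE hy
    have hlimP := ZHam.IsGaugeSolution.tendsto_one_sub_normSq_p hs hN hE hy
    refine ⟨t₀, ht₀, B, fun t => v t * ZHam.gaugeW s (u t), fun t => u t * ZHam.gaugeW s (u t),
      hB, hv, hu, h.isSolutionOn hs hu1, fun t ht => ?_, ZHam.tendsto_Fsol hs hN hE, hPlim,
      h.condensesAt hs hN hE hy, fun ε hε => ?_, hlimC, hlimP, fun ξ hξ => ?_⟩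
    · have hF : ‖u t‖ ^ 2 = ZHam.Fsol s N E t :=
        ZHam.IsGaugeSolution.normSq_u_eq_Fsol hs hN hE hy t
      have hpos : 0 < 1 + ZHam.Fsol s N E t := by rw [← hF]; positivity
      have hen := h.energy t
      have hpa := h.particle t
      rw [hF] at hen
      have hv2 : ‖v t‖ ^ 2 = E / (ZHam.Fsol s N E t + 1) *
          (1 - ZHam.Fsol s N E t / ZHam.Fc s) := by
        rw [ZHam.Fc_eq hs, eq_comm, add_comm]
        field_simp
        linarith
      refine ⟨hP t ht, ?_, ?_, ?_, ?_, fun ξ => ZHam.summable_sobolevTerm_ansatz hs ξ _ _ (hP t ht)⟩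
      · rw [ZHam.genF_mul_gaugeW hs (hu1 t ht), hF]
      · rw [ZHam.norm_sq_mul_gaugeW_eq, hF, ZHam.genFInv]
      · rw [← hv2]
        linarith
      · have hW := ZHam.gaugeW_sq_mul s (u t)
        rw [hF] at hW
        have hr : 0 < (1 + ZHam.Fsol s N E t) ^ s := Real.rpow_pos_of_pos hpos s
        rw [ZHam.norm_sq_mul_gaugeW, hv2, eq_div_of_mul_eq hr.ne' hW,
          add_comm (ZHam.Fsol s N E t) 1, Real.rpow_add_one hpos.ne']
        field_simp
    · obtain ⟨n₀, hn₀, hn⟩ := ZHam.exists_spectrum hs hε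
      exact ⟨n₀, hn₀, fun n hnn t _ => hn n hnn _ _ _⟩
    · refine ZHam.tendsto_sobolevNorm (N := N) hs hξ hC₂0 ?_ ?_ hPlim hlimC hlimP
      · filter_upwards with t
        linarith [h.particle t, sq_nonneg ‖v t‖]
      · filter_upwards [hev] with t ht using hP t ht
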